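/- Let $M$ be a closed (compact, boundaryless, smooth) manifold of dimension $n$, let $\lambda$ be a smooth positive probability density on $M$, let $\alpha\in(-1,1)$, $p=\frac{2}{1-\alpha}$ and $p^*=\frac{2}{1+\alpha}$. Let $\operatorname{Prob}(M)$ be the space of smooth positive densities $\mu$ with $\int_M\mu=1$, with tangent spaces $T_\mu\operatorname{Prob}(M)=\{a \text{ a smooth density}: \int_M a=0\}$. For real $k>n/2$ let $\operatorname{Prob}^k(M)$ be the space of densities $\mu$ with $\mu/\lambda\in H^k(M)$, $\mu>0$ and $\int_M\mu=1$, with $T_\mu\operatorname{Prob}^k(M)=\{a: a/\lambda\in H^k(M),\ \int_M a=0\}$. Let $\overline\nabla^{(\alpha)}$ be the connection on $\operatorname{Prob}(M)$ induced by the $\alpha$-divergence $$D^{(\alpha)}(\mu\|\nu)=p\int_M\nu+p^*\int_M\mu-p^*p\int_M\Big(\frac{\mu}{\lambda}\Big)^{1/p}\Big(\frac{\nu}{\lambda}\Big)^{1/p^*}\lambda ,$$ that is, $\int_M\frac{\overline\nabla^{(\alpha)}_ab}{\mu}\frac{c}{\mu}\mu=-\partial_\mu\big(\partial_\mu\partial_\nu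 D^{(\alpha)}(\mu\|\nu)[b,c]\big)[a]\big|_{\nu=\mu}$ for tangent $a,b,c$. (1) A $C^2$ path $\mu:[0,1]\to\operatorname{Prob}(M)$ (with respect to the $C^\infty$ topology) is a geodesic of $\overline\nabla^{(\alpha)}$, i.e. $\overline\nabla^{(\alpha)}_{\mu_t}\mu_t=0$, if and only if $$\mu_{tt}-\frac1{p^*}\frac{\mu_t^2}{\mu}=-\frac1{p^*}\left(\int_M\Big(\frac{\mu_t}{\mu}\Big)^2\mu\right)\mu .\qquad(*)$$ (2) Let $k>n/2$, $\mu_0\in\operatorname{Prob}^k(M)$ and $a\in T_{\mu_0}\operatorname{Prob}^k(M)$. Then $(*)$ with $\mu(0)=\mu_0$, $\mu_t(0)=a$ has a unique solution in $\operatorname{Prob}^k(M)$, defined on a maximal interval of existence $[0,T)$, $0<T\le\infty$: there is a solution $\mu:[0,T)\to\operatorname{Prob}^k(M)$, $C^2$ in time with respect to the $H^k$ topology, and every such solution on an interval $[0,S)$ with the same initial conditions satisfies $S\le T$ and coincides with $\mu$ on $[0,S)$. (3) The maximal interval of existence does not depend on the Sobolev order: if the initial conditions are admissible in (2) for both $k$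 and $l$ (with $k,l>n/2$), then the two maximal solutions have the same $T$ and coincide. (4) Consequently the same holds for smooth probability densities: for $\mu_0\in\operatorname{Prob}(M)$ and $a\in T_{\mu_0}\operatorname{Prob}(M)$ there is a unique solution of $(*)$ in $\operatorname{Prob}(M)$, $C^2$ in time with respect to the $C^\infty$ topology, on a maximal interval of existence $[0,T)$, $0<T\le\infty$ (in the sense of (2)); and for every $k>n/2$ this solution, on the same interval $[0,T)$, is the maximal solution in $\operatorname{Prob}^k(M)$. -/

import Mathlib

open scoped Manifold ContDiff Topology FourierTransform
open MeasureTheory Set Filter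

noncomputable section

namespace FisherRao

/-! ## Closed manifolds: localization in charts and smooth volumes

`M` is a manifold of dimension `n` modelled on `EuclideanSpace ℝ (Fin n)`. -/

/-- A smooth chart of `M` together with a smooth cutoff function that is compactly supported in the
image of the chart. -/
structure LocalizedChart (n : ℕ) (M : Type*) [TopologicalSpace M]
    [ChartedSpace (EuclideanSpace ℝ (Fin n)) M] where
  chart : OpenPartialHomeomorph M (EuclideanSpace ℝ (Fin n))
  chart_mem : chart ∈ IsManifold.maximalAtlas (𝓡 n) ∞ M
  cutoff : EuclideanSpace ℝ (Fin n) → ℝ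
  cutoff_contDiff : ContDiff ℝ ∞ cutoff
  cutoff_compact : HasCompactSupport cutoff
  cutoff_support : tsupport cutoff ⊆ chart.target

section Manifold

variable {n : ℕ} {M : Type*} [TopologicalSpace M] [ChartedSpace (EuclideanSpace ℝ (Fin n)) M]

/-- The function `f` on `M`, read in the chart and multiplied by the cutoff: a function on all of
`ℝⁿ` (it vanishes outside the image of the chart, because the cutoff does). -/
def LocalizedChart.localize (c : LocalizedChart n M) (f : M → ℝ) :
    EuclideanSpace ℝ (Fin n) → ℝ :=
  fun y => c.cutoff y * f (c.chart.symm y)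

/-- `lam` is a smooth volume on `M`: in every smooth chart it has a smooth positive density with
respect to Lebesgue measure. -/
def IsSmoothVolume (n : ℕ) {M : Type*} [TopologicalSpace M]
    [ChartedSpace (EuclideanSpace ℝ (Fin n)) M] [MeasurableSpace M] (lam : Measure M) : Prop :=
  ∀ e ∈ IsManifold.maximalAtlas (𝓡 n) ∞ M, ∃ ρ : EuclideanSpace ℝ (Fin n) → ℝ,
    ContDiffOn ℝ ∞ ρ e.target ∧ (∀ y ∈ e.target, 0 < ρ y) ∧
    (lam.restrict e.source).map e =
      (volume.restrict e.target).withDensity (fun y => ENNReal.ofReal (ρ y))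

/-! ## Sobolev functions -/

/-- For a function `g` on `ℝⁿ` this is `ξ ↦ (1 + |ξ|²)^(k/2) ĝ(ξ)`; an integrable function `g` belongs
to `H^k(ℝⁿ)` if and only if this is square integrable, and `‖g‖_{H^k}` is its `L²` norm. -/
def besselFourier (k : ℝ) (g : EuclideanSpace ℝ (Fin n) → ℝ) : EuclideanSpace ℝ (Fin n) → ℂ :=
  fun ξ => (((1 + ‖ξ‖ ^ 2) ^ (k / 2) : ℝ) : ℂ) * 𝓕 (fun y => (g y : ℂ)) ξ

theorem LocalizedChart.continuous_localize (c : LocalizedChart n M) {f : M → ℝ}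
    (hf : Continuous f) : Continuous (c.localize f) := by
  rw [continuous_iff_continuousAt]
  intro y
  by_cases hy : y ∈ tsupport c.cutoff
  · have h1 : ContinuousAt c.chart.symm y :=
      c.chart.continuousAt_symm (c.cutoff_support hy)
    exact c.cutoff_contDiff.continuous.continuousAt.mul (hf.continuousAt.comp h1)
  · have h0 : c.localize f =ᶠ[𝓝 y] fun _ => 0 := by
      filter_upwards [(isClosed_tsupport c.cutoff).isOpen_compl.mem_nhds hy] with z hz
      simp [LocalizedChart.localize, image_eq_zero_of_notMem_tsupport hz]
    exact continuousAt_const.congr h0.symm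

theorem LocalizedChart.integrable_localize (c : LocalizedChart n M) {f : M → ℝ}
    (hf : Continuous f) : Integrable (fun y => (c.localize f y : ℂ)) :=
  ((c.continuous_localize hf).integrable_of_hasCompactSupport
    (c.cutoff_compact.mul_right)).ofReal

theorem LocalizedChart.besselFourier_add (c : LocalizedChart n M) (k : ℝ) {f g : M → ℝ}
    (hf : Continuous f) (hg : Continuous g) :
    besselFourier k (c.localize (f + g)) =
      besselFourier k (c.localize f) + besselFourier k (c.localize g) := by
  have h : (fun y => (c.localize (f + g) y : ℂ)) =
      (fun y => (c.localize f y : ℂ)) + fun y => (c.localize g y : ℂ) := by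
    ext y
    simp [LocalizedChart.localize, mul_add]
  funext ξ
  simp only [besselFourier, h, Pi.add_apply, Real.fourier_eq]
  rw [← mul_add, ← integral_add]
  · congr 2
    ext v
    simp [smul_add]
  · exact (Real.fourierIntegral_convergent_iff ξ).2 (c.integrable_localize hf)
  · exact (Real.fourierIntegral_convergent_iff ξ).2 (c.integrable_localize hg)

theorem LocalizedChart.besselFourier_smul (c : LocalizedChart n M) (k r : ℝ) (f : M → ℝ) :
    besselFourier k (c.localize (r • f)) = (r : ℂ) • besselFourier k (c.localize f) := by
  have h : (fun y => (c.localize (r • f) y : ℂ)) = fun y => (r : ℂ) • (c.localize f y : ℂ) := by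
    ext y
    simp [LocalizedChart.localize]
    ring
  funext ξ
  simp only [besselFourier, h, Pi.smul_apply, Real.fourier_eq, smul_eq_mul]
  rw [mul_left_comm]
  congr 1
  rw [← integral_const_mul]
  congr 1
  funext v
  simp only [Circle.smul_def, smul_eq_mul]
  ring

variable (n M) in
/-- The functions on `M` all of whose localizations lie in `H^k(ℝⁿ)`. A Sobolev class of order
`k > n/2` has exactly one continuous representative, and is represented by it here. -/
def sobolevSubmodule (k : ℝ) : Submodule ℝ (M → ℝ) where
  carrier := {f | Continuous f ∧
    ∀ c : LocalizedChart n M, MemLp (besselFourier k (c.localize f)) 2 volume}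
  zero_mem' := by
    refine ⟨continuous_const, fun c => ?_⟩
    have h : besselFourier k (c.localize (0 : M → ℝ)) = 0 := by
      simpa using c.besselFourier_smul k 0 (0 : M → ℝ)
    rw [h]
    exact MemLp.zero
  add_mem' := by
    rintro f g ⟨hf, hf'⟩ ⟨hg, hg'⟩
    refine ⟨hf.add hg, fun c => ?_⟩
    rw [c.besselFourier_add k hf hg]
    exact (hf' c).add (hg' c)
  smul_mem' := by
    rintro r f ⟨hf, hf'⟩
    refine ⟨hf.const_smul r, fun c => ?_⟩
    rw [c.besselFourier_smul k r f]
    exact (hf' c).const_smul _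

variable (n M) in
/-- The Sobolev space `H^k(M)`, for real `k > n/2`. -/
def SobolevSpace (k : ℝ) : Type _ := sobolevSubmodule n M k

instance SobolevSpace.instAddCommGroup (k : ℝ) : AddCommGroup (SobolevSpace n M k) :=
  inferInstanceAs (AddCommGroup (sobolevSubmodule n M k))

instance SobolevSpace.instModule (k : ℝ) : Module ℝ (SobolevSpace n M k) :=
  inferInstanceAs (Module ℝ (sobolevSubmodule n M k))

instance SobolevSpace.instFunLike (k : ℝ) : FunLike (SobolevSpace n M k) M ℝ where
  coe f := f.1
  coe_injective _ _ h := Subtype.ext h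

/-- The topology of `H^k(M)`: it is the one given by the seminorms `f ↦ ‖localization of f‖_{H^k}`,
over all charts and cutoffs. -/
instance SobolevSpace.instTopologicalSpace (k : ℝ) : TopologicalSpace (SobolevSpace n M k) :=
  ⨅ c : LocalizedChart n M, TopologicalSpace.induced
    (fun f : SobolevSpace n M k => (f.2.2 c).toLp (besselFourier k (c.localize f.1)))
    inferInstance

/-! ## Smooth functions -/

/-- The Fréchet topology of `C^∞(M)`: uniform convergence of all derivatives of all
localizations. -/
instance instTopologicalSpaceSmooth : TopologicalSpace C^∞⟮𝓡 n, M; 𝓘(ℝ, ℝ), ℝ⟯ :=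
  ⨅ (c : LocalizedChart n M) (j : ℕ), TopologicalSpace.induced
    (fun f : C^∞⟮𝓡 n, M; 𝓘(ℝ, ℝ), ℝ⟯ =>
      UniformFun.ofFun (fun y => iteratedFDeriv ℝ j (c.localize f) y))
    inferInstance

end Manifold

/-! ## Probability densities

Densities and tangent vectors are represented by their Radon-Nikodym derivatives with respect to
the smooth probability volume `lam`. -/

section Densities

variable {M : Type*} [MeasurableSpace M]

/-- The density `f lam` is positive of total mass one. -/
def IsProb (lam : Measure M) (f : M → ℝ) : Prop :=
  (∀ x, 0 < f x) ∧ ∫ x, f x ∂lam = 1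

/-- The density `a lam` is tangent to the space of probability densities. -/
def IsTangent (lam : Measure M) (a : M → ℝ) : Prop :=
  ∫ x, a x ∂lam = 0

/-- The exponent `p = 2 / (1 - α)`. -/
def expP (α : ℝ) : ℝ := 2 / (1 - α)

/-- The conjugate exponent `p* = 2 / (1 + α)`. -/
def expPStar (α : ℝ) : ℝ := 2 / (1 + α)

/-- The `α`-divergence `D^(α)(f lam || g lam)`. -/
def alphaDivergence (lam : Measure M) (α : ℝ) (f g : M → ℝ) : ℝ :=
  expP α * ∫ x, g x ∂lam + expPStar α * ∫ x, f x ∂lam -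
    expPStar α * expP α * ∫ x, f x ^ (1 / expP α) * g x ^ (1 / expPStar α) ∂lam

/-- The mixed second derivative `∂_μ ∂_ν D^(α)(μ || ν)[b, c]` at `μ = f lam`, `ν = g lam`. -/
def alphaDivergenceMixed (lam : Measure M) (α : ℝ) (f g b c : M → ℝ) : ℝ :=
  deriv (fun s : ℝ => deriv (fun r : ℝ => alphaDivergence lam α (f + s • b) (g + r • c)) 0) 0

/-- The Fisher-Rao metric `∫ (a/μ) (b/μ) μ` at `μ = f lam`. -/
def fisherRao (lam : Measure M) (f a b : M → ℝ) : ℝ :=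
  ∫ x, (a x / f x) * (b x / f x) * f x ∂lam

/-- The geodesic equation of the `α`-connection, for position `f`, velocity `v` and
acceleration `w` at one instant:
`μ_tt - (1/p*) μ_t² / μ = - (1/p*) (∫ (μ_t/μ)² μ) μ`. -/
def GeodesicEquation (lam : Measure M) (α : ℝ) (f v w : M → ℝ) : Prop :=
  ∀ x, w x - 1 / expPStar α * (v x ^ 2 / f x) =
    - (1 / expPStar α) * (∫ y, (v y / f y) ^ 2 * f y ∂lam) * f x

end Densities

/-! ## Curves -/

/-- `u` is a twice continuously differentiable curve on `J ⊆ ℝ` in the topological vector space `X`,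
with first derivative `v` and second derivative `w` (limits of difference quotients within `J`). -/
structure IsC2Curve {X : Type*} [AddCommGroup X] [Module ℝ X] [TopologicalSpace X]
    (J : Set ℝ) (u v w : ℝ → X) : Prop where
  velocity : ∀ t ∈ J, Tendsto (slope u t) (𝓝[J \ {t}] t) (𝓝 (v t))
  acceleration : ∀ t ∈ J, Tendsto (slope v t) (𝓝[J \ {t}] t) (𝓝 (w t))
  continuousOn : ContinuousOn w J

section Connection

variable {n : ℕ} {M : Type*} [TopologicalSpace M] [ChartedSpace (EuclideanSpace ℝ (Fin n)) M]
  [MeasurableSpace M]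

/-- `d` is the covariant derivative `∇^(α) b` at time `t` of the vector field `b` along the curve `u`
in the space of smooth probability densities, for the connection induced by the `α`-divergence
restricted to that space: `d` is tangent and, for all tangent vectors `c`,
`G_{u(t)}(d, c) = - d/ds ∂_μ ∂_ν D^(α)(u(s) || u(t))[b(s), c]` at `s = t`.
If `b` is the restriction of a vector field to the curve this is the relation
`G_μ(∇_a b, c) = - ∂_μ (∂_μ ∂_ν D^(α)(μ || ν)[b, c])[a]` at `ν = μ`, with `a` the velocity of `u`. -/
def IsAlphaCovDeriv (lam : Measure M) (α : ℝ) (J : Set ℝ)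
    (u b : ℝ → C^∞⟮𝓡 n, M; 𝓘(ℝ, ℝ), ℝ⟯) (t : ℝ) (d : C^∞⟮𝓡 n, M; 𝓘(ℝ, ℝ), ℝ⟯) : Prop :=
  IsTangent lam d ∧ ∀ c : C^∞⟮𝓡 n, M; 𝓘(ℝ, ℝ), ℝ⟯, IsTangent lam c →
    HasDerivWithinAt (fun s => alphaDivergenceMixed lam α (u s) (u t) (b s) c)
      (- fisherRao lam (u t) d c) J t

/-- The curve `u` with velocity `v` is a geodesic on `J`: the covariant derivative of its velocity
vanishes. -/
def IsAlphaGeodesic (lam : Measure M) (α : ℝ) (J : Set ℝ)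
    (u v : ℝ → C^∞⟮𝓡 n, M; 𝓘(ℝ, ℝ), ℝ⟯) : Prop :=
  ∀ t ∈ J, IsAlphaCovDeriv lam α J u v t 0

end Connection

/-! ## The initial value problem -/

/-- The time interval `[0, T)`, with `T = ∞` allowed. -/
def timeInterval (T : EReal) : Set ℝ := {t | 0 ≤ t ∧ (t : EReal) < T}

section Solutions

variable {M : Type*} [MeasurableSpace M] {X : Type*} [AddCommGroup X] [Module ℝ X]
  [TopologicalSpace X] [FunLike X M ℝ]

/-- `u` solves on `[0, T)` the geodesic equation with initial position `f` and initial velocity `a`,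
as a curve of probability densities in the function space `X`. -/
def IsGeodesicSolution (lam : Measure M) (α : ℝ) (f a : X) (T : EReal) (u : ℝ → X) : Prop :=
  0 < T ∧ ∃ v w : ℝ → X, IsC2Curve (timeInterval T) u v w ∧ u 0 = f ∧ v 0 = a ∧
    ∀ t ∈ timeInterval T, IsProb lam (u t) ∧ GeodesicEquation lam α (u t) (v t) (w t)

/-- `u` is the unique solution, and `[0, T)` is its maximal interval of existence: every solution
with the same initial data lives on a smaller interval, and coincides there with `u`. -/
def IsMaximalGeodesicSolution (lam : Measure M) (α : ℝ) (f a : X) (T : EReal) (u : ℝ → X) :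
    Prop :=
  IsGeodesicSolution lam α f a T u ∧
    ∀ (S : EReal) (u' : ℝ → X), IsGeodesicSolution lam α f a S u' →
      S ≤ T ∧ ∀ t ∈ timeInterval S, u' t = u t

end Solutions

end FisherRao

end

/-! Densities are taken relative to λ. Write μ = f G^p with f = μ(0) and G > 0. The quadratic term
of (*) is exactly the one this substitution removes: (*) becomes G_tt = c(t) G, where c = -(1/(p
p*)) ∫ (μ_t/μ)² μ does not depend on the point. So at all points of M the functions t ↦ G(x,t) solve
one linear equation of second order, with data 1 and φ(x) = a(x)/(p f(x)), and therefore G = A(t) (1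
+ τ(t) φ(x)) with A(0) = 1 and A'(0) = 0. The constant Wronskian gives τ' = A^(-2), and unit mass
gives A^p Z(τ) = 1 with Z(τ) = ∫ f (1 + τφ)^p. Hence dt = Z^(-2/p) dτ, and the problem is solved by
one quadrature, the `clock`.

The solution lives as long as 1 + τφ stays positive, so its lifetime is the supremum of the clock
over the interval of such τ with 1 + τφ > 0. This number, and the formula for the solution, involve
only the functions f and a and no Sobolev order, which is why (3) and (4) hold. Uniqueness
(`isExplicitPosition_of_geodesicEquation`) needs only pointwise derivatives in time: a solution on
any interval is given by the formula, hence cannot reach the lifetime.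

Existence in H^k rests on the fact that τ ↦ b (1 + τφ)^s is a differentiable curve in H^k
(`sobolev_rpow_curve`). In a chart the compactly supported H^k functions with a unit adjoined form a
commutative Banach algebra. A positive 1 + φ is invertible there: a product estimate that costs only
one H^k factor, with an interpolation bound for the other, shows that squaring loses less than the
decay of the values gains (`exists_norm_sq_le`, `isUnit_one_sub_of_norm_sq_le`). Real powers are
then exponentials of an integrated logarithmic derivative (`exists_rpow_curve`). The smooth case
follows from all orders k together by Sobolev embedding.

For (1), differentiating the divergence gives the covariant derivative of the velocity as μ_tt -
(1/p*) μ_t²/μ, up to a multiple of μ that tangent test vectors do not see; conservation of mass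
determines this multiple. -/

noncomputable section

namespace FisherRao

open scoped ENNReal NNReal

/-! ### Wiener norm, Sobolev norm and products on ℝⁿ. -/

section FourierSide

variable {n : ℕ}

/-- The Fourier transform of a real-valued function. -/
def realFourier (g : EuclideanSpace ℝ (Fin n) → ℝ) : EuclideanSpace ℝ (Fin n) → ℂ :=
  𝓕 (fun y => (g y : ℂ))

/-- The total mass of the Fourier transform. -/
def wienerNorm (g : EuclideanSpace ℝ (Fin n) → ℝ) : ℝ≥0∞ := ∫⁻ ξ, ‖realFourier g ξ‖ₑ

/-- The `H^k`-norm of `g`. -/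
def sobolevENorm (k : ℝ) (g : EuclideanSpace ℝ (Fin n) → ℝ) : ℝ≥0∞ :=
  eLpNorm (besselFourier k g) 2 volume

theorem besselFourier_apply (k : ℝ) (g : EuclideanSpace ℝ (Fin n) → ℝ)
    (ξ : EuclideanSpace ℝ (Fin n)) :
    besselFourier k g ξ = (((1 + ‖ξ‖ ^ 2) ^ (k / 2) : ℝ) : ℂ) * realFourier g ξ := rfl

theorem enorm_besselFourier (k : ℝ) (g : EuclideanSpace ℝ (Fin n) → ℝ)
    (ξ : EuclideanSpace ℝ (Fin n)) :
    ‖besselFourier k g ξ‖ₑ =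
      ENNReal.ofReal ((1 + ‖ξ‖ ^ 2) ^ (k / 2)) * ‖realFourier g ξ‖ₑ := by
  rw [besselFourier_apply, enorm_mul]
  congr 1
  rw [← ofReal_norm, Complex.norm_real, Real.norm_of_nonneg (by positivity)]

theorem continuous_realFourier {g : EuclideanSpace ℝ (Fin n) → ℝ} (hg : Integrable g) :
    Continuous (realFourier g) :=
  VectorFourier.fourierIntegral_continuous Real.continuous_fourierChar
    (by exact continuous_inner) hg.ofReal

theorem continuous_besselFourier (k : ℝ) {g : EuclideanSpace ℝ (Fin n) → ℝ} (hg : Integrable g) :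
    Continuous (besselFourier k g) := by
  refine Continuous.mul (Complex.continuous_ofReal.comp ?_) (continuous_realFourier hg)
  refine Continuous.rpow_const (by fun_prop) fun ξ => Or.inl ?_
  positivity

theorem enorm_realFourier_le (g : EuclideanSpace ℝ (Fin n) → ℝ) (ξ : EuclideanSpace ℝ (Fin n)) :
    ‖realFourier g ξ‖ₑ ≤ ∫⁻ y, ‖g y‖ₑ := by
  rw [realFourier, Real.fourier_eq]
  refine (enorm_integral_le_lintegral_enorm _).trans (le_of_eq ?_)
  refine lintegral_congr fun y => ?_
  rw [← ofReal_norm, ← ofReal_norm, Circle.norm_smul, Complex.norm_real]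

theorem sobolevENorm_eq (k : ℝ) (g : EuclideanSpace ℝ (Fin n) → ℝ) :
    sobolevENorm k g = (∫⁻ ξ, ‖besselFourier k g ξ‖ₑ ^ (2 : ℝ)) ^ (1 / 2 : ℝ) := by
  simp [sobolevENorm, eLpNorm_eq_lintegral_rpow_enorm_toReal]

/-- Bound |ĝ|^(1-θ) by B^(1-θ), and apply Hölder with exponents θ/2 and 1 - θ/2 to |ĝ|^θ against the
weight w, which is integrable because r > n. The positive power of B is the gain that later makes
squaring in H^k cheap for functions with small values. -/
theorem wienerNorm_le_of_lt {k θ : ℝ} (hθ : 0 < θ) (hθ1 : θ ≤ 1)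
    (hk : (n : ℝ) < 2 * k * θ / (2 - θ)) :
    ∃ C : ℝ≥0, ∀ g : EuclideanSpace ℝ (Fin n) → ℝ, Integrable g → ∀ B : ℝ≥0∞,
      (∀ ξ, ‖realFourier g ξ‖ₑ ≤ B) →
      wienerNorm g ≤ C * B ^ (1 - θ) * sobolevENorm k g ^ θ := by
  set r := 2 * k * θ / (2 - θ) with hr
  set w : EuclideanSpace ℝ (Fin n) → ℝ≥0∞ := fun ξ => ENNReal.ofReal ((1 + ‖ξ‖ ^ 2) ^ (-r / 2))
    with hw
  have hwm : Measurable w := by fun_prop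
  have hwfin : ∫⁻ ξ, w ξ ≠ ⊤ := by
    have h := integrable_rpow_neg_one_add_norm_sq (E := EuclideanSpace ℝ (Fin n))
      (μ := volume) (r := r) (by simpa using hk)
    have := h.lintegral_lt_top
    exact this.ne
  refine ⟨((∫⁻ ξ, w ξ) ^ (1 - θ / 2)).toNNReal, fun g hg B hB => ?_⟩
  rw [ENNReal.coe_toNNReal (ENNReal.rpow_ne_top_of_nonneg (by linarith) hwfin)]
  have hpt : ∀ ξ, ‖realFourier g ξ‖ₑ ≤
      B ^ (1 - θ) * ((‖besselFourier k g ξ‖ₑ ^ (2 : ℝ)) ^ (θ / 2) * w ξ ^ (1 - θ / 2)) := by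
    intro ξ
    have h1 : (0 : ℝ) < 1 + ‖ξ‖ ^ 2 := by positivity
    have e1 : (‖besselFourier k g ξ‖ₑ ^ (2 : ℝ)) ^ (θ / 2) * w ξ ^ (1 - θ / 2) =
        ‖realFourier g ξ‖ₑ ^ θ := by
      rw [← ENNReal.rpow_mul, enorm_besselFourier, ENNReal.mul_rpow_of_nonneg _ _ (by linarith),
        hw, ENNReal.ofReal_rpow_of_pos (by positivity), ENNReal.ofReal_rpow_of_pos (by positivity),
        ← Real.rpow_mul h1.le, ← Real.rpow_mul h1.le, mul_right_comm,
        ← ENNReal.ofReal_mul (by positivity), ← Real.rpow_add h1]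
      have : k / 2 * (2 * (θ / 2)) + -r / 2 * (1 - θ / 2) = 0 := by
        have h2 : (2 - θ) ≠ 0 := by linarith
        rw [hr]; field_simp; ring
      rw [this]
      simp only [Real.rpow_zero, ENNReal.ofReal_one, one_mul]
      congr 1; ring
    rw [e1]
    calc ‖realFourier g ξ‖ₑ = ‖realFourier g ξ‖ₑ ^ ((1 - θ) + θ) := by simp
      _ = ‖realFourier g ξ‖ₑ ^ (1 - θ) * ‖realFourier g ξ‖ₑ ^ θ :=
        ENNReal.rpow_add_of_nonneg _ _ (by linarith) hθ.le
      _ ≤ _ := by gcongr; exact hB ξ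
  have hbm : Measurable (fun ξ => ‖besselFourier k g ξ‖ₑ ^ (2 : ℝ)) :=
    ((continuous_besselFourier k hg).measurable.enorm).pow_const _
  calc wienerNorm g ≤ ∫⁻ ξ, B ^ (1 - θ) *
        ((‖besselFourier k g ξ‖ₑ ^ (2 : ℝ)) ^ (θ / 2) * w ξ ^ (1 - θ / 2)) :=
        lintegral_mono hpt
    _ = B ^ (1 - θ) * ∫⁻ ξ, (‖besselFourier k g ξ‖ₑ ^ (2 : ℝ)) ^ (θ / 2) * w ξ ^ (1 - θ / 2) := by
        rw [lintegral_const_mul]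
        exact (hbm.pow_const _).mul (hwm.pow_const _)
    _ ≤ B ^ (1 - θ) * ((∫⁻ ξ, ‖besselFourier k g ξ‖ₑ ^ (2 : ℝ)) ^ (θ / 2) *
        (∫⁻ ξ, w ξ) ^ (1 - θ / 2)) := by
        gcongr
        exact ENNReal.lintegral_mul_norm_pow_le hbm.aemeasurable hwm.aemeasurable (by linarith)
          (by linarith) (by ring)
    _ = _ := by
        rw [sobolevENorm_eq, ← ENNReal.rpow_mul]
        rw [show (1 / 2 * θ : ℝ) = θ / 2 by ring]
        ring

/-- Young's inequality for the convolution of an `L²` and an `L¹` function. -/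
theorem lintegral_convolution_sq_le {a b : EuclideanSpace ℝ (Fin n) → ℝ≥0∞} (ha : Measurable a)
    (hb : Measurable b) :
    ∫⁻ ξ, (∫⁻ η, a (ξ - η) * b η) ^ (2 : ℝ) ≤ (∫⁻ η, b η) ^ (2 : ℝ) * ∫⁻ ξ, a ξ ^ (2 : ℝ) := by
  have h1 : ∀ ξ, (∫⁻ η, a (ξ - η) * b η) ^ (2 : ℝ) ≤
      (∫⁻ η, a (ξ - η) ^ (2 : ℝ) * b η) * ∫⁻ η, b η := by
    intro ξ
    -- Cauchy–Schwarz with the factor b split evenly between the two sides.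
    have e : ∀ η, a (ξ - η) * b η =
        (a (ξ - η) ^ (2 : ℝ) * b η) ^ (1 / 2 : ℝ) * b η ^ (1 / 2 : ℝ) := by
      intro η
      rw [ENNReal.mul_rpow_of_nonneg _ _ (by norm_num), ← ENNReal.rpow_mul, mul_assoc,
        ← ENNReal.rpow_add_of_nonneg _ _ (by norm_num) (by norm_num)]
      norm_num
    have ha' : Measurable fun η => a (ξ - η) := ha.comp (measurable_const.sub measurable_id)
    have h := ENNReal.lintegral_mul_norm_pow_le (μ := (volume : Measure (EuclideanSpace ℝ (Fin n))))
      (f := fun η => a (ξ - η) ^ (2 : ℝ) * b η) (g := b) (p := 1 / 2) (q := 1 / 2)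
      ((ha'.pow_const _).mul hb).aemeasurable hb.aemeasurable
      (by norm_num) (by norm_num) (by norm_num)
    rw [lintegral_congr e]
    calc _ ≤ ((∫⁻ η, a (ξ - η) ^ (2 : ℝ) * b η) ^ (1 / 2 : ℝ) *
          (∫⁻ η, b η) ^ (1 / 2 : ℝ)) ^ (2 : ℝ) := by gcongr
      _ = _ := by
        rw [ENNReal.mul_rpow_of_nonneg _ _ (by norm_num), ← ENNReal.rpow_mul, ← ENNReal.rpow_mul]
        norm_num
  have hm : Measurable fun p : EuclideanSpace ℝ (Fin n) × EuclideanSpace ℝ (Fin n) =>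
      a (p.1 - p.2) ^ (2 : ℝ) * b p.2 :=
    ((ha.comp (measurable_fst.sub measurable_snd)).pow_const _).mul (hb.comp measurable_snd)
  calc _ ≤ ∫⁻ ξ, (∫⁻ η, a (ξ - η) ^ (2 : ℝ) * b η) * ∫⁻ η, b η := lintegral_mono h1
    _ = (∫⁻ ξ, ∫⁻ η, a (ξ - η) ^ (2 : ℝ) * b η) * ∫⁻ η, b η :=
        lintegral_mul_const _ (Measurable.lintegral_prod_right' hm)
    _ = (∫⁻ η, ∫⁻ ξ, a (ξ - η) ^ (2 : ℝ) * b η) * ∫⁻ η, b η := by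
        rw [lintegral_lintegral_swap hm.aemeasurable]
    _ = (∫⁻ η, (∫⁻ ξ, a ξ ^ (2 : ℝ)) * b η) * ∫⁻ η, b η := by
        congr 1
        refine lintegral_congr fun η => ?_
        have hm' : Measurable fun ξ => a (ξ - η) ^ (2 : ℝ) :=
          (ha.comp (measurable_id.sub_const η)).pow_const _
        rw [lintegral_mul_const _ hm']
        congr 1
        exact lintegral_sub_right_eq_self (fun ξ => a ξ ^ (2 : ℝ)) η
    _ = _ := by
        rw [lintegral_const_mul _ hb, ENNReal.rpow_two]
        ring

theorem integrable_realFourier_of_ne_top {g : EuclideanSpace ℝ (Fin n) → ℝ} (hg : Integrable g)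
    (h : wienerNorm g ≠ ⊤) : Integrable (realFourier g) :=
  ⟨(continuous_realFourier hg).aestronglyMeasurable, lt_top_iff_ne_top.2 h⟩

theorem fourierInv_realFourier {g : EuclideanSpace ℝ (Fin n) → ℝ} (hc : Continuous g)
    (hg : Integrable g) (h : wienerNorm g ≠ ⊤) (y : EuclideanSpace ℝ (Fin n)) :
    (g y : ℂ) = 𝓕⁻ (realFourier g) y := by
  have := Continuous.fourierInv_fourier_eq (f := fun y => (g y : ℂ))
    (Complex.continuous_ofReal.comp hc) hg.ofReal (integrable_realFourier_of_ne_top hg h)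
  exact (congrFun this y).symm

theorem enorm_le_wienerNorm {g : EuclideanSpace ℝ (Fin n) → ℝ} (hc : Continuous g)
    (hg : Integrable g) (y : EuclideanSpace ℝ (Fin n)) : ‖g y‖ₑ ≤ wienerNorm g := by
  by_cases h : wienerNorm g = ⊤
  · simp [h]
  have h1 : ‖g y‖ₑ = ‖(g y : ℂ)‖ₑ := by
    rw [← ofReal_norm, ← ofReal_norm, Complex.norm_real]
  rw [h1, fourierInv_realFourier hc hg h, Real.fourierInv_eq]
  refine (enorm_integral_le_lintegral_enorm _).trans (le_of_eq ?_)
  refine lintegral_congr fun ξ => ?_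
  rw [← ofReal_norm, ← ofReal_norm, Circle.norm_smul]

/-- The Fourier transform of a product is the convolution of the Fourier transforms. -/
theorem realFourier_mul {f g : EuclideanSpace ℝ (Fin n) → ℝ} (hf : Integrable f)
    (hgc : Continuous g) (hg : Integrable g) (h : wienerNorm g ≠ ⊤)
    (ξ : EuclideanSpace ℝ (Fin n)) :
    realFourier (fun y => f y * g y) ξ = ∫ η, realFourier f (ξ - η) * realFourier g η := by
  have hG := integrable_realFourier_of_ne_top hg h
  -- Fourier inversion replaces g(y) by an integral; Fubini then gives the convolution.
  have e1 : ∀ y, Real.fourierChar (-inner ℝ y ξ) • ((f y * g y : ℝ) : ℂ) =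
      ∫ η, (Real.fourierChar (-inner ℝ y (ξ - η)) : ℂ) * f y * realFourier g η := by
    intro y
    push_cast
    rw [fourierInv_realFourier hgc hg h, Real.fourierInv_eq, Circle.smul_def, smul_eq_mul,
      ← mul_assoc, ← integral_const_mul]
    refine integral_congr_ae (Eventually.of_forall fun η => ?_)
    simp only [Circle.smul_def, smul_eq_mul]
    have : (-inner ℝ y (ξ - η) : ℝ) = -inner ℝ y ξ + inner ℝ η y := by
      rw [inner_sub_right, real_inner_comm η y]; ring
    rw [this, AddChar.map_add_eq_mul, Circle.coe_mul]
    ring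
  rw [realFourier, Real.fourier_eq]
  simp_rw [e1]
  rw [integral_integral_swap]
  · refine integral_congr_ae (Eventually.of_forall fun η => ?_)
    simp only [integral_mul_const]
    congr 1
  · have h0 : Integrable (fun p : EuclideanSpace ℝ (Fin n) × EuclideanSpace ℝ (Fin n) =>
        (f p.1 : ℂ) * realFourier g p.2) (volume.prod volume) := hf.ofReal.mul_prod hG
    refine h0.mono ?_ (Eventually.of_forall fun p => ?_)
    · refine AEStronglyMeasurable.congr (f := fun p : EuclideanSpace ℝ (Fin n) ×
        EuclideanSpace ℝ (Fin n) => (Real.fourierChar (-inner ℝ p.1 (ξ - p.2)) : ℂ) *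
          ((f p.1 : ℂ) * realFourier g p.2)) ?_ (Eventually.of_forall fun p => ?_)
      · refine AEStronglyMeasurable.mul (Continuous.aestronglyMeasurable ?_) h0.1
        exact continuous_subtype_val.comp (Real.continuous_fourierChar.comp (by fun_prop))
      · simp only [Function.uncurry]; ring
    · simp [Function.uncurry, Circle.norm_coe]

/-- One of |ξ - η|, |η| is at least |ξ|/2. This moves the Sobolev weight of a product onto one of
its factors. -/
theorem one_add_norm_sq_rpow_le {k : ℝ} (hk : 0 ≤ k) (ξ η : EuclideanSpace ℝ (Fin n)) :
    (1 + ‖ξ‖ ^ 2) ^ (k / 2) ≤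
      4 ^ (k / 2) * ((1 + ‖ξ - η‖ ^ 2) ^ (k / 2) + (1 + ‖η‖ ^ 2) ^ (k / 2)) := by
  set A := 1 + ‖ξ - η‖ ^ 2
  set B := 1 + ‖η‖ ^ 2
  have h0 : ‖ξ‖ ≤ ‖ξ - η‖ + ‖η‖ := by simpa using norm_add_le (ξ - η) η
  have h1 : 1 + ‖ξ‖ ^ 2 ≤ 4 * max A B := by
    have hA : A ≤ max A B := le_max_left _ _
    have hB : B ≤ max A B := le_max_right _ _
    have : ‖ξ‖ ^ 2 ≤ (‖ξ - η‖ + ‖η‖) ^ 2 := by gcongr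
    nlinarith [sq_nonneg (‖ξ - η‖ - ‖η‖), show A = 1 + ‖ξ - η‖ ^ 2 from rfl,
      show B = 1 + ‖η‖ ^ 2 from rfl]
  have hA0 : 0 ≤ A := by positivity
  have hB0 : 0 ≤ B := by positivity
  calc (1 + ‖ξ‖ ^ 2) ^ (k / 2) ≤ (4 * max A B) ^ (k / 2) := by gcongr
    _ = 4 ^ (k / 2) * (max A B) ^ (k / 2) := Real.mul_rpow (by norm_num) (le_max_of_le_left hA0)
    _ ≤ _ := by
      gcongr
      have := Real.rpow_nonneg hA0 (k / 2)
      have := Real.rpow_nonneg hB0 (k / 2)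
      rcases max_cases A B with ⟨h, _⟩ | ⟨h, _⟩ <;> rw [h] <;> linarith

/-- The transform of the product is a convolution; distribute the weight over the two factors and
apply Young's inequality L² * L¹ to each term. Each term carries the H^k-norm of only one factor,
which is essential for the spectral radius estimate. -/
theorem sobolevENorm_mul_le {k : ℝ} (hk : 0 ≤ k) {f g : EuclideanSpace ℝ (Fin n) → ℝ}
    (hf : Integrable f) (hgc : Continuous g) (hg : Integrable g) (h : wienerNorm g ≠ ⊤) :
    sobolevENorm k (fun y => f y * g y) ≤ ENNReal.ofReal (4 ^ (k / 2)) *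
      (sobolevENorm k f * wienerNorm g + wienerNorm f * sobolevENorm k g) := by
  set a : EuclideanSpace ℝ (Fin n) → ℝ≥0∞ := fun ξ => ‖besselFourier k f ξ‖ₑ
  set b : EuclideanSpace ℝ (Fin n) → ℝ≥0∞ := fun ξ => ‖realFourier g ξ‖ₑ
  set a' : EuclideanSpace ℝ (Fin n) → ℝ≥0∞ := fun ξ => ‖besselFourier k g ξ‖ₑ
  set b' : EuclideanSpace ℝ (Fin n) → ℝ≥0∞ := fun ξ => ‖realFourier f ξ‖ₑ
  have ha : Measurable a := (continuous_besselFourier k hf).measurable.enorm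
  have hb : Measurable b := (continuous_realFourier hg).measurable.enorm
  have ha' : Measurable a' := (continuous_besselFourier k hg).measurable.enorm
  have hb' : Measurable b' := (continuous_realFourier hf).measurable.enorm
  have hconv : ∀ {u v : EuclideanSpace ℝ (Fin n) → ℝ≥0∞}, Measurable u → Measurable v →
      Measurable fun ξ => ∫⁻ η, u (ξ - η) * v η := fun hu hv =>
    Measurable.lintegral_prod_right' (f := fun p : EuclideanSpace ℝ (Fin n) ×
      EuclideanSpace ℝ (Fin n) => _) ((hu.comp (measurable_fst.sub measurable_snd)).mul
      (hv.comp measurable_snd))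
  have hpt : ∀ ξ, ‖besselFourier k (fun y => f y * g y) ξ‖ₑ ≤ ENNReal.ofReal (4 ^ (k / 2)) *
      ((∫⁻ η, a (ξ - η) * b η) + ∫⁻ η, a' (ξ - η) * b' η) := by
    intro ξ
    have hsw : ∫⁻ η, a' (ξ - η) * b' η = ∫⁻ η, a' η * b' (ξ - η) := by
      rw [← lintegral_sub_left_eq_self (fun η => a' η * b' (ξ - η)) ξ]
      simp
    have hm1 : Measurable fun η => a (ξ - η) * b η :=
      (ha.comp (measurable_const.sub measurable_id)).mul hb
    have hm2 : Measurable fun η => b' (ξ - η) := hb'.comp (measurable_const.sub measurable_id)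
    have hm3 : Measurable fun η => a (ξ - η) * b η + a' η * b' (ξ - η) := hm1.add (ha'.mul hm2)
    rw [hsw, ← lintegral_add_left hm1, enorm_besselFourier, realFourier_mul hf hgc hg h,
      ← lintegral_const_mul _ hm3]
    calc _ ≤ ENNReal.ofReal ((1 + ‖ξ‖ ^ 2) ^ (k / 2)) *
          ∫⁻ η, ‖realFourier f (ξ - η) * realFourier g η‖ₑ := by
          gcongr; exact enorm_integral_le_lintegral_enorm _
      _ = ∫⁻ η, ENNReal.ofReal ((1 + ‖ξ‖ ^ 2) ^ (k / 2)) * (b' (ξ - η) * b η) := by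
          have hm5 : Measurable fun η => b' (ξ - η) * b η := hm2.mul hb
          rw [lintegral_const_mul _ hm5]
          simp only [enorm_mul, b, b']
      _ ≤ _ := by
          refine lintegral_mono fun η => ?_
          calc _ ≤ ENNReal.ofReal (4 ^ (k / 2) * ((1 + ‖ξ - η‖ ^ 2) ^ (k / 2) +
                (1 + ‖η‖ ^ 2) ^ (k / 2))) * (b' (ξ - η) * b η) := by
                gcongr; exact one_add_norm_sq_rpow_le hk ξ η
            _ = _ := by
                rw [ENNReal.ofReal_mul (by positivity), ENNReal.ofReal_add (by positivity)
                  (by positivity)]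
                simp only [a, b, a', b', enorm_besselFourier]
                ring
  have hY : ∀ {u v : EuclideanSpace ℝ (Fin n) → ℝ≥0∞}, Measurable u → Measurable v →
      eLpNorm (fun ξ => ∫⁻ η, u (ξ - η) * v η) 2 volume ≤
        (∫⁻ ξ, u ξ ^ (2 : ℝ)) ^ (1 / 2 : ℝ) * ∫⁻ η, v η := by
    intro u v hu hv
    rw [eLpNorm_eq_lintegral_rpow_enorm_toReal (by norm_num) (by norm_num)]
    simp only [ENNReal.toReal_ofNat, enorm_eq_self]
    calc _ ≤ ((∫⁻ η, v η) ^ (2 : ℝ) * ∫⁻ ξ, u ξ ^ (2 : ℝ)) ^ (1 / 2 : ℝ) := by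
          gcongr; exact lintegral_convolution_sq_le hu hv
      _ = _ := by
          rw [ENNReal.mul_rpow_of_nonneg _ _ (by norm_num), ← ENNReal.rpow_mul]
          norm_num [mul_comm]
  calc sobolevENorm k (fun y => f y * g y)
      ≤ eLpNorm (ENNReal.ofReal (4 ^ (k / 2)) • ((fun ξ => ∫⁻ η, a (ξ - η) * b η) +
          fun ξ => ∫⁻ η, a' (ξ - η) * b' η)) 2 volume := by
        refine eLpNorm_mono_enorm fun ξ => ?_
        simpa using hpt ξ
    _ ≤ ENNReal.ofReal (4 ^ (k / 2)) * eLpNorm ((fun ξ => ∫⁻ η, a (ξ - η) * b η) +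
          fun ξ => ∫⁻ η, a' (ξ - η) * b' η) 2 volume := by
        rw [eLpNorm_eq_lintegral_rpow_enorm_toReal (by norm_num) (by norm_num),
          eLpNorm_eq_lintegral_rpow_enorm_toReal (by norm_num) (by norm_num)]
        simp only [Pi.smul_apply, Pi.add_apply, smul_eq_mul, enorm_eq_self, ENNReal.toReal_ofNat]
        simp_rw [ENNReal.mul_rpow_of_nonneg _ _ (show (0 : ℝ) ≤ 2 by norm_num)]
        have hm4 : Measurable fun x => ((∫⁻ η, a (x - η) * b η) +
            ∫⁻ η, a' (x - η) * b' η) ^ (2 : ℝ) := ((hconv ha hb).add (hconv ha' hb')).pow_const _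
        rw [lintegral_const_mul _ hm4,
          ENNReal.mul_rpow_of_nonneg _ _ (by norm_num), ← ENNReal.rpow_mul]
        norm_num
    _ ≤ _ := by
        gcongr
        refine (eLpNorm_add_le (hconv ha hb).aestronglyMeasurable
          (hconv ha' hb').aestronglyMeasurable (by norm_num)).trans ?_
        rw [sobolevENorm_eq, sobolevENorm_eq, mul_comm (wienerNorm f)]
        exact add_le_add (hY ha hb) (hY ha' hb')

end FourierSide

end FisherRao

end

noncomputable section

namespace FisherRao

open scoped ENNReal NNReal

/-! ### Sobolev embedding on ℝⁿ. -/

section FourierSide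

variable {n : ℕ}

/-- Cauchy–Schwarz against (1 + |ξ|²)^(-(k-j)), integrable since 2(k - j) > n. The case j = 0 bounds
the Wiener norm, natural numbers j give the embedding into C^j. -/
theorem lintegral_besselFourier_le {j k : ℝ} (hk : (n : ℝ) < 2 * (k - j)) :
    ∃ C : ℝ≥0, ∀ g : EuclideanSpace ℝ (Fin n) → ℝ, Integrable g →
      ∫⁻ ξ, ‖besselFourier j g ξ‖ₑ ≤ C * sobolevENorm k g := by
  set w : EuclideanSpace ℝ (Fin n) → ℝ≥0∞ := fun ξ =>
    ENNReal.ofReal ((1 + ‖ξ‖ ^ 2) ^ (-(2 * (k - j)) / 2)) with hw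
  have hwm : Measurable w := by fun_prop
  have hwfin : ∫⁻ ξ, w ξ ≠ ⊤ :=
    (integrable_rpow_neg_one_add_norm_sq (E := EuclideanSpace ℝ (Fin n))
      (μ := volume) (r := 2 * (k - j)) (by simpa using hk)).lintegral_lt_top.ne
  refine ⟨((∫⁻ ξ, w ξ) ^ (1 / 2 : ℝ)).toNNReal, fun g hg => ?_⟩
  rw [ENNReal.coe_toNNReal (ENNReal.rpow_ne_top_of_nonneg (by norm_num) hwfin), sobolevENorm_eq]
  have hbm : Measurable (fun ξ => ‖besselFourier k g ξ‖ₑ ^ (2 : ℝ)) :=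
    ((continuous_besselFourier k hg).measurable.enorm).pow_const _
  refine le_trans (le_of_eq (lintegral_congr fun ξ => ?_))
    (ENNReal.lintegral_mul_norm_pow_le hwm.aemeasurable hbm.aemeasurable
      (by norm_num) (by norm_num) (by norm_num))
  have h1 : (0 : ℝ) < 1 + ‖ξ‖ ^ 2 := by positivity
  rw [← ENNReal.rpow_mul, enorm_besselFourier, enorm_besselFourier, hw,
    ENNReal.ofReal_rpow_of_pos (by positivity), ← Real.rpow_mul h1.le]
  norm_num
  rw [← mul_assoc, ← ENNReal.ofReal_mul (by positivity), ← Real.rpow_add h1]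
  congr 3
  ring

/-- The Fourier transform is a Schwartz function and the weight has temperate growth. -/
theorem memLp_besselFourier_of_contDiff (k : ℝ) {g : EuclideanSpace ℝ (Fin n) → ℝ}
    (hg : ContDiff ℝ ∞ g) (hs : HasCompactSupport g) : MemLp (besselFourier k g) 2 volume := by
  have hs' : HasCompactSupport fun y => (g y : ℂ) := hs.comp_left Complex.ofReal_zero
  have hg' : ContDiff ℝ ∞ fun y => (g y : ℂ) := Complex.ofRealCLM.contDiff.comp hg
  set G : SchwartzMap (EuclideanSpace ℝ (Fin n)) ℂ := 𝓕 (hs'.toSchwartzMap hg')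
  have hT := Function.hasTemperateGrowth_one_add_norm_sq_rpow (EuclideanSpace ℝ (Fin n)) (k / 2)
  have h := (SchwartzMap.smulLeftCLM ℂ (fun x : EuclideanSpace ℝ (Fin n) =>
    (1 + ‖x‖ ^ 2) ^ (k / 2)) G).memLp 2 volume
  refine h.congr_norm (g := besselFourier k g) ?_ (Eventually.of_forall fun ξ => ?_)
  · exact (continuous_besselFourier k
      (hg.continuous.integrable_of_hasCompactSupport hs)).aestronglyMeasurable
  · rw [SchwartzMap.smulLeftCLM_apply_apply hT, besselFourier_apply, norm_smul, norm_mul,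
      Complex.norm_real]
    rw [show G ξ = realFourier g ξ from congrFun (SchwartzMap.fourier_coe _) ξ]

theorem norm_pow_mul_enorm_realFourier_le (j : ℕ) (g : EuclideanSpace ℝ (Fin n) → ℝ)
    (ξ : EuclideanSpace ℝ (Fin n)) :
    ‖ξ‖ₑ ^ j * ‖realFourier g ξ‖ₑ ≤ ‖besselFourier j g ξ‖ₑ := by
  rw [enorm_besselFourier]
  gcongr
  rw [← ofReal_norm, ← ENNReal.ofReal_pow (norm_nonneg _)]
  refine ENNReal.ofReal_le_ofReal ?_
  calc ‖ξ‖ ^ j = (‖ξ‖ ^ 2) ^ ((j : ℝ) / 2) := by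
        rw [← Real.rpow_natCast (‖ξ‖) 2, ← Real.rpow_mul (norm_nonneg _), ← Real.rpow_natCast]
        congr 1; push_cast; ring
    _ ≤ _ := by gcongr; linarith

/-- The Sobolev embedding into `C^j`, for smooth functions. -/
theorem enorm_iteratedFDeriv_le (j : ℕ) {k : ℝ} (hk : (n : ℝ) < 2 * (k - j)) :
    ∃ C : ℝ≥0, ∀ g : EuclideanSpace ℝ (Fin n) → ℝ, ContDiff ℝ ∞ g → HasCompactSupport g →
      ∀ y, ‖iteratedFDeriv ℝ j g y‖ₑ ≤ C * sobolevENorm k g := by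
  obtain ⟨C, hC⟩ := lintegral_besselFourier_le (n := n) hk
  set D : ℝ≥0 := (2 * Real.pi * ‖innerSL ℝ (E := EuclideanSpace ℝ (Fin n))‖).toNNReal ^ j
  refine ⟨D * C, fun g hg hs y => ?_⟩
  have hgi : Integrable g := hg.continuous.integrable_of_hasCompactSupport hs
  have hfin : ∀ m : ℕ, m ≤ j → ∫⁻ ξ, ‖besselFourier m g ξ‖ₑ ≠ ⊤ := by
    intro m hm
    obtain ⟨C', hC'⟩ := lintegral_besselFourier_le (n := n) (j := m) (k := k)
      (by have : (m : ℝ) ≤ j := by exact_mod_cast hm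
          linarith)
    exact ne_top_of_le_ne_top (ENNReal.mul_ne_top ENNReal.coe_ne_top
      (memLp_besselFourier_of_contDiff k hg hs).2.ne) (hC' g hgi)
  have hW : wienerNorm g ≠ ⊤ := by
    refine ne_top_of_le_ne_top (hfin 0 (Nat.zero_le _)) (lintegral_mono fun ξ => ?_)
    simpa using norm_pow_mul_enorm_realFourier_le 0 g ξ
  -- Reflecting ĝ turns the inverse transform into a forward one, whose derivatives are transforms
  -- of moments.
  set h : EuclideanSpace ℝ (Fin n) → ℂ := fun ξ => realFourier g (-ξ)
  have hhc : Continuous h := (continuous_realFourier hgi).comp continuous_neg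
  have hgF : (Complex.ofRealLI : ℝ → ℂ) ∘ g = 𝓕 h := by
    funext y
    rw [← Real.fourierInv_eq_fourier_comp_neg]
    exact fourierInv_realFourier hg.continuous hgi hW y
  have hneg : ∀ m : ℕ, ∫⁻ ξ, ‖ξ‖ₑ ^ m * ‖h ξ‖ₑ ≤ ∫⁻ ξ, ‖besselFourier m g ξ‖ₑ := by
    intro m
    rw [← lintegral_neg_eq_self (μ := volume) fun ξ : EuclideanSpace ℝ (Fin n) =>
      ‖besselFourier m g ξ‖ₑ]
    refine lintegral_mono fun ξ => ?_
    simpa [h] using norm_pow_mul_enorm_realFourier_le m g (-ξ)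
  have hint : ∀ m : ℕ, (m : ℕ∞) ≤ (j : ℕ∞) → Integrable fun v => ‖v‖ ^ m * ‖h v‖ := by
    intro m hm
    refine ⟨by fun_prop, ?_⟩
    rw [hasFiniteIntegral_iff_enorm]
    refine lt_of_le_of_lt (le_trans (le_of_eq (lintegral_congr fun ξ => ?_)) (hneg m))
      (lt_top_iff_ne_top.2 (hfin m (by exact_mod_cast hm)))
    simp [enorm_mul, enorm_pow]
  rw [← ofReal_norm, ← Complex.ofRealLI.norm_iteratedFDeriv_comp_left
    (hg.contDiffAt (x := y)) (i := j) (by exact_mod_cast le_top), hgF,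
    Real.iteratedFDeriv_fourier hint hhc.aestronglyMeasurable le_rfl, ofReal_norm, Real.fourier_eq]
  calc _ ≤ ∫⁻ v, ‖VectorFourier.fourierPowSMulRight (innerSL ℝ) h v j‖ₑ := by
        refine (enorm_integral_le_lintegral_enorm _).trans (le_of_eq ?_)
        refine lintegral_congr fun ξ => ?_
        rw [← ofReal_norm, ← ofReal_norm, Circle.norm_smul]
    _ ≤ ∫⁻ v, D * (‖v‖ₑ ^ j * ‖h v‖ₑ) := by
        refine lintegral_mono fun v => ?_
        have := VectorFourier.norm_fourierPowSMulRight_le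
          (innerSL ℝ (E := EuclideanSpace ℝ (Fin n))) h v j
        rw [← ofReal_norm]
        refine (ENNReal.ofReal_le_ofReal this).trans (le_of_eq ?_)
        rw [ENNReal.ofReal_mul (by positivity), ENNReal.ofReal_mul (by positivity),
          ofReal_norm, ENNReal.ofReal_pow (norm_nonneg _), ofReal_norm,
          ENNReal.ofReal_pow (by positivity), mul_assoc]
        simp [D, ENNReal.ofReal]
    _ = D * ∫⁻ v, ‖v‖ₑ ^ j * ‖h v‖ₑ := by
        rw [lintegral_const_mul]
        exact (measurable_enorm.pow_const _).mul hhc.measurable.enorm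
    _ ≤ D * (C * sobolevENorm k g) := by
        gcongr
        exact (hneg j).trans (hC g hgi)
    _ = _ := by push_cast; ring

end FourierSide

end FisherRao

end

noncomputable section

namespace FisherRao

open scoped ENNReal NNReal

/-! ### The Banach algebra of H^k functions supported in a fixed compact set. -/

section LocalSobolev

variable {n : ℕ}

theorem realFourier_add {f g : EuclideanSpace ℝ (Fin n) → ℝ} (hf : Integrable f)
    (hg : Integrable g) : realFourier (f + g) = realFourier f + realFourier g := by
  funext ξ
  simp only [realFourier, Pi.add_apply, Real.fourier_eq, Complex.ofReal_add, smul_add]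
  exact integral_add ((Real.fourierIntegral_convergent_iff ξ).2 hf.ofReal)
    ((Real.fourierIntegral_convergent_iff ξ).2 hg.ofReal)

theorem realFourier_smul (r : ℝ) (f : EuclideanSpace ℝ (Fin n) → ℝ) :
    realFourier (r • f) = (r : ℂ) • realFourier f := by
  funext ξ
  simp only [realFourier, Pi.smul_apply, Real.fourier_eq, smul_eq_mul, Complex.ofReal_mul]
  rw [← integral_const_mul]
  refine integral_congr_ae (Eventually.of_forall fun y => ?_)
  simp only [Circle.smul_def, smul_eq_mul]
  ring

theorem besselFourier_add (k : ℝ) {f g : EuclideanSpace ℝ (Fin n) → ℝ} (hf : Integrable f)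
    (hg : Integrable g) : besselFourier k (f + g) = besselFourier k f + besselFourier k g := by
  funext ξ
  simp [besselFourier_apply, realFourier_add hf hg, mul_add]

theorem besselFourier_smul (k r : ℝ) (f : EuclideanSpace ℝ (Fin n) → ℝ) :
    besselFourier k (r • f) = (r : ℂ) • besselFourier k f := by
  funext ξ
  simp only [besselFourier_apply, realFourier_smul, Pi.smul_apply, smul_eq_mul]
  ring

/-- An order `k > n/2` and a compact set `K` in `ℝⁿ`. -/
structure SobolevDomain (n : ℕ) where
  order : ℝ
  lt_order : (n : ℝ) / 2 < order
  carrier : Set (EuclideanSpace ℝ (Fin n))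
  isCompact : IsCompact carrier

theorem SobolevDomain.order_nonneg (D : SobolevDomain n) : 0 ≤ D.order :=
  le_trans (by positivity) D.lt_order.le

theorem integrable_of_support {K : Set (EuclideanSpace ℝ (Fin n))} (hK : IsCompact K)
    {g : EuclideanSpace ℝ (Fin n) → ℝ} (hc : Continuous g) (hs : ∀ y ∉ K, g y = 0) :
    Integrable g :=
  hc.integrable_of_hasCompactSupport (HasCompactSupport.intro hK hs)

/-- The functions in `H^k(ℝⁿ)` supported in `K`. -/
def localSobolevSubmodule (D : SobolevDomain n) : Submodule ℝ (EuclideanSpace ℝ (Fin n) → ℝ) where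
  carrier := {g | Continuous g ∧ (∀ y ∉ D.carrier, g y = 0) ∧
    MemLp (besselFourier D.order g) 2 volume}
  zero_mem' := by
    refine ⟨continuous_const, fun _ _ => rfl, ?_⟩
    have h := besselFourier_smul D.order 0 (0 : EuclideanSpace ℝ (Fin n) → ℝ)
    rw [zero_smul] at h
    rw [h, Complex.ofReal_zero, zero_smul]
    exact MemLp.zero
  add_mem' := by
    rintro f g ⟨hf, hf', hf''⟩ ⟨hg, hg', hg''⟩
    refine ⟨hf.add hg, fun y hy => by simp [hf' y hy, hg' y hy], ?_⟩
    rw [besselFourier_add _ (integrable_of_support D.isCompact hf hf')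
      (integrable_of_support D.isCompact hg hg')]
    exact hf''.add hg''
  smul_mem' := by
    rintro r f ⟨hf, hf', hf''⟩
    refine ⟨hf.const_smul r, fun y hy => by simp [hf' y hy], ?_⟩
    rw [besselFourier_smul]
    exact hf''.const_smul _

/-- The Banach algebra of the functions in `H^k(ℝⁿ)` supported in `K`. -/
def LocalSobolev (D : SobolevDomain n) : Type := localSobolevSubmodule D

namespace LocalSobolev

variable {D : SobolevDomain n}

instance : AddCommGroup (LocalSobolev D) := inferInstanceAs (AddCommGroup (localSobolevSubmodule D))

instance : Module ℝ (LocalSobolev D) := inferInstanceAs (Module ℝ (localSobolevSubmodule D))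

instance : FunLike (LocalSobolev D) (EuclideanSpace ℝ (Fin n)) ℝ where
  coe f := f.1
  coe_injective _ _ h := Subtype.ext h

/-- An element of the algebra, from a function with the required properties. -/
def mk (g : EuclideanSpace ℝ (Fin n) → ℝ) (hc : Continuous g) (hs : ∀ y ∉ D.carrier, g y = 0)
    (hm : MemLp (besselFourier D.order g) 2 volume) : LocalSobolev D :=
  ⟨g, hc, hs, hm⟩

@[simp] theorem coe_mk (g : EuclideanSpace ℝ (Fin n) → ℝ) (hc : Continuous g)
    (hs : ∀ y ∉ D.carrier, g y = 0) (hm : MemLp (besselFourier D.order g) 2 volume) :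
    ⇑(mk g hc hs hm) = g := rfl

@[simp] theorem zero_apply (y : EuclideanSpace ℝ (Fin n)) : (0 : LocalSobolev D) y = 0 := rfl

@[simp] theorem add_apply (f g : LocalSobolev D) (y : EuclideanSpace ℝ (Fin n)) :
    (f + g) y = f y + g y := rfl

@[simp] theorem sub_apply (f g : LocalSobolev D) (y : EuclideanSpace ℝ (Fin n)) :
    (f - g) y = f y - g y := rfl

@[simp] theorem smul_apply (r : ℝ) (f : LocalSobolev D) (y : EuclideanSpace ℝ (Fin n)) :
    (r • f) y = r * f y := rfl

theorem continuous (f : LocalSobolev D) : Continuous f := f.2.1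

theorem eq_zero (f : LocalSobolev D) {y : EuclideanSpace ℝ (Fin n)} (hy : y ∉ D.carrier) :
    f y = 0 := f.2.2.1 y hy

theorem memLp (f : LocalSobolev D) : MemLp (besselFourier D.order f) 2 volume := f.2.2.2

theorem integrable (f : LocalSobolev D) : Integrable f :=
  integrable_of_support D.isCompact f.continuous f.2.2.1

theorem exists_wienerNorm_le (D : SobolevDomain n) :
    ∃ C : ℝ≥0, ∀ g : EuclideanSpace ℝ (Fin n) → ℝ, Integrable g →
      wienerNorm g ≤ C * sobolevENorm D.order g := by
  obtain ⟨C, hC⟩ := lintegral_besselFourier_le (n := n) (j := 0) (k := D.order)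
    (by linarith [D.lt_order])
  refine ⟨C, fun g hg => le_trans (lintegral_mono fun ξ => ?_) (hC g hg)⟩
  simpa using norm_pow_mul_enorm_realFourier_le 0 g ξ

/-- A bound for the supremum and for the total mass of the Fourier transform by the `H^k`-norm. -/
def embeddingConst (D : SobolevDomain n) : ℝ≥0 := (exists_wienerNorm_le D).choose

theorem wienerNorm_le (f : LocalSobolev D) :
    wienerNorm f ≤ embeddingConst D * sobolevENorm D.order f :=
  (exists_wienerNorm_le D).choose_spec f f.integrable

theorem wienerNorm_ne_top (f : LocalSobolev D) : wienerNorm f ≠ ⊤ :=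
  ne_top_of_le_ne_top (ENNReal.mul_ne_top ENNReal.coe_ne_top f.memLp.2.ne) f.wienerNorm_le

/-- The scale that makes the `H^k`-norm submultiplicative. -/
def normConst (D : SobolevDomain n) : ℝ≥0 :=
  -- The summands serve, in order, positivity of the scale, the bound of the supremum by the norm,
  -- and the constant of the product estimate.
  1 + embeddingConst D + 2 * (4 ^ (D.order / 2) : ℝ).toNNReal * embeddingConst D

theorem normConst_pos (D : SobolevDomain n) : 0 < normConst D := by
  unfold normConst; positivity

/-- The `H^k`-norm, as a linear map to `L²`. -/
def bessel (D : SobolevDomain n) :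
    LocalSobolev D →ₗ[ℝ] Lp ℂ 2 (volume : Measure (EuclideanSpace ℝ (Fin n))) where
  toFun f := f.memLp.toLp
  map_add' f g := by
    rw [← MemLp.toLp_add]
    exact MemLp.toLp_congr _ _ (by
      rw [← besselFourier_add _ f.integrable g.integrable]; rfl)
  map_smul' r f := by
    rw [RingHom.id_apply, ← MemLp.toLp_const_smul]
    refine MemLp.toLp_congr _ _ ?_
    have := besselFourier_smul D.order r f
    exact Eventually.of_forall fun ξ => congrFun this ξ

theorem norm_bessel (f : LocalSobolev D) : ‖bessel D f‖ = (sobolevENorm D.order f).toReal :=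
  Lp.norm_toLp _ f.memLp

theorem enorm_apply_le (f : LocalSobolev D) (y : EuclideanSpace ℝ (Fin n)) :
    ‖f y‖ₑ ≤ embeddingConst D * sobolevENorm D.order f :=
  (enorm_le_wienerNorm f.continuous f.integrable y).trans f.wienerNorm_le

/-- The embedding bounds every value by the L² norm of the image, so a zero image forces the zero
function. -/
theorem bessel_injective (D : SobolevDomain n) : Function.Injective (bessel D) := by
  rw [← LinearMap.ker_eq_bot, LinearMap.ker_eq_bot']
  intro f hf
  refine DFunLike.ext _ _ fun y => ?_
  have h := norm_bessel f
  rw [hf, norm_zero, eq_comm, ENNReal.toReal_eq_zero_iff] at h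
  have h' := f.enorm_apply_le y
  rw [h.resolve_right f.memLp.2.ne, mul_zero, nonpos_iff_eq_zero, enorm_eq_zero] at h'
  exact h'

instance : NormedAddCommGroup (LocalSobolev D) :=
  NormedAddCommGroup.induced (LocalSobolev D)
    (Lp ℂ 2 (volume : Measure (EuclideanSpace ℝ (Fin n)))) ((normConst D : ℝ) • bessel D)
    (by
      intro f g h
      exact bessel_injective D (smul_right_injective _ (normConst_pos D).ne' h))

theorem norm_eq_bessel (f : LocalSobolev D) : ‖f‖ = normConst D * ‖bessel D f‖ := by
  change ‖(normConst D : ℝ) • bessel D f‖ = _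
  rw [norm_smul, Real.norm_of_nonneg (normConst D).coe_nonneg]

theorem ofReal_norm_eq (f : LocalSobolev D) :
    ENNReal.ofReal ‖f‖ = normConst D * sobolevENorm D.order f := by
  rw [norm_eq_bessel, norm_bessel, ENNReal.ofReal_mul (normConst D).coe_nonneg,
    ENNReal.ofReal_toReal (show sobolevENorm D.order f ≠ ⊤ from f.memLp.2.ne), ENNReal.ofReal_coe_nnreal]

instance : NormedSpace ℝ (LocalSobolev D) where
  norm_smul_le r f := by
    rw [norm_eq_bessel, norm_eq_bessel, map_smul, norm_smul]
    exact le_of_eq (by ring)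

theorem abs_apply_le (f : LocalSobolev D) (y : EuclideanSpace ℝ (Fin n)) : |f y| ≤ ‖f‖ := by
  rw [← Real.norm_eq_abs, ← ENNReal.ofReal_le_ofReal_iff (norm_nonneg _), ofReal_norm,
    ofReal_norm_eq]
  refine (f.enorm_apply_le y).trans ?_
  gcongr
  simp only [normConst]
  exact le_add_right (le_add_of_nonneg_left zero_le_one)

theorem sobolevENorm_mul_le' (f g : LocalSobolev D) :
    sobolevENorm D.order (fun y => f y * g y) ≤
      normConst D * (sobolevENorm D.order f * sobolevENorm D.order g) := by
  refine (sobolevENorm_mul_le D.order_nonneg f.integrable g.continuous g.integrable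
    g.wienerNorm_ne_top).trans ?_
  calc _ ≤ ENNReal.ofReal (4 ^ (D.order / 2)) *
        (sobolevENorm D.order f * (embeddingConst D * sobolevENorm D.order g) +
          embeddingConst D * sobolevENorm D.order f * sobolevENorm D.order g) := by
        gcongr
        · exact g.wienerNorm_le
        · exact f.wienerNorm_le
    _ = ((2 * (4 ^ (D.order / 2) : ℝ).toNNReal * embeddingConst D : ℝ≥0) : ℝ≥0∞) *
          (sobolevENorm D.order f * sobolevENorm D.order g) := by
        push_cast
        rw [ENNReal.ofReal]
        ring
    _ ≤ _ := by
        gcongr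
        simp only [normConst]
        exact le_add_of_nonneg_left zero_le

instance : Mul (LocalSobolev D) where
  mul f g := mk (fun y => f y * g y) (f.continuous.mul g.continuous)
    (fun y hy => by simp [f.eq_zero hy])
    ⟨(continuous_besselFourier _ (integrable_of_support D.isCompact
      (f.continuous.mul g.continuous) fun y hy => by simp [f.eq_zero hy])).aestronglyMeasurable,
    lt_of_le_of_lt (sobolevENorm_mul_le' f g) (ENNReal.mul_lt_top ENNReal.coe_lt_top
      (ENNReal.mul_lt_top f.memLp.2 g.memLp.2))⟩

@[simp] theorem mul_apply (f g : LocalSobolev D) (y : EuclideanSpace ℝ (Fin n)) :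
    (f * g) y = f y * g y := rfl

instance : NonUnitalCommRing (LocalSobolev D) where
  left_distrib f g h := DFunLike.ext _ _ fun y => by simp [mul_add]
  right_distrib f g h := DFunLike.ext _ _ fun y => by simp [add_mul]
  zero_mul f := DFunLike.ext _ _ fun y => by simp
  mul_zero f := DFunLike.ext _ _ fun y => by simp
  mul_assoc f g h := DFunLike.ext _ _ fun y => by simp [mul_assoc]
  mul_comm f g := DFunLike.ext _ _ fun y => by simp [mul_comm]

instance : NonUnitalNormedCommRing (LocalSobolev D) where
  __ := (inferInstance : NonUnitalCommRing (LocalSobolev D))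
  __ := (inferInstance : NormedAddCommGroup (LocalSobolev D))
  norm_mul_le f g := by
    rw [← ENNReal.ofReal_le_ofReal_iff (by positivity), ENNReal.ofReal_mul (norm_nonneg _),
      ofReal_norm_eq, ofReal_norm_eq, ofReal_norm_eq]
    calc (normConst D : ℝ≥0∞) * sobolevENorm D.order (fun y => f y * g y)
        ≤ normConst D * (normConst D * (sobolevENorm D.order f * sobolevENorm D.order g)) := by
          gcongr; exact sobolevENorm_mul_le' f g
      _ = _ := by ring

instance : IsScalarTower ℝ (LocalSobolev D) (LocalSobolev D) where
  smul_assoc r f g := DFunLike.ext _ _ fun y => by simp [mul_assoc]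

instance : SMulCommClass ℝ (LocalSobolev D) (LocalSobolev D) where
  smul_comm r f g := DFunLike.ext _ _ fun y => by simp; ring

/-- On a common compact support uniform closeness is L¹ closeness, hence uniform closeness of the
transforms. -/
theorem norm_realFourier_sub_le (D : SobolevDomain n) {f g : EuclideanSpace ℝ (Fin n) → ℝ}
    (hf : Continuous f) (hfs : ∀ y ∉ D.carrier, f y = 0) (hg : Continuous g)
    (hgs : ∀ y ∉ D.carrier, g y = 0) {ε : ℝ≥0∞} (h : ∀ y, ‖f y - g y‖ₑ ≤ ε)
    (ξ : EuclideanSpace ℝ (Fin n)) :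
    ‖realFourier f ξ - realFourier g ξ‖ₑ ≤ ε * volume D.carrier := by
  have e : realFourier f ξ - realFourier g ξ = realFourier (f + (-1 : ℝ) • g) ξ := by
    rw [realFourier_add (integrable_of_support D.isCompact hf hfs)
      ((integrable_of_support D.isCompact hg hgs).smul _), realFourier_smul]
    simp [sub_eq_add_neg]
  rw [e]
  refine (enorm_realFourier_le _ ξ).trans ?_
  rw [← setLIntegral_const]
  rw [← lintegral_indicator D.isCompact.measurableSet]
  refine lintegral_mono fun y => ?_
  by_cases hy : y ∈ D.carrier
  · simpa [hy, sub_eq_add_neg] using h y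
  · simp [hy, hfs y hy, hgs y hy]

/-- A Cauchy sequence has a uniform limit g, and its images in L² have a limit G. The Fourier
transforms converge everywhere to that of g, and a subsequence of the weighted ones converges almost
everywhere to G, so G is the image of g. -/
instance : CompleteSpace (LocalSobolev D) := by
  refine Metric.complete_of_cauchySeq_tendsto fun f hf => ?_
  have hdist : ∀ i j y, |f i y - f j y| ≤ dist (f i) (f j) := fun i j y => by
    rw [dist_eq_norm]; exact (f i - f j).abs_apply_le y
  have hpt : ∀ y, ∃ z, Tendsto (fun i => f i y) atTop (𝓝 z) := fun y => by
    refine cauchySeq_tendsto_of_complete (Metric.cauchySeq_iff.2 fun ε hε => ?_)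
    obtain ⟨N, hN⟩ := Metric.cauchySeq_iff.1 hf ε hε
    exact ⟨N, fun i hi j hj => lt_of_le_of_lt (hdist i j y) (hN i hi j hj)⟩
  choose g hg using hpt
  have hunif : TendstoUniformly (fun i y => f i y) g atTop := by
    rw [Metric.tendstoUniformly_iff]
    intro ε hε
    obtain ⟨N, hN⟩ := Metric.cauchySeq_iff.1 hf (ε / 2) (half_pos hε)
    refine eventually_atTop.2 ⟨N, fun i hi y => ?_⟩
    have : |f i y - g y| ≤ ε / 2 := by
      refine le_of_tendsto ((tendsto_const_nhds.sub (hg y)).abs) ?_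
      exact eventually_atTop.2 ⟨N, fun j hj => (hdist i j y).trans (hN i hi j hj).le⟩
    rw [dist_comm, Real.dist_eq]
    linarith
  have hgc : Continuous g := hunif.continuous (Frequently.of_forall fun i => (f i).continuous)
  have hgs : ∀ y ∉ D.carrier, g y = 0 := fun y hy =>
    tendsto_nhds_unique (hg y) (by simp [(f _).eq_zero hy])
  have hcauchy : CauchySeq fun i => bessel D (f i) := by
    refine Metric.cauchySeq_iff.2 fun ε hε => ?_
    have hpos : (0 : ℝ) < normConst D := normConst_pos D
    obtain ⟨N, hN⟩ := Metric.cauchySeq_iff.1 hf (normConst D * ε) (mul_pos hpos hε)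
    refine ⟨N, fun i hi j hj => ?_⟩
    have := hN i hi j hj
    rw [dist_eq_norm, norm_eq_bessel, map_sub] at this
    rw [dist_eq_norm]
    exact lt_of_mul_lt_mul_left this hpos.le
  obtain ⟨G, hG⟩ := cauchySeq_tendsto_of_complete hcauchy
  obtain ⟨ns, hns, hae⟩ :=
    (tendstoInMeasure_of_tendsto_Lp hG).exists_seq_tendsto_ae
  have hF : ∀ ξ, Tendsto (fun i => realFourier (f i) ξ) atTop (𝓝 (realFourier g ξ)) := by
    intro ξ
    rw [tendsto_iff_edist_tendsto_0]
    have hle : ∀ i, edist (realFourier (f i) ξ) (realFourier g ξ) ≤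
        (⨆ y, ‖f i y - g y‖ₑ) * volume D.carrier := fun i => by
      rw [edist_eq_enorm_sub]
      exact norm_realFourier_sub_le D (f i).continuous (f i).2.2.1 hgc hgs
        (fun y => le_iSup (fun y => ‖f i y - g y‖ₑ) y) ξ
    refine tendsto_of_tendsto_of_tendsto_of_le_of_le tendsto_const_nhds ?_ (fun _ => zero_le) hle
    have h0 : Tendsto (fun i => ⨆ y, ‖f i y - g y‖ₑ) atTop (𝓝 0) := by
      rw [ENNReal.tendsto_nhds_zero]
      intro ε hε
      filter_upwards [EMetric.tendstoUniformly_iff.1 hunif ε hε] with i hi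
      refine iSup_le fun y => ?_
      rw [← edist_eq_enorm_sub, edist_comm]
      exact (hi y).le
    simpa using ENNReal.Tendsto.mul_const h0 (Or.inr D.isCompact.measure_lt_top.ne)
  have hGg : (G : EuclideanSpace ℝ (Fin n) → ℂ) =ᵐ[volume] besselFourier D.order g := by
    have hco : ∀ᵐ ξ, ∀ i, (bessel D (f i) : EuclideanSpace ℝ (Fin n) → ℂ) ξ =
        besselFourier D.order (f i) ξ := ae_all_iff.2 fun i => (f i).memLp.coeFn_toLp
    filter_upwards [hae, hco] with ξ h1 h2
    refine tendsto_nhds_unique h1 ?_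
    simp only [h2]
    exact ((hF ξ).comp hns.tendsto_atTop).const_mul _
  have hgm : MemLp (besselFourier D.order g) 2 volume := (Lp.memLp G).ae_eq hGg
  refine ⟨mk g hgc hgs hgm, ?_⟩
  have hbg : bessel D (mk g hgc hgs hgm) = G :=
    (MemLp.toLp_congr hgm (Lp.memLp G) hGg.symm).trans (Lp.toLp_coeFn G _)
  rw [tendsto_iff_norm_sub_tendsto_zero]
  simp_rw [norm_eq_bessel, map_sub, hbg]
  simpa using (tendsto_iff_norm_sub_tendsto_zero.1 hG).const_mul (normConst D : ℝ)

end LocalSobolev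

end LocalSobolev

end FisherRao

end

noncomputable section

namespace FisherRao

open scoped ENNReal NNReal

/-! ### Inverses and real powers in Banach algebras. -/

section BanachAlgebra

/-- Since 1 + θ < 2, the exponent 2^m of s < 1 outgrows the exponent (1 + θ)^m of y. -/
theorem tendsto_pow_mul_rpow_pow {s θ y : ℝ} (hs : 0 < s) (hs1 : s < 1) (hθ1 : θ < 1)
    (hθ0 : 0 < θ) (hy : 1 ≤ y) :
    Tendsto (fun m : ℕ => s ^ (2 ^ m) * y ^ ((1 + θ) ^ m)) atTop (𝓝 0) := by
  have e : ∀ m : ℕ, s ^ (2 ^ m) * y ^ ((1 + θ) ^ m) =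
      Real.exp (2 ^ m * (Real.log s + ((1 + θ) / 2) ^ m * Real.log y)) := by
    intro m
    rw [Real.rpow_def_of_pos (by linarith), ← Real.exp_log (pow_pos hs (2 ^ m)), ← Real.exp_add,
      Real.log_pow, div_pow]
    congr 1
    push_cast
    field_simp
  simp_rw [e]
  refine Real.tendsto_exp_atBot.comp ?_
  have h1 : Tendsto (fun m : ℕ => Real.log s + ((1 + θ) / 2) ^ m * Real.log y) atTop
      (𝓝 (Real.log s)) := by
    simpa using tendsto_const_nhds.add ((tendsto_pow_atTop_nhds_zero_of_lt_one
      (show 0 ≤ (1 + θ) / 2 by linarith) (by linarith)).mul_const (Real.log y))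
  exact (tendsto_pow_atTop_atTop_of_one_lt (one_lt_two)).atTop_mul_neg (Real.log_neg hs hs1) h1

/-- A spectral radius estimate from a bound for squares with a loss in the exponent. -/
theorem isUnit_one_sub_of_norm_sq_le {A : Type*} [NormedRing A] [CompleteSpace A] {a : A}
    {s θ C : ℝ} (hs : 0 < s) (hs1 : s < 1) (hθ0 : 0 < θ) (hθ1 : θ < 1)
    (h : ∀ m : ℕ, ‖a ^ (2 ^ (m + 1))‖ ≤
      C * (s ^ (2 ^ m)) ^ (1 - θ) * (s ^ (2 ^ m) + ‖a ^ (2 ^ m)‖) ^ (1 + θ)) :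
    IsUnit (1 - a) := by
  set D : ℝ := 1 + max C 0
  have hD : 1 ≤ D := by simp [D]
  -- Dividing by the expected decay s^(2^m) turns the hypothesis into the recursion x(m+1) ≤ D
  -- x(m)^(1+θ).
  set x : ℕ → ℝ := fun m => (s ^ (2 ^ m) + ‖a ^ (2 ^ m)‖) / s ^ (2 ^ m)
  have hx1 : ∀ m, 1 ≤ x m := fun m => by
    have := pow_pos hs (2 ^ m)
    rw [le_div_iff₀ this]
    linarith [norm_nonneg (a ^ (2 ^ m))]
  have hstep : ∀ m, x (m + 1) ≤ D * x m ^ (1 + θ) := by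
    intro m
    set σ := s ^ (2 ^ m) with hσ
    have hσ0 : 0 < σ := pow_pos hs _
    have hσ2 : s ^ (2 ^ (m + 1)) = σ ^ (1 - θ) * σ ^ (1 + θ) := by
      rw [← Real.rpow_add hσ0, pow_succ, pow_mul]
      norm_num [hσ]
    have hN : 0 ≤ σ + ‖a ^ (2 ^ m)‖ := by positivity
    have h1 : ‖a ^ (2 ^ (m + 1))‖ / s ^ (2 ^ (m + 1)) ≤ max C 0 * x m ^ (1 + θ) := by
      rw [div_le_iff₀ (pow_pos hs _), Real.div_rpow hN hσ0.le, hσ2]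
      have h2 := h m
      have h3 : C * σ ^ (1 - θ) * (σ + ‖a ^ (2 ^ m)‖) ^ (1 + θ) ≤
          max C 0 * σ ^ (1 - θ) * (σ + ‖a ^ (2 ^ m)‖) ^ (1 + θ) := by
        gcongr; exact le_max_left _ _
      have h4 : (0 : ℝ) < σ ^ (1 + θ) := Real.rpow_pos_of_pos hσ0 _
      refine (h2.trans h3).trans (le_of_eq ?_)
      field_simp
    have h5 : x (m + 1) = 1 + ‖a ^ (2 ^ (m + 1))‖ / s ^ (2 ^ (m + 1)) := by
      simp only [x]
      rw [add_div, div_self (pow_pos hs _).ne']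
    have h6 : (1 : ℝ) ≤ x m ^ (1 + θ) := Real.one_le_rpow (hx1 m) (by linarith)
    rw [h5]
    simp only [D]
    linarith
  have hD0 : 0 < D := by linarith
  -- Chosen so that E D = E^(1+θ): the rescaled sequence E x(m) obeys the recursion without a
  -- constant, so it grows at most like y^((1+θ)^m).
  set E : ℝ := D ^ (1 / θ)
  have hE1 : 1 ≤ E := Real.one_le_rpow hD (by positivity)
  have hE : E * D = E ^ (1 + θ) := by
    simp only [E]
    nth_rewrite 2 [← Real.rpow_one D]
    rw [← Real.rpow_add hD0, ← Real.rpow_mul hD0.le]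
    congr 1
    field_simp
  set y : ℝ := E * x 0
  have hy : ∀ m, E * x m ≤ y ^ ((1 + θ) ^ m) := by
    intro m
    induction m with
    | zero => simp [y]
    | succ m ih =>
      have hxm := hx1 m
      calc E * x (m + 1) ≤ E * (D * x m ^ (1 + θ)) := by gcongr; exact hstep m
        _ = (E * x m) ^ (1 + θ) := by
          rw [Real.mul_rpow (by linarith) (by linarith), ← hE]; ring
        _ ≤ (y ^ ((1 + θ) ^ m)) ^ (1 + θ) := by gcongr
        _ = _ := by
          rw [← Real.rpow_mul (by have := hx1 0; positivity), pow_succ]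
  have hy1 : 1 ≤ y := by
    have := hx1 0
    simp only [y]; nlinarith
  have hlt := (tendsto_pow_mul_rpow_pow hs hs1 hθ1 hθ0 hy1).eventually (gt_mem_nhds one_pos)
  obtain ⟨m, hm⟩ := hlt.exists
  have hnorm : ‖a ^ (2 ^ m)‖ < 1 := by
    have h1 : ‖a ^ (2 ^ m)‖ ≤ s ^ (2 ^ m) * x m := by
      simp only [x]
      rw [mul_div_cancel₀ _ (pow_pos hs _).ne']
      linarith [pow_pos hs (2 ^ m)]
    have h2 : x m ≤ E * x m := by have := hx1 m; nlinarith
    calc _ ≤ s ^ (2 ^ m) * y ^ ((1 + θ) ^ m) := h1.trans (by gcongr; exact h2.trans (hy m))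
      _ < 1 := hm
  have hu := isUnit_one_sub_of_norm_lt_one hnorm
  -- As 1 - a is a commuting factor of 1 - a^(2^m), it is a unit once some power a^(2^m) has norm
  -- less than one.
  have hcomm : Commute (1 - a) (∑ i ∈ Finset.range (2 ^ m), a ^ i) := by
    refine Commute.sum_right _ _ _ fun i _ => ?_
    exact ((Commute.one_left _).sub_left ((Commute.refl a).pow_right i))
  have hprod : (1 - a) * ∑ i ∈ Finset.range (2 ^ m), a ^ i = 1 - a ^ (2 ^ m) :=
    mul_neg_geom_sum a (2 ^ m)
  rw [← hprod, hcomm.isUnit_mul_iff] at hu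
  exact hu.1

theorem eqOn_of_hasDerivAt_zero {I : Set ℝ} (hI : IsOpen I) (hc : I.OrdConnected) {q : ℝ → ℝ}
    (hq : ∀ τ ∈ I, HasDerivAt q 0 τ) {σ τ : ℝ} (hσ : σ ∈ I) (hτ : τ ∈ I) : q σ = q τ :=
  hI.is_const_of_deriv_eq_zero hc.isPreconnected
    (fun τ hτ => (hq τ hτ).differentiableAt.differentiableWithinAt)
    (fun τ hτ => (hq τ hτ).deriv) hσ hτ

/-- Real powers of the affine curve `1 + τ Φ` in a commutative Banach algebra. -/
theorem exists_rpow_curve {A : Type*} [NormedCommRing A] [NormedAlgebra ℝ A] [CompleteSpace A]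
    (Φ : A) {I : Set ℝ} (hI : IsOpen I) (hc : I.OrdConnected) (h0 : (0 : ℝ) ∈ I)
    (hu : ∀ τ ∈ I, IsUnit (1 + τ • Φ)) (s : ℝ) :
    ∃ P : ℝ → A, (∀ τ ∈ I, HasDerivAt P (s • (Φ * Ring.inverse (1 + τ • Φ) * P τ)) τ) ∧
      ∀ e : A →ₐ[ℝ] ℝ, Continuous e → (∀ τ ∈ I, 0 < 1 + τ * e Φ) →
        ∀ τ ∈ I, e (P τ) = (1 + τ * e Φ) ^ s ∧
          e (Φ * Ring.inverse (1 + τ • Φ) * P τ) = e Φ * (1 + τ * e Φ) ^ (s - 1) := by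
  set N : ℝ → A := fun τ => Φ * Ring.inverse (1 + τ • Φ) with hN
  have hNc : ContinuousOn N I := by
    intro τ hτ
    refine ContinuousAt.continuousWithinAt (continuousAt_const.mul ?_)
    obtain ⟨u, hu'⟩ := hu τ hτ
    refine ContinuousAt.comp (g := Ring.inverse) (f := fun τ : ℝ => 1 + τ • Φ) ?_ (by fun_prop)
    simp only [← hu']
    exact NormedRing.inverse_continuousAt u
  -- A logarithm of 1 + τΦ, obtained by integrating its logarithmic derivative from τ = 0; the power
  -- is then exp(s Lg), and no functional calculus is needed.
  set Lg : ℝ → A := fun τ => ∫ σ in (0 : ℝ)..τ, N σ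
  have hL : ∀ τ ∈ I, HasDerivAt Lg (N τ) τ := by
    intro τ hτ
    refine intervalIntegral.integral_hasDerivAt_right ?_ ?_ ((hNc τ hτ).continuousAt
      (hI.mem_nhds hτ))
    · exact (hNc.mono (hc.uIcc_subset h0 hτ)).intervalIntegrable
    · exact hNc.stronglyMeasurableAtFilter hI τ hτ
  set P : ℝ → A := fun τ => NormedSpace.exp (s • Lg τ)
  have hP : ∀ τ ∈ I, HasDerivAt P (s • (N τ * P τ)) τ := by
    intro τ hτ
    have h1 := (hasFDerivAt_exp (𝕂 := ℝ) (x := s • Lg τ)).comp_hasDerivAt τ ((hL τ hτ).const_smul s)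
    refine h1.congr_deriv ?_
    change NormedSpace.exp (s • Lg τ) * (s • N τ) = _
    rw [mul_smul_comm, mul_comm]
  refine ⟨P, hP, fun e he hpos => ?_⟩
  have heN : ∀ τ ∈ I, e (N τ) = e Φ * (1 + τ * e Φ)⁻¹ := by
    intro τ hτ
    have h1 : e (Ring.inverse (1 + τ • Φ)) * (1 + τ * e Φ) = 1 := by
      have := congrArg e (Ring.inverse_mul_cancel _ (hu τ hτ))
      simpa using this
    rw [hN]
    simp only [map_mul]
    rw [eq_inv_of_mul_eq_one_left h1]
  have heP : ∀ τ ∈ I, e (P τ) = (1 + τ * e Φ) ^ s := by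
    intro τ hτ
    -- The value of P under a character and the scalar power satisfy the same linear equation, so
    -- this quotient stays at its initial value 1.
    set q : ℝ → ℝ := fun τ => e (P τ) * (1 + τ * e Φ) ^ (-s)
    have hq : ∀ τ ∈ I, HasDerivAt q 0 τ := by
      intro τ hτ
      have hd1 : HasDerivAt (fun τ => e (P τ)) (s * (e (N τ) * e (P τ))) τ := by
        have := ((⟨e.toLinearMap, he⟩ : A →L[ℝ] ℝ).hasFDerivAt).comp_hasDerivAt τ (hP τ hτ)
        refine this.congr_deriv ?_
        change e (s • (N τ * P τ)) = _
        rw [map_smul, map_mul, smul_eq_mul]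
      have hd2 : HasDerivAt (fun τ : ℝ => (1 + τ * e Φ) ^ (-s))
          (e Φ * (-s) * (1 + τ * e Φ) ^ (-s - 1)) τ := by
        refine HasDerivAt.rpow_const ?_ (Or.inl (hpos τ hτ).ne')
        simpa using ((hasDerivAt_id τ).mul_const (e Φ)).const_add 1
      refine (hd1.mul hd2).congr_deriv ?_
      rw [heN τ hτ, Real.rpow_sub_one (hpos τ hτ).ne']
      have := (hpos τ hτ).ne'
      field_simp
      ring
    have h1 := eqOn_of_hasDerivAt_zero hI hc hq hτ h0
    simp only [q, P, Lg, intervalIntegral.integral_same, smul_zero, NormedSpace.exp_zero, map_one,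
      zero_mul, add_zero, Real.one_rpow, mul_one] at h1
    rw [Real.rpow_neg (hpos τ hτ).le, ← div_eq_mul_inv,
      div_eq_one_iff_eq (Real.rpow_pos_of_pos (hpos τ hτ) s).ne'] at h1
    exact h1
  intro τ hτ
  refine ⟨heP τ hτ, ?_⟩
  change e (N τ * P τ) = _
  rw [map_mul, heN τ hτ, heP τ hτ, Real.rpow_sub_one (hpos τ hτ).ne']
  ring

end BanachAlgebra

end FisherRao

end

noncomputable section

namespace FisherRao

open scoped ENNReal NNReal

/-! ### Invertibility of positive functions in the unitized Sobolev algebra. -/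

section UnitalSobolev

variable {n : ℕ}

/-- `LocalSobolev D` with the constant functions adjoined. -/
abbrev UnitalSobolev (D : SobolevDomain n) : Type := WithLp 1 (Unitization ℝ (LocalSobolev D))

namespace UnitalSobolev

variable {D : SobolevDomain n}

instance : NormedCommRing (UnitalSobolev D) where
  __ := (inferInstance : NormedRing (UnitalSobolev D))
  mul_comm a b := by
    have h : ∀ a b : Unitization ℝ (LocalSobolev D), a * b = b * a := fun a b =>
      Unitization.ext (mul_comm _ _) (by
        simp only [Unitization.snd_mul]
        rw [mul_comm a.snd b.snd, add_comm (a.fst • b.snd)])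
    exact congrArg (WithLp.toLp 1) (h (WithLp.ofLp a) (WithLp.ofLp b))

/-- The inclusion of the functions in `H^k` supported in `K`. -/
def incl (D : SobolevDomain n) : LocalSobolev D →ₗ[ℝ] UnitalSobolev D where
  toFun f := WithLp.toLp 1 (f : Unitization ℝ (LocalSobolev D))
  map_add' f g := by rw [Unitization.inr_add]; rfl
  map_smul' r f := by rw [Unitization.inr_smul]; rfl

/-- The scalar part, as a multiplicative functional. -/
def scalarPart (D : SobolevDomain n) : UnitalSobolev D →ₐ[ℝ] ℝ :=
  (Unitization.fstHom ℝ (LocalSobolev D)).comp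
    (WithLp.unitizationAlgEquiv (𝕜 := ℝ) (A := LocalSobolev D) ℝ).toAlgHom

/-- The projection to `H^k`. -/
def sobolevPart (D : SobolevDomain n) : UnitalSobolev D →L[ℝ] LocalSobolev D :=
  LinearMap.mkContinuous
    { toFun := fun a => (WithLp.ofLp a).snd
      map_add' := fun _ _ => rfl
      map_smul' := fun _ _ => rfl } 1 fun a => by
    rw [one_mul, WithLp.unitization_norm_def]
    exact le_add_of_nonneg_left (norm_nonneg _)

theorem norm_eq (a : UnitalSobolev D) : ‖a‖ = |scalarPart D a| + ‖sobolevPart D a‖ :=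
  WithLp.unitization_norm_def a

@[simp] theorem scalarPart_incl (f : LocalSobolev D) : scalarPart D (incl D f) = 0 := rfl

@[simp] theorem sobolevPart_incl (f : LocalSobolev D) : sobolevPart D (incl D f) = f := rfl

@[simp] theorem sobolevPart_one : sobolevPart D 1 = 0 := rfl

theorem sobolevPart_mul (a b : UnitalSobolev D) : sobolevPart D (a * b) =
    scalarPart D a • sobolevPart D b + scalarPart D b • sobolevPart D a +
      sobolevPart D a * sobolevPart D b := rfl

/-- Evaluation at a point. -/
def eval (D : SobolevDomain n) (y : EuclideanSpace ℝ (Fin n)) : UnitalSobolev D →ₐ[ℝ] ℝ :=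
  AlgHom.ofLinearMap
    { toFun := fun a => scalarPart D a + sobolevPart D a y
      map_add' := fun a b => by simp; ring
      map_smul' := fun r a => by simp; ring }
    (by simp) (fun a b => by
      simp only [LinearMap.coe_mk, AddHom.coe_mk, map_mul, sobolevPart_mul,
        LocalSobolev.add_apply, LocalSobolev.smul_apply, LocalSobolev.mul_apply]
      ring)

theorem eval_apply (a : UnitalSobolev D) (y : EuclideanSpace ℝ (Fin n)) :
    eval D y a = scalarPart D a + sobolevPart D a y := rfl

theorem continuous_eval (y : EuclideanSpace ℝ (Fin n)) : Continuous (eval D y) := by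
  refine AddMonoidHomClass.continuous_of_bound (eval D y) 1 fun a => ?_
  rw [one_mul, eval_apply, norm_eq]
  exact (abs_add_le _ _).trans (add_le_add_right ((sobolevPart D a).abs_apply_le y) _)

/-- Equality 2kθ/(2 - θ) = n holds at θ = 2n/(2k + n), which is less than 1 as k > n/2. The witness
is the midpoint between this value and 1. -/
theorem exists_exponent (D : SobolevDomain n) :
    ∃ θ : ℝ, 0 < θ ∧ θ < 1 ∧ (n : ℝ) < 2 * D.order * θ / (2 - θ) := by
  have h1 := D.lt_order
  have h2 : (0 : ℝ) ≤ n := by positivity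
  have h3 : 0 < 2 * D.order + n := by linarith
  refine ⟨(1 + 2 * n / (2 * D.order + n)) / 2, by positivity, ?_, ?_⟩
  · have : 2 * n / (2 * D.order + n) < 1 := by rw [div_lt_one h3]; linarith
    linarith
  · have h4 : 2 * n / (2 * D.order + n) < 1 := by rw [div_lt_one h3]; linarith
    rw [lt_div_iff₀ (by linarith)]
    have h5 : 2 * n / (2 * D.order + n) * (2 * D.order + n) = 2 * n := by field_simp
    nlinarith

/-- Values of size σ on a compact set bound the Fourier transform by a multiple of σ; interpolation
then gives the Wiener norm a factor σ^(1-θ), and the product estimate for the square costs one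
H^k-norm and one Wiener norm. For θ < 1 the loss is subquadratic, as `isUnit_one_sub_of_norm_sq_le`
demands. -/
theorem exists_norm_sq_le (D : SobolevDomain n) : ∃ θ C : ℝ, 0 < θ ∧ θ < 1 ∧
    ∀ (b : UnitalSobolev D) (σ : ℝ), 0 < σ → |scalarPart D b| ≤ σ → (∀ y, |eval D y b| ≤ σ) →
      ‖b ^ 2‖ ≤ C * σ ^ (1 - θ) * (σ + ‖b‖) ^ (1 + θ) := by
  obtain ⟨θ, hθ0, hθ1, hθ⟩ := exists_exponent D
  obtain ⟨Cw, hCw⟩ := wienerNorm_le_of_lt hθ0 hθ1.le hθ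
  set v : ℝ := (volume D.carrier).toReal
  set c : ℝ := ((LocalSobolev.normConst D : ℝ≥0) : ℝ)
  have hc0 : 0 < c := LocalSobolev.normConst_pos D
  set R : ℝ := 4 ^ (D.order / 2)
  have hR : 0 < R := by positivity
  set C₀ : ℝ := c * (R * (2 * (Cw * (2 * v) ^ (1 - θ)))) / c ^ (1 + θ)
  have hv : 0 ≤ v := ENNReal.toReal_nonneg
  have hC₀ : 0 ≤ C₀ := by positivity
  refine ⟨θ, 3 + C₀, hθ0, hθ1, fun b σ hσ hs he => ?_⟩
  set h := sobolevPart D b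
  -- The H^k part is the value minus the scalar part, hence the factor 2.
  have hh : ∀ y, |h y| ≤ 2 * σ := fun y => by
    have h1 := he y
    rw [eval_apply] at h1
    have : h y = (scalarPart D b + h y) - scalarPart D b := by ring
    rw [this]
    exact (abs_sub _ _).trans (by linarith)
  have hB : ∀ ξ, ‖realFourier h ξ‖ₑ ≤ ENNReal.ofReal (2 * σ * v) := by
    intro ξ
    refine (enorm_realFourier_le _ ξ).trans ?_
    rw [ENNReal.ofReal_mul (by positivity), ENNReal.ofReal_toReal D.isCompact.measure_lt_top.ne,
      ← setLIntegral_const, ← lintegral_indicator D.isCompact.measurableSet]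
    refine lintegral_mono fun y => ?_
    by_cases hy : y ∈ D.carrier
    · simp only [hy, indicator_of_mem]
      rw [← ofReal_norm]
      exact ENNReal.ofReal_le_ofReal (hh y)
    · simp [hy, h.eq_zero hy]
  have hW := hCw h h.integrable _ hB
  set S : ℝ := (sobolevENorm D.order h).toReal
  have hSfin : sobolevENorm D.order h ≠ ⊤ := h.memLp.2.ne
  have hS0 : 0 ≤ S := ENNReal.toReal_nonneg
  have hWr : (wienerNorm h).toReal ≤ Cw * (2 * σ * v) ^ (1 - θ) * S ^ θ := by
    have := ENNReal.toReal_mono (ENNReal.mul_ne_top (ENNReal.mul_ne_top ENNReal.coe_ne_top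
      (ENNReal.rpow_ne_top_of_nonneg (by linarith) ENNReal.ofReal_ne_top))
      (ENNReal.rpow_ne_top_of_nonneg hθ0.le hSfin)) hW
    rwa [ENNReal.toReal_mul, ENNReal.toReal_mul, ← ENNReal.toReal_rpow, ← ENNReal.toReal_rpow,
      ENNReal.toReal_ofReal (by positivity)] at this
  have hnorm : ‖h‖ = c * S := by
    rw [LocalSobolev.norm_eq_bessel, LocalSobolev.norm_bessel]
  have hsq : ‖h * h‖ ≤ c * (R * (2 * (S * (wienerNorm h).toReal))) := by
    rw [LocalSobolev.norm_eq_bessel, LocalSobolev.norm_bessel]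
    refine mul_le_mul_of_nonneg_left ?_ hc0.le
    have h1 := sobolevENorm_mul_le D.order_nonneg h.integrable h.continuous h.integrable
      h.wienerNorm_ne_top
    have h2 := ENNReal.toReal_mono (ENNReal.mul_ne_top ENNReal.ofReal_ne_top
      (ENNReal.add_ne_top.2 ⟨ENNReal.mul_ne_top hSfin h.wienerNorm_ne_top,
        ENNReal.mul_ne_top h.wienerNorm_ne_top hSfin⟩)) h1
    rw [ENNReal.toReal_mul, ENNReal.toReal_ofReal hR.le, ENNReal.toReal_add
      (ENNReal.mul_ne_top hSfin h.wienerNorm_ne_top)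
      (ENNReal.mul_ne_top h.wienerNorm_ne_top hSfin), ENNReal.toReal_mul, ENNReal.toReal_mul] at h2
    refine h2.trans (le_of_eq ?_)
    ring
  have hhh : ‖h * h‖ ≤ C₀ * σ ^ (1 - θ) * ‖h‖ ^ (1 + θ) := by
    calc ‖h * h‖ ≤ c * (R * (2 * (S * (Cw * (2 * σ * v) ^ (1 - θ) * S ^ θ)))) :=
          hsq.trans (by gcongr)
      _ = _ := by
        rw [hnorm, Real.mul_rpow hc0.le hS0, Real.rpow_add_of_nonneg hS0 zero_le_one hθ0.le,
          Real.rpow_one, show 2 * σ * v = 2 * v * σ by ring,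
          Real.mul_rpow (by positivity) hσ.le]
        have : c ^ (1 + θ) ≠ 0 := (Real.rpow_pos_of_pos hc0 _).ne'
        simp only [C₀]
        field_simp
  have hhb : ‖h‖ ≤ σ + ‖b‖ := by
    have := norm_eq b
    linarith [abs_nonneg (scalarPart D b)]
  have hM : 0 < σ + ‖b‖ := by positivity
  have hσM : σ * (σ + ‖b‖) ≤ σ ^ (1 - θ) * (σ + ‖b‖) ^ (1 + θ) := by
    calc σ * (σ + ‖b‖) = σ ^ (1 - θ) * (σ ^ θ * (σ + ‖b‖)) := by
          rw [← mul_assoc, ← Real.rpow_add hσ]; simp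
      _ ≤ σ ^ (1 - θ) * ((σ + ‖b‖) ^ θ * (σ + ‖b‖)) := by
          gcongr; linarith [norm_nonneg b]
      _ = _ := by rw [add_comm 1 θ, Real.rpow_add_one hM.ne']
  calc ‖b ^ 2‖ = |scalarPart D b| ^ 2 + ‖(2 * scalarPart D b) • h + h * h‖ := by
        rw [norm_eq, sq b, sobolevPart_mul, map_mul, abs_mul, ← sq, ← add_smul, ← two_mul]
    _ ≤ σ * (σ + ‖b‖) + (2 * (σ * (σ + ‖b‖)) + C₀ * σ ^ (1 - θ) * (σ + ‖b‖) ^ (1 + θ)) := by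
        gcongr
        · have : |scalarPart D b| ^ 2 ≤ σ ^ 2 := by gcongr
          nlinarith [norm_nonneg b]
        · refine (norm_add_le _ _).trans (add_le_add ?_ (hhh.trans (by gcongr)))
          rw [norm_smul, Real.norm_eq_abs, abs_mul, abs_two, mul_assoc]
          gcongr
    _ ≤ _ := by
        rw [mul_assoc, mul_assoc]
        nlinarith

/-- A function `1 + φ` with `φ` in `H^k`, compactly supported, is invertible if it is positive. -/
theorem isUnit_one_add_incl (φ : LocalSobolev D) (hφ : ∀ y, 0 < 1 + φ y) :
    IsUnit (1 + incl D φ) := by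
  have hcs : HasCompactSupport φ := HasCompactSupport.intro D.isCompact fun y hy => φ.eq_zero hy
  obtain ⟨_, ⟨y₀, rfl⟩, hy₀⟩ := (hcs.isCompact_range φ.continuous).exists_isLeast
    (range_nonempty φ)
  have hmin : ∀ y, φ y₀ ≤ φ y := fun y => hy₀ (mem_range_self y)
  -- A lower bound for 1 + φ and also for its scalar part 1; the cap 1/2 keeps s = 1 - δ/M positive.
  set δ : ℝ := min (1 + φ y₀) (1 / 2)
  have hδ0 : 0 < δ := lt_min (hφ y₀) (by norm_num)
  have hδ2 : δ ≤ 1 / 2 := min_le_right _ _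
  set M : ℝ := 1 + ‖φ‖
  have hM : 1 ≤ M := by simp [M]
  have hM0 : 0 < M := by linarith
  set s : ℝ := 1 - δ / M
  have hδM : δ / M ≤ 1 / 2 := (div_le_self hδ0.le hM).trans hδ2
  have hδM0 : 0 < δ / M := by positivity
  have hs0 : 0 < s := by simp only [s]; linarith
  have hs1 : s < 1 := by simp only [s]; linarith
  -- After scaling by M, an upper bound for 1 + φ, all values of g and its scalar part have absolute
  -- value at most s < 1. Evaluations are multiplicative, so those of g^(2^m) are at most s^(2^m).
  set g : UnitalSobolev D := 1 - M⁻¹ • (1 + incl D φ) with hg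
  have hbd : ∀ z : ℝ, δ ≤ z → z ≤ M → |1 - M⁻¹ * z| ≤ s := by
    intro z h1 h2
    have h3 : M⁻¹ * z ≤ 1 := by rw [inv_mul_le_iff₀ hM0]; linarith
    have h4 : δ / M ≤ M⁻¹ * z := by rw [div_eq_inv_mul]; gcongr
    rw [abs_of_nonneg (by linarith)]
    simp only [s]; linarith
  have hsg : |scalarPart D g| ≤ s := by
    have : scalarPart D g = 1 - M⁻¹ * 1 := by simp [hg]
    rw [this]
    exact hbd 1 (by linarith) hM
  have heg : ∀ y, |eval D y g| ≤ s := by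
    intro y
    have : eval D y g = 1 - M⁻¹ * (1 + φ y) := by
      rw [hg, map_sub, map_smul, map_add, map_one, eval_apply (incl D φ)]
      simp
    rw [this]
    refine hbd _ ((min_le_left _ _).trans (by linarith [hmin y])) ?_
    simp only [M]
    linarith [le_abs_self (φ y), φ.abs_apply_le y]
  obtain ⟨θ, C, hθ0, hθ1, hC⟩ := exists_norm_sq_le D
  have hu : IsUnit (1 - g) := by
    refine isUnit_one_sub_of_norm_sq_le (C := C) hs0 hs1 hθ0 hθ1 fun m => ?_
    have := hC (g ^ (2 ^ m)) (s ^ (2 ^ m)) (pow_pos hs0 _)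
      (by rw [map_pow, abs_pow]; gcongr) (fun y => by rw [map_pow, abs_pow]; gcongr; exact heg y)
    rwa [← pow_mul, ← pow_succ] at this
  have h1 : 1 + incl D φ = algebraMap ℝ (UnitalSobolev D) M * (1 - g) := by
    rw [hg, sub_sub_cancel, ← Algebra.smul_def, smul_smul, mul_inv_cancel₀ hM0.ne', one_smul]
  rw [h1]
  exact ((isUnit_iff_ne_zero.2 hM0.ne').map _).mul hu

end UnitalSobolev

end UnitalSobolev

/-! ### Powers of 1 + τφ as curves in H^k(ℝⁿ). -/

section RpowCurve

variable {n : ℕ}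

/-- The class in `L²` of `(1 + |ξ|²)^(k/2) ĝ(ξ)` if this function is square integrable, else `0`. -/
def sobolevVec (k : ℝ) (g : EuclideanSpace ℝ (Fin n) → ℝ) :
    Lp ℂ 2 (volume : Measure (EuclideanSpace ℝ (Fin n))) :=
  open Classical in if h : MemLp (besselFourier k g) 2 volume then h.toLp else 0

theorem sobolevVec_eq {k : ℝ} {g : EuclideanSpace ℝ (Fin n) → ℝ}
    (h : MemLp (besselFourier k g) 2 volume) : sobolevVec k g = h.toLp := dif_pos h

/-- If `β` and `φ` are compactly supported and in `H^k`, then `τ ↦ β (1 + τ φ)^s` is a differentiable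
curve in `H^k` as long as `1 + τ φ` is positive. -/
theorem hasDerivAt_sobolevVec_rpow {k : ℝ} (hk : (n : ℝ) / 2 < k)
    {β φ : EuclideanSpace ℝ (Fin n) → ℝ} (hβ : Continuous β) (hβs : HasCompactSupport β)
    (hβm : MemLp (besselFourier k β) 2 volume) (hφ : Continuous φ) (hφs : HasCompactSupport φ)
    (hφm : MemLp (besselFourier k φ) 2 volume) {I : Set ℝ} (hI : IsOpen I) (hc : I.OrdConnected)
    (h0 : (0 : ℝ) ∈ I) (hpos : ∀ τ ∈ I, ∀ y, 0 < 1 + τ * φ y) (s : ℝ) :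
    ∀ τ ∈ I, MemLp (besselFourier k (fun y => β y * (1 + τ * φ y) ^ s)) 2 volume ∧
      HasDerivAt (fun τ => sobolevVec k (fun y => β y * (1 + τ * φ y) ^ s))
        (s • sobolevVec k (fun y => β y * φ y * (1 + τ * φ y) ^ (s - 1))) τ := by
  set D : SobolevDomain n := ⟨k, hk, tsupport β ∪ tsupport φ, hβs.isCompact.union hφs.isCompact⟩
  set B : LocalSobolev D := LocalSobolev.mk β hβ
    (fun y hy => image_eq_zero_of_notMem_tsupport fun h => hy (Or.inl h)) hβm
  set F : LocalSobolev D := LocalSobolev.mk φ hφ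
    (fun y hy => image_eq_zero_of_notMem_tsupport fun h => hy (Or.inr h)) hφm
  have hF : ∀ y, UnitalSobolev.eval D y (UnitalSobolev.incl D F) = φ y := fun y => zero_add (φ y)
  obtain ⟨P, hP, hPe⟩ := exists_rpow_curve (UnitalSobolev.incl D F) hI hc h0 (fun τ hτ => by
    rw [← map_smul]
    exact UnitalSobolev.isUnit_one_add_incl _ fun y => hpos τ hτ y) s
  have hPe' := fun (y : EuclideanSpace ℝ (Fin n)) => hPe (UnitalSobolev.eval D y)
    (UnitalSobolev.continuous_eval y) (fun τ hτ => by rw [hF]; exact hpos τ hτ y)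
  -- Multiplication by β removes the scalar part, so the result is a genuine H^k function, as the
  -- power (1 + τφ)^s alone is not.
  set L : UnitalSobolev D →L[ℝ] LocalSobolev D := (UnitalSobolev.sobolevPart D).comp
    (ContinuousLinearMap.mul ℝ (UnitalSobolev D) (UnitalSobolev.incl D B)) with hL
  have hLe : ∀ a y, L a y = β y * UnitalSobolev.eval D y a := by
    intro a y
    have h1 : UnitalSobolev.eval D y (UnitalSobolev.incl D B * a) =
        UnitalSobolev.scalarPart D (UnitalSobolev.incl D B * a) + L a y := rfl
    rw [map_mul, map_mul, UnitalSobolev.scalarPart_incl, zero_mul, zero_add] at h1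
    rw [← h1, UnitalSobolev.eval_apply (UnitalSobolev.incl D B), UnitalSobolev.scalarPart_incl,
      zero_add]
    rfl
  set Λ : LocalSobolev D →L[ℝ] Lp ℂ 2 (volume : Measure (EuclideanSpace ℝ (Fin n))) :=
    (LocalSobolev.bessel D).mkContinuous (LocalSobolev.normConst D : ℝ)⁻¹ fun f => by
      rw [LocalSobolev.norm_eq_bessel, inv_mul_cancel_left₀
        (NNReal.coe_ne_zero.2 (LocalSobolev.normConst_pos D).ne')]
  have hΛ : ∀ f : LocalSobolev D, Λ f = sobolevVec k f := fun f => (sobolevVec_eq f.memLp).symm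
  have hval : ∀ τ ∈ I, ⇑(L (P τ)) = fun y => β y * (1 + τ * φ y) ^ s := by
    intro τ hτ
    funext y
    rw [hLe, (hPe' y τ hτ).1, hF]
  intro τ hτ
  refine ⟨hval τ hτ ▸ (L (P τ)).memLp, ?_⟩
  have hd := (Λ.comp L).hasFDerivAt.comp_hasDerivAt τ (hP τ hτ)
  refine (hd.congr_of_eventuallyEq ?_).congr_deriv ?_
  · filter_upwards [hI.mem_nhds hτ] with σ hσ
    simp only [Function.comp_apply, ContinuousLinearMap.comp_apply]
    rw [hΛ, hval σ hσ]
  · rw [map_smul, ContinuousLinearMap.comp_apply, hΛ]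
    congr 2
    funext y
    rw [hLe, (hPe' y τ hτ).2, hF, mul_assoc]

end RpowCurve

end FisherRao

end

noncomputable section

namespace FisherRao

open scoped ENNReal NNReal

/-! ### From ℝⁿ to the manifold by charts and cutoffs. -/

section Localization

variable {n : ℕ} {M : Type*} [TopologicalSpace M] [ChartedSpace (EuclideanSpace ℝ (Fin n)) M]

theorem exists_localizedChart {e : OpenPartialHomeomorph M (EuclideanSpace ℝ (Fin n))}
    (he : e ∈ IsManifold.maximalAtlas (𝓡 n) ∞ M) {K : Set (EuclideanSpace ℝ (Fin n))}
    (hK : IsCompact K) (hKe : K ⊆ e.target) :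
    ∃ c : LocalizedChart n M, c.chart = e ∧ (∀ y, c.cutoff y ∈ Icc (0 : ℝ) 1) ∧
      ∀ᶠ y in 𝓝ˢ K, c.cutoff y = 1 := by
  obtain ⟨L, hL, hKL, hLe⟩ := exists_compact_between hK e.open_target hKe
  obtain ⟨f, hf1, hf0, hf⟩ := exists_contMDiffMap_one_nhds_of_subset_interior
    (n := ⊤) (𝓡 n) hK.isClosed hKL
  have hsupp : tsupport f ⊆ L := closure_minimal (fun y hy => by
    by_contra h
    exact hy (hf0 y h)) hL.isClosed
  exact ⟨⟨e, he, f, f.contMDiff.contDiff, HasCompactSupport.intro' hL hL.isClosed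
    (fun y hy => hf0 y hy), hsupp.trans hLe⟩, rfl, hf, hf1⟩

theorem LocalizedChart.localize_eq_zero (c : LocalizedChart n M) (f : M → ℝ)
    {y : EuclideanSpace ℝ (Fin n)} (hy : y ∉ tsupport c.cutoff) : c.localize f y = 0 := by
  simp [LocalizedChart.localize, image_eq_zero_of_notMem_tsupport hy]

theorem LocalizedChart.hasCompactSupport_localize (c : LocalizedChart n M) (f : M → ℝ) :
    HasCompactSupport (c.localize f) := c.cutoff_compact.mul_right

theorem LocalizedChart.integrable_real_localize (c : LocalizedChart n M) {f : M → ℝ}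
    (hf : Continuous f) : Integrable (c.localize f) :=
  (c.continuous_localize hf).integrable_of_hasCompactSupport (c.hasCompactSupport_localize f)

theorem LocalizedChart.localize_sub (c : LocalizedChart n M) (f g : M → ℝ) :
    c.localize (f - g) = c.localize f - c.localize g := by
  funext y
  simp [LocalizedChart.localize, mul_sub]

theorem LocalizedChart.localize_add (c : LocalizedChart n M) (f g : M → ℝ) :
    c.localize (f + g) = c.localize f + c.localize g := by
  funext y
  simp [LocalizedChart.localize, mul_add]

theorem LocalizedChart.localize_smul (c : LocalizedChart n M) (r : ℝ) (f : M → ℝ) :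
    c.localize (r • f) = r • c.localize f := by
  funext y
  simp [LocalizedChart.localize]
  ring

theorem LocalizedChart.contDiff_localize (c : LocalizedChart n M) {f : M → ℝ}
    (hf : ContMDiff (𝓡 n) 𝓘(ℝ, ℝ) ∞ f) : ContDiff ℝ ∞ (c.localize f) := by
  rw [contDiff_iff_contDiffAt]
  intro y
  by_cases hy : y ∈ tsupport c.cutoff
  · have h1 : ContMDiffOn 𝓘(ℝ, EuclideanSpace ℝ (Fin n)) 𝓘(ℝ, ℝ) ∞ (f ∘ c.chart.symm)
        c.chart.target :=
      hf.comp_contMDiffOn (contMDiffOn_symm_of_mem_maximalAtlas c.chart_mem)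
    have h2 : ContDiffAt ℝ ∞ (f ∘ c.chart.symm) y :=
      h1.contDiffOn.contDiffAt (c.chart.open_target.mem_nhds (c.cutoff_support hy))
    exact c.cutoff_contDiff.contDiffAt.mul h2
  · refine (contDiffAt_const (c := (0 : ℝ))).congr_of_eventuallyEq ?_
    filter_upwards [(isClosed_tsupport c.cutoff).isOpen_compl.mem_nhds hy] with z hz
    exact c.localize_eq_zero f hz

theorem mem_sobolevSubmodule_of_contMDiff (k : ℝ) {f : M → ℝ}
    (hf : ContMDiff (𝓡 n) 𝓘(ℝ, ℝ) ∞ f) : f ∈ sobolevSubmodule n M k :=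
  ⟨hf.continuous, fun c => memLp_besselFourier_of_contDiff k (c.contDiff_localize hf)
    (c.hasCompactSupport_localize f)⟩

/-- The nonlinear factor cannot be multiplied by a cutoff from outside. A second cutoff, equal to 1
on the support of the first, lets φ be replaced inside the power by a compactly supported function
on ℝⁿ. -/
theorem localize_mul_rpow {c c' : LocalizedChart n M} (h : c'.chart = c.chart)
    (h1 : ∀ y ∈ tsupport c.cutoff, c'.cutoff y = 1) (b φ : M → ℝ) (τ s : ℝ) :
    c.localize (fun x => b x * (1 + τ * φ x) ^ s) =
      fun y => c.localize b y * (1 + τ * c'.localize φ y) ^ s := by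
  funext y
  by_cases hy : y ∈ tsupport c.cutoff
  · simp only [LocalizedChart.localize, h1 y hy, h, one_mul]
    ring
  · rw [c.localize_eq_zero _ hy, c.localize_eq_zero _ hy, zero_mul]

theorem localize_mul_mul_rpow {c c' : LocalizedChart n M} (h : c'.chart = c.chart)
    (h1 : ∀ y ∈ tsupport c.cutoff, c'.cutoff y = 1) (b φ : M → ℝ) (τ s : ℝ) :
    c.localize (fun x => b x * φ x * (1 + τ * φ x) ^ s) =
      fun y => c.localize b y * c'.localize φ y * (1 + τ * c'.localize φ y) ^ s := by
  funext y
  by_cases hy : y ∈ tsupport c.cutoff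
  · simp only [LocalizedChart.localize, h1 y hy, h, one_mul]
    ring
  · rw [c.localize_eq_zero _ hy, c.localize_eq_zero _ hy, zero_mul, zero_mul]

/-- If `b` and `φ` are in `H^k(M)`, then `τ ↦ b (1 + τ φ)^s` is a differentiable curve in `H^k(M)` as
long as `1 + τ φ` is positive. -/
theorem sobolev_rpow_curve {k : ℝ} (hk : (n : ℝ) / 2 < k) {b φ : M → ℝ}
    (hb : b ∈ sobolevSubmodule n M k) (hφ : φ ∈ sobolevSubmodule n M k) {I : Set ℝ}
    (hI : IsOpen I) (hc : I.OrdConnected) (h0 : (0 : ℝ) ∈ I)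
    (hpos : ∀ τ ∈ I, ∀ x, 0 < 1 + τ * φ x) (s : ℝ) {τ : ℝ} (hτ : τ ∈ I) :
    (fun x => b x * (1 + τ * φ x) ^ s) ∈ sobolevSubmodule n M k ∧
    ∀ c : LocalizedChart n M,
      HasDerivAt (fun τ => sobolevVec k (c.localize fun x => b x * (1 + τ * φ x) ^ s))
        (s • sobolevVec k (c.localize fun x => b x * φ x * (1 + τ * φ x) ^ (s - 1))) τ := by
  have key : ∀ c : LocalizedChart n M,
      MemLp (besselFourier k (c.localize fun x => b x * (1 + τ * φ x) ^ s)) 2 volume ∧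
      HasDerivAt (fun τ => sobolevVec k (c.localize fun x => b x * (1 + τ * φ x) ^ s))
        (s • sobolevVec k (c.localize fun x => b x * φ x * (1 + τ * φ x) ^ (s - 1))) τ := by
    intro c
    obtain ⟨c', hc', hc01, hc1⟩ := exists_localizedChart c.chart_mem c.cutoff_compact
      c.cutoff_support
    have h1 : ∀ y ∈ tsupport c.cutoff, c'.cutoff y = 1 := fun y hy =>
      hc1.self_of_nhdsSet y hy
    simp only [localize_mul_mul_rpow hc' h1]
    simp only [localize_mul_rpow hc' h1]
    refine hasDerivAt_sobolevVec_rpow hk (c.continuous_localize hb.1)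
      (c.hasCompactSupport_localize b) (hb.2 c) (c'.continuous_localize hφ.1)
      (c'.hasCompactSupport_localize φ) (hφ.2 c') hI hc h0 (fun τ hτ y => ?_) s τ hτ
    have h2 := hpos τ hτ (c'.chart.symm y)
    obtain ⟨h3, h4⟩ := hc01 y
    -- A convex combination of 1 and a positive value of 1 + τφ, hence positive.
    have h5 : 1 + τ * c'.localize φ y = (1 - c'.cutoff y) +
        c'.cutoff y * (1 + τ * φ (c'.chart.symm y)) := by
      simp only [LocalizedChart.localize]; ring
    rw [h5]
    rcases h3.eq_or_lt with h6 | h6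
    · rw [← h6]; norm_num
    · have := mul_pos h6 h2; linarith
  refine ⟨⟨?_, fun c => (key c).1⟩, fun c => (key c).2⟩
  refine hb.1.mul (Continuous.rpow_const (by have := hφ.1; fun_prop) fun x =>
    Or.inl (hpos τ hτ x).ne')

end Localization

/-! ### The open interval of times with 1 + τφ positive. -/

section Positivity

variable {M : Type*}

/-- The times at which `1 + τ φ` is positive. -/
def positiveTimes (φ : M → ℝ) : Set ℝ := {τ | ∀ x, 0 < 1 + τ * φ x}

theorem zero_mem_positiveTimes (φ : M → ℝ) : (0 : ℝ) ∈ positiveTimes φ := fun x => by simp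

theorem ordConnected_positiveTimes (φ : M → ℝ) : (positiveTimes φ).OrdConnected := by
  refine ⟨fun σ hσ τ hτ ρ hρ x => ?_⟩
  have h1 := hσ x
  have h2 := hτ x
  rcases le_total 0 (φ x) with h | h
  · nlinarith [mul_le_mul_of_nonneg_right hρ.1 h]
  · nlinarith [mul_le_mul_of_nonpos_right hρ.2 h]

theorem isOpen_positiveTimes [TopologicalSpace M] [CompactSpace M] {φ : M → ℝ} (hφ : Continuous φ) : IsOpen (positiveTimes φ) := by
  rw [isOpen_iff_mem_nhds]
  intro τ hτ
  have h : ∀ᶠ σ in 𝓝 τ, ∀ x ∈ (univ : Set M), 0 < 1 + σ * φ x := by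
    refine isCompact_univ.eventually_forall_of_forall_eventually fun x _ => ?_
    have hc : Continuous fun z : ℝ × M => 1 + z.1 * φ z.2 := by fun_prop
    exact hc.continuousAt.eventually (lt_mem_nhds (hτ x))
  filter_upwards [h] with σ hσ x using hσ x (mem_univ x)

/-- The quotient is a (1 + τ(f - 1))^(-1) at τ = 1, a point of the curve of powers. -/
theorem sobolev_div_mem {n : ℕ} [TopologicalSpace M] [CompactSpace M]
    [ChartedSpace (EuclideanSpace ℝ (Fin n)) M] {k : ℝ} (hk : (n : ℝ) / 2 < k) {a f : M → ℝ}
    (ha : a ∈ sobolevSubmodule n M k) (hf : f ∈ sobolevSubmodule n M k) (hpos : ∀ x, 0 < f x) :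
    (fun x => a x / f x) ∈ sobolevSubmodule n M k := by
  have hone : (fun x => f x - 1) ∈ sobolevSubmodule n M k :=
    Submodule.sub_mem _ hf (mem_sobolevSubmodule_of_contMDiff k contMDiff_const)
  have h := (sobolev_rpow_curve hk ha hone (isOpen_positiveTimes hone.1)
    (ordConnected_positiveTimes _) (zero_mem_positiveTimes _) (fun τ hτ => hτ) (-1)
    (τ := 1) (fun x => by simpa using hpos x)).1
  convert h using 2 with x
  rw [one_mul, add_sub_cancel, Real.rpow_neg_one, div_eq_mul_inv]

end Positivity

/-! ### Convergence and differentiability in H^k(M). -/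

section SobolevTopology

variable {n : ℕ} {M : Type*} [TopologicalSpace M] [ChartedSpace (EuclideanSpace ℝ (Fin n)) M]

theorem sobolevVec_add {k : ℝ} {f g : EuclideanSpace ℝ (Fin n) → ℝ} (hf : Integrable f)
    (hg : Integrable g) (hf' : MemLp (besselFourier k f) 2 volume)
    (hg' : MemLp (besselFourier k g) 2 volume) :
    sobolevVec k (f + g) = sobolevVec k f + sobolevVec k g := by
  have e := besselFourier_add k hf hg
  have h : MemLp (besselFourier k (f + g)) 2 volume := e ▸ hf'.add hg'
  rw [sobolevVec_eq h, sobolevVec_eq hf', sobolevVec_eq hg', ← MemLp.toLp_add]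
  exact MemLp.toLp_congr _ _ (Eventually.of_forall fun ξ => congrFun e ξ)

theorem sobolevVec_smul {k : ℝ} (r : ℝ) {f : EuclideanSpace ℝ (Fin n) → ℝ}
    (hf' : MemLp (besselFourier k f) 2 volume) :
    sobolevVec k (r • f) = r • sobolevVec k f := by
  have e := besselFourier_smul k r f
  have h : MemLp (besselFourier k (r • f)) 2 volume := e ▸ hf'.const_smul _
  rw [sobolevVec_eq h, sobolevVec_eq hf', ← MemLp.toLp_const_smul]
  exact MemLp.toLp_congr _ _ (Eventually.of_forall fun ξ => congrFun e ξ)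

theorem norm_sobolevVec {k : ℝ} {f : EuclideanSpace ℝ (Fin n) → ℝ}
    (hf' : MemLp (besselFourier k f) 2 volume) :
    ENNReal.ofReal ‖sobolevVec k f‖ = sobolevENorm k f := by
  rw [sobolevVec_eq hf', Lp.norm_toLp, ENNReal.ofReal_toReal hf'.2.ne, sobolevENorm]

theorem SobolevSpace.continuous {k : ℝ} (f : SobolevSpace n M k) : Continuous f := f.2.1

theorem SobolevSpace.memLp {k : ℝ} (f : SobolevSpace n M k) (c : LocalizedChart n M) :
    MemLp (besselFourier k (c.localize f)) 2 volume := f.2.2 c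

/-- The localization in a chart, as a linear map on `H^k(M)`. -/
def sobolevLocal (k : ℝ) (c : LocalizedChart n M) :
    SobolevSpace n M k →ₗ[ℝ] Lp ℂ 2 (volume : Measure (EuclideanSpace ℝ (Fin n))) where
  toFun f := sobolevVec k (c.localize f)
  map_add' f g := by
    rw [← sobolevVec_add (c.integrable_real_localize f.continuous)
      (c.integrable_real_localize g.continuous) (f.memLp c) (g.memLp c), ← c.localize_add]
    rfl
  map_smul' r f := by
    rw [RingHom.id_apply, ← sobolevVec_smul r (f.memLp c), ← c.localize_smul]
    rfl

theorem SobolevSpace.tendsto_iff {k : ℝ} {ι : Type*} {l : Filter ι} {F : ι → SobolevSpace n M k}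
    {G : SobolevSpace n M k} : Tendsto F l (𝓝 G) ↔
      ∀ c : LocalizedChart n M, Tendsto (fun i => sobolevLocal k c (F i)) l
        (𝓝 (sobolevLocal k c G)) := by
  rw [nhds_iInf, tendsto_iInf]
  refine forall_congr' fun c => ?_
  rw [nhds_induced, tendsto_comap_iff]
  have e : ∀ f : SobolevSpace n M k, sobolevLocal k c f =
      (f.2.2 c).toLp (besselFourier k (c.localize f.1)) := fun f => sobolevVec_eq _
  simp only [e]
  rfl

theorem SobolevSpace.continuousOn_iff {k : ℝ} {J : Set ℝ} {w : ℝ → SobolevSpace n M k} :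
    ContinuousOn w J ↔ ∀ c : LocalizedChart n M, ContinuousOn (fun t => sobolevLocal k c (w t)) J :=
  ⟨fun h c t ht => SobolevSpace.tendsto_iff.1 (h t ht) c,
    fun h t ht => SobolevSpace.tendsto_iff.2 fun c => h c t ht⟩

theorem map_slope {E F : Type*} [AddCommGroup E] [Module ℝ E] [AddCommGroup F] [Module ℝ F]
    (L : E →ₗ[ℝ] F) (u : ℝ → E) (t s : ℝ) : L (slope u t s) = slope (fun r => L (u r)) t s := by
  simp [slope_def_module]

/-- The space carries only a topology defined by seminorms; this reduces time derivatives in it to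
ordinary derivatives in the Hilbert space L², one for each localization. -/
theorem SobolevSpace.tendsto_slope_iff {k : ℝ} {J : Set ℝ} {u : ℝ → SobolevSpace n M k}
    {v : SobolevSpace n M k} {t : ℝ} : Tendsto (slope u t) (𝓝[J \ {t}] t) (𝓝 v) ↔
      ∀ c : LocalizedChart n M,
        HasDerivWithinAt (fun s => sobolevLocal k c (u s)) (sobolevLocal k c v) J t := by
  rw [SobolevSpace.tendsto_iff]
  refine forall_congr' fun c => ?_
  rw [hasDerivWithinAt_iff_tendsto_slope]
  simp only [map_slope]

theorem exists_localizedChart_at [IsManifold (𝓡 n) ∞ M] (x : M) :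
    ∃ c : LocalizedChart n M, c.chart = chartAt (EuclideanSpace ℝ (Fin n)) x ∧
      ∀ᶠ y in 𝓝 (chartAt (EuclideanSpace ℝ (Fin n)) x x), c.cutoff y = 1 := by
  obtain ⟨c, hc, -, h1⟩ := exists_localizedChart (K := {chartAt (EuclideanSpace ℝ (Fin n)) x x})
    (IsManifold.chart_mem_maximalAtlas (I := 𝓡 n) (n := ∞) x) isCompact_singleton
    (singleton_subset_iff.2 (mem_chart_target _ x))
  rw [nhdsSet_singleton] at h1
  exact ⟨c, hc, h1⟩

/-- Point evaluations are limits of the localizations. -/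
theorem SobolevSpace.tendsto_apply [IsManifold (𝓡 n) ∞ M] {k : ℝ} (hk : (n : ℝ) / 2 < k)
    {ι : Type*} {l : Filter ι} {F : ι → SobolevSpace n M k} {G : SobolevSpace n M k}
    (h : Tendsto F l (𝓝 G)) (x : M) : Tendsto (fun i => F i x) l (𝓝 (G x)) := by
  obtain ⟨c, hc, h1⟩ := exists_localizedChart_at (n := n) x
  have hloc : ∀ f : M → ℝ, c.localize f (chartAt (EuclideanSpace ℝ (Fin n)) x x) = f x := by
    intro f
    simp only [LocalizedChart.localize, h1.self_of_nhds, hc, one_mul]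
    rw [(chartAt (EuclideanSpace ℝ (Fin n)) x).left_inv (mem_chart_source _ x)]
  obtain ⟨C, hC⟩ := lintegral_besselFourier_le (n := n) (j := 0) (k := k) (by linarith)
  have hle : ∀ i, |F i x - G x| ≤ C * ‖sobolevLocal k c (F i) - sobolevLocal k c G‖ := by
    intro i
    set f := F i - G with hf
    have hfi := c.integrable_real_localize f.continuous
    have e : F i x - G x = c.localize f (chartAt (EuclideanSpace ℝ (Fin n)) x x) :=
      (hloc f).symm
    rw [← map_sub, e, ← Real.norm_eq_abs, ← ENNReal.ofReal_le_ofReal_iff (by positivity),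
      ofReal_norm, ENNReal.ofReal_mul C.coe_nonneg]
    refine (enorm_le_wienerNorm (c.continuous_localize f.continuous) hfi _).trans ?_
    have h2 : ENNReal.ofReal ‖sobolevLocal k c f‖ = sobolevENorm k (c.localize f) :=
      norm_sobolevVec (f.memLp c)
    rw [h2, ENNReal.ofReal_coe_nnreal]
    refine le_trans (lintegral_mono fun ξ => ?_) (hC _ hfi)
    simpa using norm_pow_mul_enorm_realFourier_le 0 (c.localize f) ξ
  rw [tendsto_iff_norm_sub_tendsto_zero]
  refine squeeze_zero (fun _ => norm_nonneg _) hle ?_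
  simpa using (tendsto_iff_norm_sub_tendsto_zero.1 (SobolevSpace.tendsto_iff.1 h c)).const_mul
    (C : ℝ)

end SobolevTopology

end FisherRao

end

noncomputable section

namespace FisherRao

open scoped ENNReal NNReal

/-! ### The smooth topology compared with Sobolev and uniform convergence. -/

section SmoothTopology

variable {n : ℕ} {M : Type*} [TopologicalSpace M] [ChartedSpace (EuclideanSpace ℝ (Fin n)) M]

/-- A smooth function, as an element of `H^k(M)`. -/
def toSobolev (k : ℝ) : C^∞⟮𝓡 n, M; 𝓘(ℝ, ℝ), ℝ⟯ →ₗ[ℝ] SobolevSpace n M k where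
  toFun f := ⟨f, mem_sobolevSubmodule_of_contMDiff k f.contMDiff⟩
  map_add' _ _ := rfl
  map_smul' _ _ := rfl

theorem smooth_tendsto_iff {ι : Type*} {l : Filter ι} {F : ι → C^∞⟮𝓡 n, M; 𝓘(ℝ, ℝ), ℝ⟯}
    {G : C^∞⟮𝓡 n, M; 𝓘(ℝ, ℝ), ℝ⟯} : Tendsto F l (𝓝 G) ↔ ∀ (c : LocalizedChart n M) (j : ℕ),
      TendstoUniformly (fun i y => iteratedFDeriv ℝ j (c.localize (F i)) y)
        (fun y => iteratedFDeriv ℝ j (c.localize G) y) l := by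
  rw [nhds_iInf, tendsto_iInf]
  refine forall_congr' fun c => ?_
  rw [nhds_iInf, tendsto_iInf]
  refine forall_congr' fun j => ?_
  rw [nhds_induced, tendsto_comap_iff, UniformFun.tendsto_iff_tendstoUniformly]
  rfl

/-- Convergence in all Sobolev spaces implies convergence in the smooth topology. -/
theorem smooth_tendsto_of_sobolev {ι : Type*} {l : Filter ι}
    {F : ι → C^∞⟮𝓡 n, M; 𝓘(ℝ, ℝ), ℝ⟯} {G : C^∞⟮𝓡 n, M; 𝓘(ℝ, ℝ), ℝ⟯}
    (h : ∀ k : ℝ, (n : ℝ) / 2 < k → Tendsto (fun i => toSobolev k (F i)) l (𝓝 (toSobolev k G))) :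
    Tendsto F l (𝓝 G) := by
  rw [smooth_tendsto_iff]
  intro c j
  -- Large enough for the embedding of H^k into C^j, which needs 2(k - j) > n.
  set k : ℝ := n / 2 + j + 1
  obtain ⟨C, hC⟩ := enorm_iteratedFDeriv_le (n := n) j (k := k) (by simp only [k]; linarith)
  have h1 := SobolevSpace.tendsto_iff.1 (h k (by
    have : (0 : ℝ) ≤ j := by positivity
    simp only [k]; linarith)) c
  rw [tendsto_iff_edist_tendsto_0] at h1
  rw [EMetric.tendstoUniformly_iff]
  intro ε hε
  have h2 : Tendsto (fun i => C * edist (sobolevLocal k c (toSobolev k (F i)))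
      (sobolevLocal k c (toSobolev k G))) l (𝓝 0) := by
    simpa using ENNReal.Tendsto.const_mul h1 (Or.inr ENNReal.coe_ne_top)
  filter_upwards [h2.eventually (gt_mem_nhds hε)] with i hi y
  refine lt_of_le_of_lt ?_ hi
  have hF := c.contDiff_localize (F i).contMDiff
  have hG := c.contDiff_localize G.contMDiff
  have e1 : iteratedFDeriv ℝ j (c.localize (F i)) y - iteratedFDeriv ℝ j (c.localize G) y =
      iteratedFDeriv ℝ j (c.localize (F i - G : C^∞⟮𝓡 n, M; 𝓘(ℝ, ℝ), ℝ⟯)) y := by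
    have e2 : c.localize (F i - G : C^∞⟮𝓡 n, M; 𝓘(ℝ, ℝ), ℝ⟯) = c.localize (F i) - c.localize G :=
      c.localize_sub _ _
    rw [e2, iteratedFDeriv_sub_apply (hF.contDiffAt.of_le (by exact_mod_cast le_top))
      (hG.contDiffAt.of_le (by exact_mod_cast le_top))]
  rw [edist_comm, edist_eq_enorm_sub, edist_eq_enorm_sub, e1, ← map_sub, ← map_sub]
  refine (hC _ (c.contDiff_localize (F i - G).contMDiff) (c.hasCompactSupport_localize _) y).trans
    (le_of_eq ?_)
  congr 1
  rw [← ofReal_norm]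
  exact (norm_sobolevVec ((toSobolev k (F i - G)).memLp c)).symm

/-- Convergence in the smooth topology implies locally uniform convergence. -/
theorem smooth_tendstoLocallyUniformly [IsManifold (𝓡 n) ∞ M] {ι : Type*} {l : Filter ι}
    {F : ι → C^∞⟮𝓡 n, M; 𝓘(ℝ, ℝ), ℝ⟯} {G : C^∞⟮𝓡 n, M; 𝓘(ℝ, ℝ), ℝ⟯} (h : Tendsto F l (𝓝 G)) :
    TendstoLocallyUniformly (fun i x => F i x) (fun x => G x) l := by
  rw [Metric.tendstoLocallyUniformly_iff]
  intro ε hε x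
  obtain ⟨c, hc, h1⟩ := exists_localizedChart_at (n := n) x
  set e := chartAt (EuclideanSpace ℝ (Fin n)) x
  have h2 : ∀ᶠ z in 𝓝 x, c.cutoff (e z) = 1 :=
    (e.continuousAt (mem_chart_source _ x)).eventually h1
  have h3 : ∀ᶠ z in 𝓝 x, z ∈ e.source := e.open_source.mem_nhds (mem_chart_source _ x)
  refine ⟨_, h2.and h3, ?_⟩
  filter_upwards [Metric.tendstoUniformly_iff.1 (smooth_tendsto_iff.1 h c 0) ε hε] with i hi z hz
  have hloc : ∀ f : M → ℝ, c.localize f (e z) = f z := by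
    intro f
    simp only [LocalizedChart.localize, hc]
    rw [hz.1, e.left_inv hz.2, one_mul]
  have h4 := hi (e z)
  rw [iteratedFDeriv_zero_eq_comp, iteratedFDeriv_zero_eq_comp] at h4
  simp only [Function.comp_apply, LinearIsometryEquiv.dist_map, hloc] at h4
  exact h4

end SmoothTopology

section SpaceOfContinuousFunctions

variable {n : ℕ} {M : Type*} [TopologicalSpace M] [CompactSpace M]
  [ChartedSpace (EuclideanSpace ℝ (Fin n)) M]

/-- A smooth function, as a continuous function. -/
def toContinuous : C^∞⟮𝓡 n, M; 𝓘(ℝ, ℝ), ℝ⟯ →ₗ[ℝ] C(M, ℝ) where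
  toFun f := ⟨f, f.contMDiff.continuous⟩
  map_add' _ _ := rfl
  map_smul' _ _ := rfl

theorem tendsto_toContinuous [IsManifold (𝓡 n) ∞ M] {ι : Type*} {l : Filter ι}
    {F : ι → C^∞⟮𝓡 n, M; 𝓘(ℝ, ℝ), ℝ⟯} {G : C^∞⟮𝓡 n, M; 𝓘(ℝ, ℝ), ℝ⟯} (h : Tendsto F l (𝓝 G)) :
    Tendsto (fun i => toContinuous (F i)) l (𝓝 (toContinuous G)) :=
  ContinuousMap.tendsto_iff_tendstoLocallyUniformly.2 (smooth_tendstoLocallyUniformly h)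

end SpaceOfContinuousFunctions

/-! ### Differentiation of integrals over M. -/

section Integrals

variable {M : Type*} [TopologicalSpace M] [CompactSpace M] [MeasurableSpace M] [BorelSpace M]
  (lam : Measure M) [IsFiniteMeasure lam]

theorem integrable_of_continuous {f : M → ℝ} (hf : Continuous f) : Integrable f lam := by
  obtain ⟨C, hC⟩ := isCompact_univ.exists_bound_of_continuousOn hf.continuousOn
  exact Integrable.of_bound hf.measurable.aestronglyMeasurable C
    (Eventually.of_forall fun x => hC x (mem_univ x))

/-- Integration, as a continuous linear functional on the continuous functions. -/
def integralCLM : C(M, ℝ) →L[ℝ] ℝ :=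
  LinearMap.mkContinuous
    { toFun := fun f => ∫ x, f x ∂lam
      map_add' := fun f g => integral_add (integrable_of_continuous lam f.continuous)
        (integrable_of_continuous lam g.continuous)
      map_smul' := fun r f => integral_const_mul r f } (lam.real univ) fun f => by
    rw [mul_comm]
    exact norm_integral_le_of_norm_le_const (Eventually.of_forall fun x => f.norm_coe_le_norm x)

/-- The construction of powers again, now in the Banach algebra C(M), where units are the nowhere
vanishing functions; integration against b is a continuous functional there. -/
theorem hasDerivAt_integral_rpow {b φ : M → ℝ} (hb : Continuous b) (hφ : Continuous φ) (s : ℝ)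
    {τ : ℝ} (hτ : τ ∈ positiveTimes φ) :
    HasDerivAt (fun τ => ∫ x, b x * (1 + τ * φ x) ^ s ∂lam)
      (s * ∫ x, b x * φ x * (1 + τ * φ x) ^ (s - 1) ∂lam) τ := by
  have hI := isOpen_positiveTimes hφ
  obtain ⟨P, hP, hPe⟩ := exists_rpow_curve (⟨φ, hφ⟩ : C(M, ℝ)) hI (ordConnected_positiveTimes φ)
    (zero_mem_positiveTimes φ) (fun τ hτ => by
      rw [ContinuousMap.isUnit_iff_forall_ne_zero]
      exact fun x => (hτ x).ne') s
  have hPe' := fun x : M => hPe (ContinuousMap.evalAlgHom ℝ ℝ x) (continuous_eval_const x)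
    (fun τ hτ => hτ x)
  set B : C(M, ℝ) := ⟨b, hb⟩
  set L : C(M, ℝ) →L[ℝ] ℝ := (integralCLM lam).comp (ContinuousLinearMap.mul ℝ C(M, ℝ) B)
  have hd := L.hasFDerivAt.comp_hasDerivAt τ (hP τ hτ)
  refine (hd.congr_of_eventuallyEq ?_).congr_deriv ?_
  · filter_upwards [hI.mem_nhds hτ] with σ hσ
    refine integral_congr_ae (Eventually.of_forall fun x => ?_)
    exact congrArg (b x * ·) (hPe' x σ hσ).1.symm
  · rw [map_smul, smul_eq_mul]
    congr 1
    refine integral_congr_ae (Eventually.of_forall fun x => ?_)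
    exact (congrArg (b x * ·) (hPe' x τ hτ).2).trans (mul_assoc _ _ _).symm

/-- Differentiation under the integral sign, within a convex set of times. -/
theorem hasDerivWithinAt_integral_of_bounded {J : Set ℝ} (hJ : Convex ℝ J) {F F' : ℝ → M → ℝ}
    (hF : ∀ s ∈ J, Continuous (F s))
    (hd : ∀ x, ∀ s ∈ J, HasDerivWithinAt (fun s => F s x) (F' s x) J s) {C : ℝ}
    (hC : ∀ s ∈ J, ∀ x, |F' s x| ≤ C) {t : ℝ} (ht : t ∈ J) :
    HasDerivWithinAt (fun s => ∫ x, F s x ∂lam) (∫ x, F' t x ∂lam) J t := by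
  rw [hasDerivWithinAt_iff_tendsto_slope]
  have h1 : Tendsto (fun s => ∫ x, slope (fun s => F s x) t s ∂lam) (𝓝[J \ {t}] t)
      (𝓝 (∫ x, F' t x ∂lam)) := by
    -- By the mean value inequality on the convex set J, the bound C for the derivative dominates
    -- the difference quotients.
    refine tendsto_integral_filter_of_dominated_convergence (fun _ => C) ?_ ?_
      (integrable_const _) ?_
    · filter_upwards [self_mem_nhdsWithin] with s hs
      simp only [slope_def_module]
      exact (((hF s hs.1).sub (hF t ht)).const_smul (s - t)⁻¹).measurable.aestronglyMeasurable
    · filter_upwards [self_mem_nhdsWithin] with s hs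
      refine Eventually.of_forall fun x => ?_
      have h2 := hJ.norm_image_sub_le_of_norm_hasDerivWithin_le (hd x) (fun s hs => hC s hs x) ht
        hs.1
      have h3 : 0 < ‖s - t‖ := norm_pos_iff.2 (sub_ne_zero.2 hs.2)
      rw [slope_def_module, norm_smul, norm_inv, inv_mul_le_iff₀ h3, mul_comm]
      exact h2
    · exact Eventually.of_forall fun x => hasDerivWithinAt_iff_tendsto_slope.1 (hd x t ht)
  refine h1.congr' ?_
  filter_upwards [self_mem_nhdsWithin] with s hs
  simp only [slope_def_module]
  rw [integral_smul, integral_sub (integrable_of_continuous lam (hF s hs.1))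
    (integrable_of_continuous lam (hF t ht))]

end Integrals

/-! ### Smooth volumes charge every nonempty open set. -/

section OpenPositive

variable {n : ℕ} {M : Type*} [TopologicalSpace M] [ChartedSpace (EuclideanSpace ℝ (Fin n)) M]
  [IsManifold (𝓡 n) ∞ M] [MeasurableSpace M] [BorelSpace M]

theorem IsSmoothVolume.isOpenPosMeasure {lam : Measure M} (h : IsSmoothVolume n lam) :
    lam.IsOpenPosMeasure := by
  refine ⟨fun U hU hne h0 => ?_⟩
  obtain ⟨x, hx⟩ := hne
  set e := chartAt (EuclideanSpace ℝ (Fin n)) x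
  obtain ⟨ρ, hρ, hρpos, hmap⟩ := h e (IsManifold.chart_mem_maximalAtlas (I := 𝓡 n) (n := ∞) x)
  set V := e.target ∩ e.symm ⁻¹' U
  have hV : IsOpen V := e.isOpen_inter_preimage_symm hU
  have hVne : V.Nonempty := ⟨e x, e.map_source (mem_chart_source _ x), by
    rw [mem_preimage, e.left_inv (mem_chart_source _ x)]; exact hx⟩
  have hem : AEMeasurable e (lam.restrict e.source) :=
    e.continuousOn.aemeasurable e.open_source.measurableSet
  have h1 : (lam.restrict e.source).map e V = 0 := by
    rw [Measure.map_apply_of_aemeasurable hem hV.measurableSet,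
      Measure.restrict_apply₀' e.open_source.measurableSet.nullMeasurableSet]
    refine measure_mono_null ?_ h0
    rintro z ⟨hz, hz'⟩
    have := hz.2
    rwa [mem_preimage, e.left_inv hz'] at this
  rw [hmap, withDensity_apply _ hV.measurableSet, Measure.restrict_restrict hV.measurableSet,
    inter_eq_left.2 inter_subset_left] at h1
  have hρm : AEMeasurable (fun y => ENNReal.ofReal (ρ y)) (volume.restrict V) :=
    ((hρ.continuousOn.mono inter_subset_left).aemeasurable hV.measurableSet).ennreal_ofReal
  rw [lintegral_eq_zero_iff' hρm] at h1
  have h2 : ∀ᵐ y ∂(volume.restrict V), False := by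
    filter_upwards [h1, ae_restrict_mem hV.measurableSet] with y hy hyV
    exact (ENNReal.ofReal_pos.2 (hρpos y hyV.1)).ne' hy
  rw [eventually_false_iff_eq_bot, ae_eq_bot, Measure.restrict_eq_zero] at h2
  exact (hV.measure_pos volume hVne).ne' h2

end OpenPositive

end FisherRao

end

noncomputable section

namespace FisherRao

open scoped ENNReal NNReal

/-! ### The change of time between τ and t. -/

section Clock

/-- The time at which the explicit solution with mass function `Z` reaches the parameter `τ`. -/
def clock (p : ℝ) (Z : ℝ → ℝ) (τ : ℝ) : ℝ := ∫ σ in (0 : ℝ)..τ, Z σ ^ (-(2 / p))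

/-- The supremum of the times reached in `I`. -/
def lifetime (p : ℝ) (Z : ℝ → ℝ) (I : Set ℝ) : EReal := ⨆ τ ∈ I, (clock p Z τ : EReal)

variable {p : ℝ} {Z : ℝ → ℝ} {I : Set ℝ}

@[simp] theorem clock_zero (p : ℝ) (Z : ℝ → ℝ) : clock p Z 0 = 0 := by simp [clock]

theorem hasDerivAt_clock (hI : IsOpen I) (hc : I.OrdConnected) (h0 : (0 : ℝ) ∈ I)
    (hZ : ContinuousOn Z I) (hpos : ∀ τ ∈ I, 0 < Z τ) {τ : ℝ} (hτ : τ ∈ I) :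
    HasStrictDerivAt (clock p Z) (Z τ ^ (-(2 / p))) τ := by
  have hc' : ContinuousOn (fun σ => Z σ ^ (-(2 / p))) I := fun σ hσ =>
    (hZ σ hσ).rpow_const (Or.inl (hpos σ hσ).ne')
  refine intervalIntegral.integral_hasStrictDerivAt_right
    (hc'.mono (hc.uIcc_subset h0 hτ)).intervalIntegrable
    (hc'.stronglyMeasurableAtFilter hI τ hτ) ((hc' τ hτ).continuousAt (hI.mem_nhds hτ))

theorem strictMonoOn_clock (hI : IsOpen I) (hc : I.OrdConnected) (h0 : (0 : ℝ) ∈ I)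
    (hZ : ContinuousOn Z I) (hpos : ∀ τ ∈ I, 0 < Z τ) : StrictMonoOn (clock p Z) I := by
  refine strictMonoOn_of_deriv_pos hc.convex (fun τ hτ =>
    (hasDerivAt_clock hI hc h0 hZ hpos hτ).hasDerivAt.continuousAt.continuousWithinAt) ?_
  intro τ hτ
  rw [(hasDerivAt_clock hI hc h0 hZ hpos (interior_subset hτ)).hasDerivAt.deriv]
  exact Real.rpow_pos_of_pos (hpos τ (interior_subset hτ)) _

/-- The supremum is not attained: I is open and the clock strictly increases. Hence the interval of
existence is half-open. -/
theorem clock_lt_lifetime (hI : IsOpen I) (hc : I.OrdConnected) (h0 : (0 : ℝ) ∈ I)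
    (hZ : ContinuousOn Z I) (hpos : ∀ τ ∈ I, 0 < Z τ) {τ : ℝ} (hτ : τ ∈ I) :
    (clock p Z τ : EReal) < lifetime p Z I := by
  obtain ⟨σ, hσ, hτσ⟩ : ∃ σ ∈ I, τ < σ := by
    obtain ⟨ε, hε, hball⟩ := Metric.isOpen_iff.1 hI τ hτ
    refine ⟨τ + ε / 2, hball ?_, by linarith⟩
    rw [Metric.mem_ball, Real.dist_eq]
    rw [show τ + ε / 2 - τ = ε / 2 by ring, abs_of_pos (by linarith)]
    linarith
  refine lt_of_lt_of_le (b := (clock p Z σ : EReal)) ?_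
    (le_iSup₂ (f := fun τ (_ : τ ∈ I) => (clock p Z τ : EReal)) σ hσ)
  exact_mod_cast strictMonoOn_clock hI hc h0 hZ hpos hτ hσ hτσ

/-- The change of time of the explicit solution. -/
theorem exists_time_change (hp : 0 < p) (hI : IsOpen I) (hc : I.OrdConnected) (h0 : (0 : ℝ) ∈ I)
    {Z₁ Z₂ : ℝ → ℝ} (hpos : ∀ τ ∈ I, 0 < Z τ) (hZ : ∀ τ ∈ I, HasDerivAt Z (Z₁ τ) τ)
    (hZ₁ : ∀ τ ∈ I, HasDerivAt Z₁ (Z₂ τ) τ) (hZ₂ : ContinuousOn Z₂ I) (hZ0 : Z 0 = 1)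
    (hZ₁0 : Z₁ 0 = 0) :
    ∃ (J : Set ℝ) (τ A A₁ A₂ : ℝ → ℝ), IsOpen J ∧ timeInterval (lifetime p Z I) ⊆ J ∧
      (∀ t ∈ J, τ t ∈ I ∧ clock p Z (τ t) = t ∧ 0 < A t ∧ A t ^ p * Z (τ t) = 1 ∧
        HasDerivAt τ (A t ^ (-2 : ℝ)) t ∧ HasDerivAt A (A₁ t) t ∧ HasDerivAt A₁ (A₂ t) t) ∧
      ContinuousOn A₂ J ∧ τ 0 = 0 ∧ A 0 = 1 ∧ A₁ 0 = 0 := by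
  have hZc : ContinuousOn Z I := fun τ hτ => (hZ τ hτ).continuousAt.continuousWithinAt
  have hmono := strictMonoOn_clock (p := p) hI hc h0 hZc hpos
  have hderiv : ∀ τ ∈ I, HasStrictDerivAt (clock p Z) (Z τ ^ (-(2 / p))) τ := fun τ hτ =>
    hasDerivAt_clock hI hc h0 hZc hpos hτ
  set τ : ℝ → ℝ := Function.invFunOn (clock p Z) I
  have hinv : ∀ σ ∈ I, τ (clock p Z σ) = σ := fun σ hσ => hmono.injOn.leftInvOn_invFunOn hσ
  have hτ : ∀ σ ∈ I, HasDerivAt τ (Z σ ^ (-(2 / p)))⁻¹ (clock p Z σ) := fun σ hσ =>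
    ((hderiv σ hσ).to_local_left_inverse (Real.rpow_pos_of_pos (hpos σ hσ) _).ne' (by
      filter_upwards [hI.mem_nhds hσ] with ρ hρ using hinv ρ hρ)).hasDerivAt
  -- The amplitude as a function of the parameter, forced by α^p Z = 1. Here β is its t-derivative
  -- Z^(2/p) dα/dσ, and γ is dβ/dσ.
  set α : ℝ → ℝ := fun σ => Z σ ^ (-(1 / p))
  set β : ℝ → ℝ := fun σ => -(1 / p) * (Z σ ^ (1 / p - 1) * Z₁ σ)
  set γ : ℝ → ℝ := fun σ => -(1 / p) * (Z₁ σ * (1 / p - 1) * Z σ ^ (1 / p - 1 - 1) * Z₁ σ +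
    Z σ ^ (1 / p - 1) * Z₂ σ)
  have hα : ∀ σ ∈ I, HasDerivAt α (Z₁ σ * (-(1 / p)) * Z σ ^ (-(1 / p) - 1)) σ := fun σ hσ =>
    (hZ σ hσ).rpow_const (Or.inl (hpos σ hσ).ne')
  have hβ : ∀ σ ∈ I, HasDerivAt β (γ σ) σ := fun σ hσ =>
    (((hZ σ hσ).rpow_const (Or.inl (hpos σ hσ).ne')).mul (hZ₁ σ hσ)).const_mul _
  have hα2 : ∀ σ ∈ I, α σ ^ (-2 : ℝ) = Z σ ^ (2 / p) := fun σ hσ => by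
    simp only [α]
    rw [← Real.rpow_mul (hpos σ hσ).le]
    congr 1; ring
  have hτ' : ∀ σ ∈ I, HasDerivAt τ (Z σ ^ (2 / p)) (clock p Z σ) := fun σ hσ => by
    have := hτ σ hσ
    rwa [← Real.rpow_neg (hpos σ hσ).le, neg_neg] at this
  have hopen : IsOpen (clock p Z '' I) := by
    rw [isOpen_iff_mem_nhds]
    rintro _ ⟨σ, hσ, rfl⟩
    rw [← (hderiv σ hσ).map_nhds_eq (Real.rpow_pos_of_pos (hpos σ hσ) _).ne']
    exact image_mem_map (hI.mem_nhds hσ)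
  -- J is the whole image of the clock, negative times included, so that two-sided derivatives exist
  -- at t = 0.
  refine ⟨clock p Z '' I, τ, α ∘ τ, β ∘ τ, fun t => γ (τ t) * Z (τ t) ^ (2 / p), hopen,
    ?_, ?_, ?_, ?_, ?_, ?_⟩
  · rintro t ⟨ht0, htT⟩
    obtain ⟨σ, hσ, htσ⟩ : ∃ σ ∈ I, t < clock p Z σ := by
      simp only [lifetime, lt_iSup_iff] at htT
      obtain ⟨σ, hσ, h⟩ := htT
      exact ⟨σ, hσ, by exact_mod_cast h⟩
    have hσ0 : 0 ≤ σ := by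
      by_contra h
      have := hmono hσ h0 (not_le.1 h)
      rw [clock_zero] at this
      linarith
    have hsub : Icc 0 σ ⊆ I := hc.out h0 hσ
    have := intermediate_value_Icc hσ0 (f := clock p Z) fun ρ hρ =>
      (hderiv ρ (hsub hρ)).hasDerivAt.continuousAt.continuousWithinAt
    obtain ⟨ρ, hρ, hρt⟩ := this ⟨by rw [clock_zero]; exact ht0, htσ.le⟩
    exact ⟨ρ, hsub hρ, hρt⟩
  · rintro _ ⟨σ, hσ, rfl⟩
    have hZσ := hpos σ hσ
    have h1 := hτ' σ hσ
    refine ⟨by rw [hinv σ hσ]; exact hσ, by rw [hinv σ hσ], ?_, ?_, ?_, ?_, ?_⟩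
    · simp only [Function.comp_apply, hinv σ hσ, α]
      exact Real.rpow_pos_of_pos hZσ _
    · simp only [Function.comp_apply, hinv σ hσ, α]
      rw [← Real.rpow_mul hZσ.le, show -(1 / p) * p = -1 by field_simp, Real.rpow_neg_one,
        inv_mul_cancel₀ hZσ.ne']
    · simp only [Function.comp_apply, hinv σ hσ]
      rw [hα2 σ hσ]
      exact h1
    · have h2 := hα σ hσ
      rw [← hinv σ hσ] at h2
      refine (h2.comp _ h1).congr_deriv ?_
      simp only [Function.comp_apply, hinv σ hσ, β]
      rw [mul_assoc, ← Real.rpow_add hZσ, show -(1 / p) - 1 + 2 / p = 1 / p - 1 by ring]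
      ring
    · have h2 := hβ σ hσ
      rw [← hinv σ hσ] at h2
      refine (h2.comp _ h1).congr_deriv ?_
      simp only [hinv σ hσ]
  · rintro _ ⟨σ, hσ, rfl⟩
    have hτc : ContinuousAt τ (clock p Z σ) := (hτ' σ hσ).continuousAt
    have hg : ContinuousAt (fun σ => γ σ * Z σ ^ (2 / p)) (τ (clock p Z σ)) := by
      rw [hinv σ hσ]
      have hZ2 : ContinuousAt Z₂ σ := (hZ₂ σ hσ).continuousAt (hI.mem_nhds hσ)
      have hZ1 : ContinuousAt Z₁ σ := (hZ₁ σ hσ).continuousAt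
      have hZ0 : ContinuousAt Z σ := (hZ σ hσ).continuousAt
      have hr : ∀ q : ℝ, ContinuousAt (fun σ => Z σ ^ q) σ := fun q =>
        hZ0.rpow_const (Or.inl (hpos σ hσ).ne')
      exact (continuousAt_const.mul ((((hZ1.mul continuousAt_const).mul (hr _)).mul hZ1).add
        ((hr _).mul hZ2))).mul (hr _)
    exact (ContinuousAt.comp (g := fun σ => γ σ * Z σ ^ (2 / p)) hg hτc).continuousWithinAt
  all_goals
    have hτ0 : τ 0 = 0 := by simpa using hinv 0 h0
    simp [hτ0, α, β, hZ0, hZ₁0]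

end Clock

end FisherRao

end

noncomputable section

namespace FisherRao

open scoped ENNReal NNReal

/-! ### The explicit formula and its time derivatives. -/

section Profile

variable {M : Type*}

/-- The position of the explicit solution, in terms of the parameter `τ` and the amplitude `A`. -/
def profile (p : ℝ) (f φ : M → ℝ) (τ A : ℝ) : M → ℝ := fun x =>
  A ^ p * (f x * (1 + τ * φ x) ^ p)

/-- The velocity of the explicit solution. -/
def profileVel (p : ℝ) (f φ : M → ℝ) (τ A A₁ : ℝ) : M → ℝ := fun x =>
  p * A₁ * A ^ p / A * (f x * (1 + τ * φ x) ^ p) +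
    p * A ^ p / A ^ 2 * (f x * φ x * (1 + τ * φ x) ^ (p - 1))

/-- The acceleration of the explicit solution. -/
def profileAcc (p : ℝ) (f φ : M → ℝ) (τ A A₁ A₂ : ℝ) : M → ℝ := fun x =>
  A ^ p * (p * A₂ / A + p * (p - 1) * A₁ ^ 2 / A ^ 2) * (f x * (1 + τ * φ x) ^ p) +
    A ^ p * (2 * p * (p - 1) * A₁ / A ^ 3) * (f x * φ x * (1 + τ * φ x) ^ (p - 1)) +
    A ^ p * (p * (p - 1) / A ^ 4) * (f x * φ x * φ x * (1 + τ * φ x) ^ (p - 1 - 1))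

/-- Only the chain rule, τ' = A^(-2) and the relations between the Q's enter. The target space is
arbitrary so that the computation serves both for localizations in L² and for integrals over M. -/
theorem hasDerivAt_profile {E : Type*} [NormedAddCommGroup E] [NormedSpace ℝ E] {Q₀ Q₁ Q₂ : ℝ → E}
    {p : ℝ} {τ A A₁ A₂ : ℝ → ℝ} {t : ℝ} (hA : 0 < A t)
    (hτ : HasDerivAt τ (A t ^ (-2 : ℝ)) t) (hA₁ : HasDerivAt A (A₁ t) t)
    (hA₂ : HasDerivAt A₁ (A₂ t) t) (hQ₀ : HasDerivAt Q₀ (p • Q₁ (τ t)) (τ t))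
    (hQ₁ : HasDerivAt Q₁ ((p - 1) • Q₂ (τ t)) (τ t)) :
    HasDerivAt (fun t => A t ^ p • Q₀ (τ t))
      ((p * A₁ t * A t ^ p / A t) • Q₀ (τ t) + (p * A t ^ p / A t ^ 2) • Q₁ (τ t)) t ∧
    HasDerivAt (fun t => (p * A₁ t * A t ^ p / A t) • Q₀ (τ t) +
        (p * A t ^ p / A t ^ 2) • Q₁ (τ t))
      ((A t ^ p * (p * A₂ t / A t + p * (p - 1) * A₁ t ^ 2 / A t ^ 2)) • Q₀ (τ t) +
        (A t ^ p * (2 * p * (p - 1) * A₁ t / A t ^ 3)) • Q₁ (τ t) +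
        (A t ^ p * (p * (p - 1) / A t ^ 4)) • Q₂ (τ t)) t := by
  have hne := hA.ne'
  have e2 : A t ^ (-2 : ℝ) = 1 / A t ^ 2 := by
    rw [Real.rpow_neg hA.le, one_div]; norm_cast
  have hG : HasDerivAt (fun t => A t ^ p) (p * A₁ t * A t ^ p / A t) t := by
    refine (hA₁.rpow_const (Or.inl hne)).congr_deriv ?_
    rw [Real.rpow_sub_one hne]; ring
  have hq₀ : HasDerivAt (fun t => Q₀ (τ t)) ((A t ^ (-2 : ℝ)) • p • Q₁ (τ t)) t :=
    HasDerivAt.scomp t hQ₀ hτ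
  have hq₁ : HasDerivAt (fun t => Q₁ (τ t)) ((A t ^ (-2 : ℝ)) • (p - 1) • Q₂ (τ t)) t :=
    HasDerivAt.scomp t hQ₁ hτ
  constructor
  · refine (hG.smul hq₀).congr_deriv ?_
    rw [e2, smul_smul, smul_smul, add_comm]
    congr 2
    field_simp
  · have h0 : HasDerivAt (fun t => p * A₁ t * A t ^ p / A t)
        (A t ^ p * (p * A₂ t / A t + p * (p - 1) * A₁ t ^ 2 / A t ^ 2)) t := by
      refine (((hA₂.const_mul p).mul hG).div hA₁ hne).congr_deriv ?_
      simp only [Pi.mul_apply]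
      field_simp
      ring
    have h1 : HasDerivAt (fun t => p * A t ^ p / A t ^ 2)
        (p * (p - 2) * A₁ t * A t ^ p / A t ^ 3) t := by
      refine ((hG.const_mul p).div (hA₁.pow 2) (pow_ne_zero 2 hne)).congr_deriv ?_
      simp only [Pi.pow_apply]
      field_simp
      ring
    refine ((h0.smul hq₀).add (h1.smul hq₁)).congr_deriv ?_
    rw [e2]
    match_scalars
    · ring
    · field_simp
    · field_simp

/-- The explicit solution satisfies the geodesic equation up to the value of the multiplier. -/
theorem profile_identity {p : ℝ} (hp : p ≠ 0) {f φ : M → ℝ} {τ A A₁ A₂ : ℝ} (hA : 0 < A) {x : M}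
    (hf : 0 < f x) (hφ : 0 < 1 + τ * φ x) :
    profileAcc p f φ τ A A₁ A₂ x -
      (p - 1) / p * (profileVel p f φ τ A A₁ x ^ 2 / profile p f φ τ A x) =
      p * (A₂ / A) * profile p f φ τ A x := by
  have h1 := (Real.rpow_pos_of_pos hA p).ne'
  have h2 := (Real.rpow_pos_of_pos hφ p).ne'
  have h3 := hφ.ne'
  have h4 := hf.ne'
  have h5 := hA.ne'
  simp only [profileAcc, profileVel, profile, Real.rpow_sub_one h3]
  generalize A ^ p = G at *
  generalize (1 + τ * φ x) ^ p = q at *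
  generalize 1 + τ * φ x = s at *
  field_simp
  ring

theorem profile_pos {p : ℝ} {f φ : M → ℝ} {τ A : ℝ} (hA : 0 < A) {x : M} (hf : 0 < f x)
    (hφ : 0 < 1 + τ * φ x) : 0 < profile p f φ τ A x :=
  mul_pos (Real.rpow_pos_of_pos hA p) (mul_pos hf (Real.rpow_pos_of_pos hφ p))

theorem continuous_mul_rpow [TopologicalSpace M] {b φ : M → ℝ} (hb : Continuous b)
    (hφ : Continuous φ) {τ : ℝ} (hτ : τ ∈ positiveTimes φ) (s : ℝ) :
    Continuous fun x => b x * (1 + τ * φ x) ^ s :=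
  hb.mul (Continuous.rpow_const (by fun_prop) fun x => Or.inl (hτ x).ne')

/-- The logarithmic direction of the geodesic with initial position `f` and velocity `a`. -/
def direction (p : ℝ) (f a : M → ℝ) : M → ℝ := fun x => a x / (p * f x)

theorem mul_direction {p : ℝ} (hp : p ≠ 0) {f : M → ℝ} (hf : ∀ x, 0 < f x) (a : M → ℝ) (x : M) :
    f x * direction p f a x = p⁻¹ * a x := by
  have := (hf x).ne'
  simp only [direction]
  field_simp

theorem continuous_direction [TopologicalSpace M] {p : ℝ} (hp : p ≠ 0) {f a : M → ℝ} (hf : Continuous f)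
    (ha : Continuous a) (hpos : ∀ x, 0 < f x) : Continuous (direction p f a) :=
  ha.div (by fun_prop) fun x => mul_ne_zero hp (hpos x).ne'

end Profile

/-! ### The explicit curve satisfies the geodesic equation. -/

section ExplicitSolution

variable {M : Type*} [MeasurableSpace M]

/-- The mass of `f (1 + τ φ)^p`, where `φ` is the logarithmic direction. -/
def geodesicMass (lam : Measure M) (p : ℝ) (f a : M → ℝ) (τ : ℝ) : ℝ :=
  ∫ x, f x * (1 + τ * direction p f a x) ^ p ∂lam

/-- The length of the maximal interval of existence. -/
def geodesicLifetime (lam : Measure M) (p : ℝ) (f a : M → ℝ) : EReal :=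
  lifetime p (geodesicMass lam p f a) (positiveTimes (direction p f a))

variable [TopologicalSpace M] [CompactSpace M] [BorelSpace M] {lam : Measure M}
  [IsProbabilityMeasure lam]

theorem integral_pos_of_continuous {g : M → ℝ} (hg : Continuous g) (hpos : ∀ x, 0 < g x) :
    0 < ∫ x, g x ∂lam := by
  rw [integral_pos_iff_support_of_nonneg (fun x => (hpos x).le) (integrable_of_continuous lam hg)]
  have : Function.support g = univ := eq_univ_of_forall fun x => (hpos x).ne'
  rw [this]
  simp

theorem geodesicMass_pos {p : ℝ} (hp : p ≠ 0) {f a : M → ℝ} (hf : Continuous f)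
    (ha : Continuous a) (hpos : ∀ x, 0 < f x) {τ : ℝ}
    (hτ : τ ∈ positiveTimes (direction p f a)) : 0 < geodesicMass lam p f a τ :=
  integral_pos_of_continuous (continuous_mul_rpow hf (continuous_direction hp hf ha hpos) hτ p)
    fun x => mul_pos (hpos x) (Real.rpow_pos_of_pos (hτ x) _)

variable (lam) in
/-- The time changes for which the explicit solution is a geodesic with initial position `f` and
initial velocity `a`. -/
structure IsTimeChange (p : ℝ) (f a : M → ℝ) (J : Set ℝ) (τ A A₁ A₂ : ℝ → ℝ) : Prop where
  isOpen : IsOpen J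
  subset : timeInterval (geodesicLifetime lam p f a) ⊆ J
  mem : ∀ t ∈ J, τ t ∈ positiveTimes (direction p f a)
  clock_eq : ∀ t ∈ J, clock p (geodesicMass lam p f a) (τ t) = t
  pos : ∀ t ∈ J, 0 < A t
  mass : ∀ t ∈ J, A t ^ p * geodesicMass lam p f a (τ t) = 1
  deriv_time : ∀ t ∈ J, HasDerivAt τ (A t ^ (-2 : ℝ)) t
  deriv_amplitude : ∀ t ∈ J, HasDerivAt A (A₁ t) t
  deriv_deriv : ∀ t ∈ J, HasDerivAt A₁ (A₂ t) t
  continuousOn : ContinuousOn A₂ J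
  time_zero : τ 0 = 0
  amplitude_zero : A 0 = 1
  deriv_zero : A₁ 0 = 0

theorem hasDerivAt_geodesicMass {p : ℝ} (hp : p ≠ 0) {f a : M → ℝ} (hf : Continuous f)
    (ha : Continuous a) (hpos : ∀ x, 0 < f x) {τ : ℝ}
    (hτ : τ ∈ positiveTimes (direction p f a)) :
    HasDerivAt (geodesicMass lam p f a)
      (p * ∫ x, f x * direction p f a x * (1 + τ * direction p f a x) ^ (p - 1) ∂lam) τ :=
  hasDerivAt_integral_rpow lam hf (continuous_direction hp hf ha hpos) p hτ

theorem exists_isTimeChange {p : ℝ} (hp : 0 < p) {f a : M → ℝ} (hf : Continuous f)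
    (ha : Continuous a) (hprob : IsProb lam f) (htan : IsTangent lam a) :
    ∃ (J : Set ℝ) (τ A A₁ A₂ : ℝ → ℝ), IsTimeChange lam p f a J τ A A₁ A₂ := by
  have hφ := continuous_direction hp.ne' hf ha hprob.1
  have hI := isOpen_positiveTimes hφ
  obtain ⟨J, τ, A, A₁, A₂, h1, h2, h3, h4, h5, h6, h7⟩ := exists_time_change
    (Z := geodesicMass lam p f a) hp hI
    (ordConnected_positiveTimes _) (zero_mem_positiveTimes _)
    (fun τ hτ => geodesicMass_pos hp.ne' hf ha hprob.1 hτ)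
    (fun τ hτ => hasDerivAt_geodesicMass hp.ne' hf ha hprob.1 hτ)
    (fun τ hτ => (hasDerivAt_integral_rpow lam (hf.mul hφ) hφ (p - 1) hτ).const_mul p)
    (by
      refine continuousOn_const.mul (continuousOn_const.mul fun τ hτ => ?_)
      exact (hasDerivAt_integral_rpow lam ((hf.mul hφ).mul hφ) hφ
        (p - 1 - 1) hτ).continuousAt.continuousWithinAt)
    (by simpa [geodesicMass] using hprob.2)
    (by
      simp only [zero_mul, add_zero, Real.one_rpow, mul_one, mul_direction hp.ne' hprob.1]
      -- Tangency of the initial velocity is exactly Z'(0) = ∫ a = 0, so A'(0) = 0.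
      rw [integral_const_mul, htan]
      simp)
  exact ⟨J, τ, A, A₁, A₂, h1, h2, fun t ht => (h3 t ht).1, fun t ht => (h3 t ht).2.1,
    fun t ht => (h3 t ht).2.2.1, fun t ht => (h3 t ht).2.2.2.1, fun t ht => (h3 t ht).2.2.2.2.1,
    fun t ht => (h3 t ht).2.2.2.2.2.1, fun t ht => (h3 t ht).2.2.2.2.2.2, h4, h5, h6, h7⟩

theorem geodesicLifetime_pos {p : ℝ} (hp : 0 < p) {f a : M → ℝ} (hf : Continuous f)
    (ha : Continuous a) (hpos : ∀ x, 0 < f x) : 0 < geodesicLifetime lam p f a := by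
  have h := clock_lt_lifetime (p := p) (Z := geodesicMass lam p f a)
    (isOpen_positiveTimes (continuous_direction hp.ne' hf ha hpos))
    (ordConnected_positiveTimes _) (zero_mem_positiveTimes _)
    (fun τ hτ => (hasDerivAt_geodesicMass hp.ne' hf ha hpos hτ).continuousAt.continuousWithinAt)
    (fun τ hτ => geodesicMass_pos hp.ne' hf ha hpos hτ) (zero_mem_positiveTimes _)
  rw [clock_zero] at h
  exact_mod_cast h

theorem IsTimeChange.isProb_profile {p : ℝ} {f a : M → ℝ} {J : Set ℝ} {τ A A₁ A₂ : ℝ → ℝ}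
    (h : IsTimeChange lam p f a J τ A A₁ A₂) (hpos : ∀ x, 0 < f x) {t : ℝ} (ht : t ∈ J) :
    IsProb lam (profile p f (direction p f a) (τ t) (A t)) := by
  refine ⟨fun x => profile_pos (h.pos t ht) (hpos x) (h.mem t ht x), ?_⟩
  simp only [profile]
  rw [integral_const_mul]
  exact h.mass t ht

/-- The integral is the second time derivative of the total mass, which is constantly 1 on the open
set J. -/
theorem IsTimeChange.integral_profileAcc {p : ℝ} (hp : p ≠ 0) {f a : M → ℝ} {J : Set ℝ}
    {τ A A₁ A₂ : ℝ → ℝ} (h : IsTimeChange lam p f a J τ A A₁ A₂) (hf : Continuous f)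
    (ha : Continuous a) (hpos : ∀ x, 0 < f x) {t : ℝ} (ht : t ∈ J) :
    ∫ x, profileAcc p f (direction p f a) (τ t) (A t) (A₁ t) (A₂ t) x ∂lam = 0 := by
  set φ := direction p f a with hφdef
  have hφ : Continuous φ := continuous_direction hp hf ha hpos
  have hint : ∀ {b : M → ℝ}, Continuous b → ∀ s : ℝ, ∀ t ∈ J,
      Integrable (fun x => b x * (1 + τ t * φ x) ^ s) lam := fun hb s t ht =>
    integrable_of_continuous lam (continuous_mul_rpow hb hφ (h.mem t ht) s)
  have hd := fun t (ht : t ∈ J) => hasDerivAt_profile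
    (Q₁ := fun τ => ∫ x, f x * φ x * (1 + τ * φ x) ^ (p - 1) ∂lam)
    (Q₂ := fun τ => ∫ x, f x * φ x * φ x * (1 + τ * φ x) ^ (p - 1 - 1) ∂lam) (h.pos t ht) (h.deriv_time t ht)
    (h.deriv_amplitude t ht) (h.deriv_deriv t ht)
    (hasDerivAt_integral_rpow lam hf hφ p (h.mem t ht))
    (hasDerivAt_integral_rpow lam (hf.mul hφ) hφ (p - 1) (h.mem t ht))
  have hvel : ∀ t ∈ J, (p * A₁ t * A t ^ p / A t) • ∫ x, f x * (1 + τ t * φ x) ^ p ∂lam +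
      (p * A t ^ p / A t ^ 2) • ∫ x, f x * φ x * (1 + τ t * φ x) ^ (p - 1) ∂lam = 0 := by
    intro t ht
    refine (hd t ht).1.unique ((hasDerivAt_const t (1 : ℝ)).congr_of_eventuallyEq ?_)
    filter_upwards [h.isOpen.mem_nhds ht] with s hs using h.mass s hs
  have hacc := (hd t ht).2.unique ((hasDerivAt_const t (0 : ℝ)).congr_of_eventuallyEq (by
    filter_upwards [h.isOpen.mem_nhds ht] with s hs using hvel s hs))
  simp only [profileAcc]
  have i0 := (hint hf p t ht).const_mul
    (A t ^ p * (p * A₂ t / A t + p * (p - 1) * A₁ t ^ 2 / A t ^ 2))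
  have i1 := (hint (hf.mul hφ) (p - 1) t ht).const_mul
    (A t ^ p * (2 * p * (p - 1) * A₁ t / A t ^ 3))
  have i2 := (hint ((hf.mul hφ).mul hφ) (p - 1 - 1) t ht).const_mul
    (A t ^ p * (p * (p - 1) / A t ^ 4))
  exact ((integral_add (i0.add i1) i2).trans (congrArg₂ (· + ·) ((integral_add i0 i1).trans
    (congrArg₂ (· + ·) (integral_const_mul _ _) (integral_const_mul _ _)))
    (integral_const_mul _ _))).trans hacc

/-- The explicit solution satisfies the geodesic equation. -/
theorem IsTimeChange.geodesicEquation {α p : ℝ} (hp : p ≠ 0) (hα : 1 / expPStar α = (p - 1) / p)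
    {f a : M → ℝ} {J : Set ℝ} {τ A A₁ A₂ : ℝ → ℝ} (h : IsTimeChange lam p f a J τ A A₁ A₂)
    (hf : Continuous f) (ha : Continuous a) (hpos : ∀ x, 0 < f x) {t : ℝ} (ht : t ∈ J) :
    GeodesicEquation lam α (profile p f (direction p f a) (τ t) (A t))
      (profileVel p f (direction p f a) (τ t) (A t) (A₁ t))
      (profileAcc p f (direction p f a) (τ t) (A t) (A₁ t) (A₂ t)) := by
  set φ := direction p f a with hφdef
  have hφ : Continuous φ := continuous_direction hp hf ha hpos
  set u := profile p f φ (τ t) (A t)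
  set v := profileVel p f φ (τ t) (A t) (A₁ t)
  set w := profileAcc p f φ (τ t) (A t) (A₁ t) (A₂ t)
  have hu : ∀ x, 0 < u x := fun x => profile_pos (h.pos t ht) (hpos x) (h.mem t ht x)
  have huc : Continuous u := (continuous_mul_rpow hf hφ (h.mem t ht) p).const_mul _
  have hvc : Continuous v := ((continuous_mul_rpow hf hφ (h.mem t ht) p).const_mul _).add
    ((continuous_mul_rpow (hf.mul hφ) hφ (h.mem t ht) (p - 1)).const_mul _)
  have hid : ∀ x, w x - (p - 1) / p * (v x ^ 2 / u x) = p * (A₂ t / A t) * u x := fun x =>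
    profile_identity hp (h.pos t ht) (hpos x) (h.mem t ht x)
  have hE : ∀ y, (v y / u y) ^ 2 * u y = v y ^ 2 / u y := fun y => by
    have := (hu y).ne'
    field_simp
  have hint1 : Integrable (fun x => v x ^ 2 / u x) lam :=
    integrable_of_continuous lam ((hvc.pow 2).div huc fun x => (hu x).ne')
  have hint2 : Integrable u lam := integrable_of_continuous lam huc
  have hw : ∀ x, w x = p * (A₂ t / A t) * u x + (p - 1) / p * (v x ^ 2 / u x) := fun x => by
    linarith [hid x]
  -- Integrating the pointwise identity over M, where the acceleration has integral zero and u has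
  -- mass one, determines the multiplier p A''/A.
  have h1 : 0 = p * (A₂ t / A t) + (p - 1) / p * ∫ x, v x ^ 2 / u x ∂lam := by
    have h2 := h.integral_profileAcc hp hf ha hpos ht
    rw [integral_congr_ae (Eventually.of_forall hw), integral_add (hint2.const_mul _)
      (hint1.const_mul _), integral_const_mul, integral_const_mul,
      (h.isProb_profile hpos ht).2, mul_one] at h2
    exact h2.symm
  intro x
  rw [hα, hid x]
  simp only [hE]
  rw [neg_mul, eq_neg_of_add_eq_zero_left h1.symm]

end ExplicitSolution

end FisherRao

end

noncomputable section

namespace FisherRao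

open scoped ENNReal NNReal

/-! ### The explicit position as a function of time. -/

section ExplicitPosition

variable {M : Type*}

theorem IsC2Curve.mono {X : Type*} [AddCommGroup X] [Module ℝ X] [TopologicalSpace X]
    {I J : Set ℝ} {u v w : ℝ → X} (h : IsC2Curve J u v w) (hIJ : I ⊆ J) : IsC2Curve I u v w :=
  ⟨fun t ht => (h.velocity t (hIJ ht)).mono_left (nhdsWithin_mono t (sdiff_subset_sdiff_left hIJ)),
    fun t ht => (h.acceleration t (hIJ ht)).mono_left
      (nhdsWithin_mono t (sdiff_subset_sdiff_left hIJ)), h.continuousOn.mono hIJ⟩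

theorem zero_mem_timeInterval {T : EReal} (hT : 0 < T) : (0 : ℝ) ∈ timeInterval T :=
  ⟨le_rfl, by exact_mod_cast hT⟩

theorem profile_zero (p : ℝ) (f φ : M → ℝ) : profile p f φ 0 1 = f := by
  funext x
  simp [profile]

theorem profileVel_zero {p : ℝ} (hp : p ≠ 0) {f : M → ℝ} (hf : ∀ x, 0 < f x) (a : M → ℝ) :
    profileVel p f (direction p f a) 0 1 0 = a := by
  funext x
  simp [profileVel, mul_direction hp hf, hp]

variable [MeasurableSpace M]

/-- `F` is the position at time `t` of the explicit solution. -/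
def IsExplicitPosition (lam : Measure M) (p : ℝ) (f a : M → ℝ) (t : ℝ) (F : M → ℝ) : Prop :=
  ∃ τ ∈ positiveTimes (direction p f a), ∃ A : ℝ, clock p (geodesicMass lam p f a) τ = t ∧
    A ^ p * geodesicMass lam p f a τ = 1 ∧ F = profile p f (direction p f a) τ A

variable [TopologicalSpace M] [CompactSpace M] [BorelSpace M] {lam : Measure M}
  [IsProbabilityMeasure lam]

theorem strictMonoOn_clock_geodesicMass {p : ℝ} (hp : p ≠ 0) {f a : M → ℝ} (hf : Continuous f)
    (ha : Continuous a) (hpos : ∀ x, 0 < f x) :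
    StrictMonoOn (clock p (geodesicMass lam p f a)) (positiveTimes (direction p f a)) :=
  strictMonoOn_clock (isOpen_positiveTimes (continuous_direction hp hf ha hpos))
    (ordConnected_positiveTimes _) (zero_mem_positiveTimes _)
    (fun _ hτ => (hasDerivAt_geodesicMass hp hf ha hpos hτ).continuousAt.continuousWithinAt)
    fun _ hτ => geodesicMass_pos hp hf ha hpos hτ

/-- The clock is injective, so t determines τ; the mass condition then determines A^p, which is all
the profile uses of A. -/
theorem IsExplicitPosition.eq {p : ℝ} (hp : p ≠ 0) {f a : M → ℝ} (hf : Continuous f)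
    (ha : Continuous a) (hpos : ∀ x, 0 < f x) {t : ℝ} {F G : M → ℝ}
    (hF : IsExplicitPosition lam p f a t F) (hG : IsExplicitPosition lam p f a t G) : F = G := by
  obtain ⟨τ, hτ, A, hc, hA, rfl⟩ := hF
  obtain ⟨τ', hτ', A', hc', hA', rfl⟩ := hG
  obtain rfl := (strictMonoOn_clock_geodesicMass (lam := lam) hp hf ha hpos).injOn hτ hτ'
    (hc.trans hc'.symm)
  have h := mul_right_cancel₀ (geodesicMass_pos (lam := lam) hp hf ha hpos hτ).ne'
    (hA.trans hA'.symm)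
  funext x
  simp only [profile, h]

end ExplicitPosition

section SmoothFormulas

variable {n : ℕ} {M : Type*} [TopologicalSpace M] [ChartedSpace (EuclideanSpace ℝ (Fin n)) M]

theorem contMDiff_mul_rpow {b φ : M → ℝ} (hb : ContMDiff (𝓡 n) 𝓘(ℝ, ℝ) ∞ b)
    (hφ : ContMDiff (𝓡 n) 𝓘(ℝ, ℝ) ∞ φ) (s : ℝ) {τ : ℝ} (hτ : τ ∈ positiveTimes φ) :
    ContMDiff (𝓡 n) 𝓘(ℝ, ℝ) ∞ fun x => b x * (1 + τ * φ x) ^ s := by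
  refine hb.mul fun x => ?_
  have h1 : ContDiffAt ℝ ∞ (fun y : ℝ => (1 + τ * y) ^ s) (φ x) :=
    ContDiffAt.rpow_const_of_ne (by fun_prop) (hτ x).ne'
  exact h1.contMDiffAt.comp x (hφ x)

theorem contMDiff_direction {p : ℝ} (hp : p ≠ 0) {f a : M → ℝ}
    (hf : ContMDiff (𝓡 n) 𝓘(ℝ, ℝ) ∞ f) (ha : ContMDiff (𝓡 n) 𝓘(ℝ, ℝ) ∞ a)
    (hpos : ∀ x, 0 < f x) : ContMDiff (𝓡 n) 𝓘(ℝ, ℝ) ∞ (direction p f a) := fun x => by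
  have h1 : ContDiffAt ℝ ∞ (fun y : ℝ × ℝ => y.1 / (p * y.2)) (a x, f x) :=
    ContDiffAt.div (by fun_prop) (by fun_prop) (mul_ne_zero hp (hpos x).ne')
  exact h1.contMDiffAt.comp x ((ha x).prodMk_space (hf x))

end SmoothFormulas

/-! ### Existence in H^k(M) and in the smooth functions. -/

section Existence

variable {n : ℕ} {M : Type*} [TopologicalSpace M] [CompactSpace M]
  [ChartedSpace (EuclideanSpace ℝ (Fin n)) M]

/-- For small ε the function b (1 + εφ) lies on the curve of first powers, and b φ is its difference
quotient. -/
theorem sobolev_mul_mem {k : ℝ} (hk : (n : ℝ) / 2 < k) {b φ : M → ℝ}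
    (hb : b ∈ sobolevSubmodule n M k) (hφ : φ ∈ sobolevSubmodule n M k) :
    (fun x => b x * φ x) ∈ sobolevSubmodule n M k := by
  obtain ⟨ε, hε, hball⟩ := Metric.isOpen_iff.1 (isOpen_positiveTimes hφ.1) 0
    (zero_mem_positiveTimes φ)
  have hτ : ε / 2 ∈ positiveTimes φ := hball (by
    rw [Metric.mem_ball, Real.dist_eq, sub_zero, abs_of_pos (by positivity)]; linarith)
  have h := (sobolev_rpow_curve hk hb hφ (isOpen_positiveTimes hφ.1)
    (ordConnected_positiveTimes _) (zero_mem_positiveTimes _) (fun _ hτ => hτ) 1 hτ).1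
  convert Submodule.smul_mem _ (ε / 2)⁻¹ (Submodule.sub_mem _ h hb) using 1
  funext x
  simp only [Pi.smul_apply, Pi.sub_apply, Real.rpow_one, smul_eq_mul]
  field_simp
  ring

theorem direction_mem_sobolevSubmodule {k : ℝ} (hk : (n : ℝ) / 2 < k) (p : ℝ) {f a : M → ℝ}
    (hf : f ∈ sobolevSubmodule n M k) (ha : a ∈ sobolevSubmodule n M k) (hpos : ∀ x, 0 < f x) :
    direction p f a ∈ sobolevSubmodule n M k := by
  convert Submodule.smul_mem _ p⁻¹ (sobolev_div_mem hk ha hf hpos) using 1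
  funext x
  simp only [direction, Pi.smul_apply, smul_eq_mul, div_eq_mul_inv, mul_inv]
  ring

/-- `b (1 + τ φ)^s` as an element of `H^k(M)`. -/
def sobolevRpow {k : ℝ} (hk : (n : ℝ) / 2 < k) {b φ : M → ℝ} (hb : b ∈ sobolevSubmodule n M k)
    (hφ : φ ∈ sobolevSubmodule n M k) (s : ℝ) {τ : ℝ} (hτ : τ ∈ positiveTimes φ) :
    SobolevSpace n M k :=
  ⟨_, (sobolev_rpow_curve hk hb hφ (isOpen_positiveTimes hφ.1)
    (ordConnected_positiveTimes _) (zero_mem_positiveTimes _) (fun _ hτ => hτ) s hτ).1⟩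

theorem hasDerivAt_sobolevRpow {k : ℝ} (hk : (n : ℝ) / 2 < k) {b φ : M → ℝ}
    (hb : b ∈ sobolevSubmodule n M k) (hφ : φ ∈ sobolevSubmodule n M k) (s : ℝ) {τ : ℝ}
    (hτ : τ ∈ positiveTimes φ) (c : LocalizedChart n M) :
    HasDerivAt (fun τ => sobolevVec k (c.localize fun x => b x * (1 + τ * φ x) ^ s))
        (s • sobolevVec k (c.localize fun x => b x * φ x * (1 + τ * φ x) ^ (s - 1))) τ :=
  (sobolev_rpow_curve hk hb hφ (isOpen_positiveTimes hφ.1)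
    (ordConnected_positiveTimes _) (zero_mem_positiveTimes _) (fun _ hτ => hτ) s hτ).2 c

variable [MeasurableSpace M] [BorelSpace M] {lam : Measure M} [IsProbabilityMeasure lam]

/-- Each localization of u, v, w is a combination of powers of 1 + τφ with scalar coefficients in t,
so the derivatives come from `hasDerivAt_profile` in L². -/
theorem IsTimeChange.isC2Curve {k : ℝ} (hk : (n : ℝ) / 2 < k) {p : ℝ} {f a : M → ℝ}
    (hf : f ∈ sobolevSubmodule n M k) (ha : a ∈ sobolevSubmodule n M k) (hpos : ∀ x, 0 < f x)
    {J : Set ℝ} {τ A A₁ A₂ : ℝ → ℝ} (h : IsTimeChange lam p f a J τ A A₁ A₂)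
    {u v w : ℝ → SobolevSpace n M k}
    (hu : ∀ t ∈ J, ⇑(u t) = profile p f (direction p f a) (τ t) (A t))
    (hv : ∀ t ∈ J, ⇑(v t) = profileVel p f (direction p f a) (τ t) (A t) (A₁ t))
    (hw : ∀ t ∈ J, ⇑(w t) = profileAcc p f (direction p f a) (τ t) (A t) (A₁ t) (A₂ t)) :
    IsC2Curve J u v w := by
  set φ := direction p f a
  have hφ : φ ∈ sobolevSubmodule n M k := direction_mem_sobolevSubmodule hk p hf ha hpos
  have hf₁ := sobolev_mul_mem hk hf hφ
  have hf₂ := sobolev_mul_mem hk hf₁ hφ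
  let Q (c : LocalizedChart n M) (b : M → ℝ) (s τ : ℝ) :=
    sobolevVec k (c.localize fun x => b x * (1 + τ * φ x) ^ s)
  have hU : ∀ c, ∀ t ∈ J, sobolevLocal k c (u t) = A t ^ p • Q c f p (τ t) := by
    intro c t ht
    have : u t = A t ^ p • sobolevRpow hk hf hφ p (h.mem t ht) := DFunLike.coe_injective (hu t ht)
    rw [this, map_smul]
    rfl
  have hV : ∀ c, ∀ t ∈ J, sobolevLocal k c (v t) =
      (p * A₁ t * A t ^ p / A t) • Q c f p (τ t) +
        (p * A t ^ p / A t ^ 2) • Q c (fun x => f x * φ x) (p - 1) (τ t) := by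
    intro c t ht
    have : v t = (p * A₁ t * A t ^ p / A t) • sobolevRpow hk hf hφ p (h.mem t ht) +
        (p * A t ^ p / A t ^ 2) • sobolevRpow hk hf₁ hφ (p - 1) (h.mem t ht) :=
      DFunLike.coe_injective (hv t ht)
    rw [this, map_add, map_smul, map_smul]
    rfl
  have hW : ∀ c, ∀ t ∈ J, sobolevLocal k c (w t) =
      (A t ^ p * (p * A₂ t / A t + p * (p - 1) * A₁ t ^ 2 / A t ^ 2)) • Q c f p (τ t) +
        (A t ^ p * (2 * p * (p - 1) * A₁ t / A t ^ 3)) •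
          Q c (fun x => f x * φ x) (p - 1) (τ t) +
        (A t ^ p * (p * (p - 1) / A t ^ 4)) •
          Q c (fun x => f x * φ x * φ x) (p - 1 - 1) (τ t) := by
    intro c t ht
    have : w t =
        (A t ^ p * (p * A₂ t / A t + p * (p - 1) * A₁ t ^ 2 / A t ^ 2)) •
          sobolevRpow hk hf hφ p (h.mem t ht) +
        (A t ^ p * (2 * p * (p - 1) * A₁ t / A t ^ 3)) •
          sobolevRpow hk hf₁ hφ (p - 1) (h.mem t ht) +
        (A t ^ p * (p * (p - 1) / A t ^ 4)) •
          sobolevRpow hk hf₂ hφ (p - 1 - 1) (h.mem t ht) :=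
      DFunLike.coe_injective (hw t ht)
    rw [this, map_add, map_add, map_smul, map_smul, map_smul]
    rfl
  have hd := fun c t (ht : t ∈ J) => hasDerivAt_profile (Q₀ := Q c f p)
    (Q₁ := Q c (fun x => f x * φ x) (p - 1)) (Q₂ := Q c (fun x => f x * φ x * φ x) (p - 1 - 1))
    (h.pos t ht) (h.deriv_time t ht) (h.deriv_amplitude t ht) (h.deriv_deriv t ht)
    (hasDerivAt_sobolevRpow hk hf hφ p (h.mem t ht) c)
    (hasDerivAt_sobolevRpow hk hf₁ hφ (p - 1) (h.mem t ht) c)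
  refine ⟨fun t ht => SobolevSpace.tendsto_slope_iff.2 fun c => ?_,
    fun t ht => SobolevSpace.tendsto_slope_iff.2 fun c => ?_,
    SobolevSpace.continuousOn_iff.2 fun c => ?_⟩
  · rw [hV c t ht]
    exact (hd c t ht).1.hasDerivWithinAt.congr (hU c) (hU c t ht)
  · rw [hW c t ht]
    exact (hd c t ht).2.hasDerivWithinAt.congr (hV c) (hV c t ht)
  · refine ContinuousOn.congr ?_ (hW c)
    intro t ht
    have hA := (h.pos t ht).ne'
    have cA : ContinuousWithinAt A J t := (h.deriv_amplitude t ht).continuousAt.continuousWithinAt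
    have cA₁ : ContinuousWithinAt A₁ J t := (h.deriv_deriv t ht).continuousAt.continuousWithinAt
    have cA₂ : ContinuousWithinAt A₂ J t := h.continuousOn t ht
    have cp : ContinuousWithinAt (fun t => A t ^ p) J t := cA.rpow_const (Or.inl hA)
    have cτ : ContinuousAt τ t := (h.deriv_time t ht).continuousAt
    have cQ : ∀ {b : M → ℝ} (s : ℝ), b ∈ sobolevSubmodule n M k →
        ContinuousWithinAt (fun t => Q c b s (τ t)) J t := fun {b} s hb =>
      (ContinuousAt.comp (g := Q c b s)
        (hasDerivAt_sobolevRpow hk hb hφ s (h.mem t ht) c).continuousAt cτ).continuousWithinAt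
    have c0 : ContinuousWithinAt
        (fun t => A t ^ p * (p * A₂ t / A t + p * (p - 1) * A₁ t ^ 2 / A t ^ 2)) J t :=
      cp.mul (((continuousWithinAt_const.mul cA₂).div cA hA).add
        ((continuousWithinAt_const.mul (cA₁.pow 2)).div (cA.pow 2) (pow_ne_zero 2 hA)))
    have c1 : ContinuousWithinAt (fun t => A t ^ p * (2 * p * (p - 1) * A₁ t / A t ^ 3)) J t :=
      cp.mul ((continuousWithinAt_const.mul cA₁).div (cA.pow 3) (pow_ne_zero 3 hA))
    have c2 : ContinuousWithinAt (fun t => A t ^ p * (p * (p - 1) / A t ^ 4)) J t :=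
      cp.mul (continuousWithinAt_const.div (cA.pow 4) (pow_ne_zero 4 hA))
    exact ((c0.smul (cQ p hf)).add (c1.smul (cQ (p - 1) hf₁))).add
      (c2.smul (cQ (p - 1 - 1) hf₂))

/-- Curves of functions that are given by the explicit formulas solve the initial value problem. -/
theorem IsTimeChange.isGeodesicSolution {X : Type*} [AddCommGroup X] [Module ℝ X]
    [TopologicalSpace X] [FunLike X M ℝ] {α p : ℝ} (hp : p ≠ 0)
    (hα : 1 / expPStar α = (p - 1) / p) {f a : X} (hf : Continuous f) (ha : Continuous a)
    (hpos : ∀ x, 0 < f x) {J : Set ℝ} {τ A A₁ A₂ : ℝ → ℝ}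
    (h : IsTimeChange lam p f a J τ A A₁ A₂) (hT : 0 < geodesicLifetime lam p f a)
    {u v w : ℝ → X} (hc : IsC2Curve J u v w)
    (hu : ∀ t ∈ J, ⇑(u t) = profile p f (direction p f a) (τ t) (A t))
    (hv : ∀ t ∈ J, ⇑(v t) = profileVel p f (direction p f a) (τ t) (A t) (A₁ t))
    (hw : ∀ t ∈ J, ⇑(w t) = profileAcc p f (direction p f a) (τ t) (A t) (A₁ t) (A₂ t)) :
    IsGeodesicSolution lam α f a (geodesicLifetime lam p f a) u ∧
      ∀ t ∈ timeInterval (geodesicLifetime lam p f a), IsExplicitPosition lam p f a t (u t) := by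
  have h0 := h.subset (zero_mem_timeInterval hT)
  refine ⟨⟨hT, v, w, hc.mono h.subset, ?_, ?_, fun t ht => ?_⟩, fun t ht => ?_⟩
  · apply DFunLike.coe_injective
    rw [hu 0 h0, h.time_zero, h.amplitude_zero, profile_zero]
  · apply DFunLike.coe_injective
    rw [hv 0 h0, h.time_zero, h.amplitude_zero, h.deriv_zero, profileVel_zero hp hpos]
  · have ht' := h.subset ht
    rw [hu t ht', hv t ht', hw t ht']
    exact ⟨h.isProb_profile hpos ht', h.geodesicEquation hp hα hf ha hpos ht'⟩
  · have ht' := h.subset ht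
    exact ⟨τ t, h.mem t ht', A t, h.clock_eq t ht', h.mass t ht', hu t ht'⟩

theorem exists_sobolev_solution {k : ℝ} (hk : (n : ℝ) / 2 < k) {α p : ℝ} (hp : 0 < p)
    (hα : 1 / expPStar α = (p - 1) / p) {f a : SobolevSpace n M k} (hprob : IsProb lam f)
    (htan : IsTangent lam a) : ∃ u : ℝ → SobolevSpace n M k,
      IsGeodesicSolution lam α f a (geodesicLifetime lam p f a) u ∧
      ∀ t ∈ timeInterval (geodesicLifetime lam p f a), IsExplicitPosition lam p f a t (u t) := by
  obtain ⟨J, τ, A, A₁, A₂, h⟩ := exists_isTimeChange hp f.continuous a.continuous hprob htan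
  have hφ := direction_mem_sobolevSubmodule hk p f.2 a.2 hprob.1
  have hf₁ := sobolev_mul_mem hk f.2 hφ
  have hf₂ := sobolev_mul_mem hk hf₁ hφ
  -- The curves must be total functions of t; their values outside J are irrelevant and set to zero.
  have hmem : ∀ t, ∃ u v w : SobolevSpace n M k, t ∈ J →
      ⇑u = profile p f (direction p f a) (τ t) (A t) ∧
      ⇑v = profileVel p f (direction p f a) (τ t) (A t) (A₁ t) ∧
      ⇑w = profileAcc p f (direction p f a) (τ t) (A t) (A₁ t) (A₂ t) := by
    intro t
    by_cases ht : t ∈ J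
    · exact ⟨A t ^ p • sobolevRpow hk f.2 hφ p (h.mem t ht),
        (p * A₁ t * A t ^ p / A t) • sobolevRpow hk f.2 hφ p (h.mem t ht) +
          (p * A t ^ p / A t ^ 2) • sobolevRpow hk hf₁ hφ (p - 1) (h.mem t ht),
        (A t ^ p * (p * A₂ t / A t + p * (p - 1) * A₁ t ^ 2 / A t ^ 2)) •
            sobolevRpow hk f.2 hφ p (h.mem t ht) +
          (A t ^ p * (2 * p * (p - 1) * A₁ t / A t ^ 3)) •
            sobolevRpow hk hf₁ hφ (p - 1) (h.mem t ht) +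
          (A t ^ p * (p * (p - 1) / A t ^ 4)) •
            sobolevRpow hk hf₂ hφ (p - 1 - 1) (h.mem t ht), fun _ => ⟨rfl, rfl, rfl⟩⟩
    · exact ⟨0, 0, 0, fun h => absurd h ht⟩
  choose u v w huvw using hmem
  exact ⟨u, h.isGeodesicSolution hp.ne' hα f.continuous a.continuous hprob.1
    (geodesicLifetime_pos hp f.continuous a.continuous hprob.1)
    (h.isC2Curve hk f.2 a.2 hprob.1 (fun t ht => (huvw t ht).1) (fun t ht => (huvw t ht).2.1)
      fun t ht => (huvw t ht).2.2) (fun t ht => (huvw t ht).1) (fun t ht => (huvw t ht).2.1)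
      fun t ht => (huvw t ht).2.2⟩

/-- The formula gives smooth functions, and the curve is C² in every H^k; convergence in all H^k is
convergence in the smooth topology. -/
theorem exists_smooth_solution {α p : ℝ} (hp : 0 < p)
    (hα : 1 / expPStar α = (p - 1) / p) {f a : C^∞⟮𝓡 n, M; 𝓘(ℝ, ℝ), ℝ⟯} (hprob : IsProb lam f)
    (htan : IsTangent lam a) : ∃ u : ℝ → C^∞⟮𝓡 n, M; 𝓘(ℝ, ℝ), ℝ⟯,
      IsGeodesicSolution lam α f a (geodesicLifetime lam p f a) u ∧
      ∀ t ∈ timeInterval (geodesicLifetime lam p f a), IsExplicitPosition lam p f a t (u t) := by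
  have hfc : Continuous f := f.contMDiff.continuous
  have hac : Continuous a := a.contMDiff.continuous
  obtain ⟨J, τ, A, A₁, A₂, h⟩ := exists_isTimeChange hp hfc hac hprob htan
  have hφ := contMDiff_direction hp.ne' f.contMDiff a.contMDiff hprob.1
  have hf₁ := f.contMDiff.mul hφ
  have hf₂ := hf₁.mul hφ
  have hmem : ∀ t, ∃ u v w : C^∞⟮𝓡 n, M; 𝓘(ℝ, ℝ), ℝ⟯, t ∈ J →
      ⇑u = profile p f (direction p f a) (τ t) (A t) ∧
      ⇑v = profileVel p f (direction p f a) (τ t) (A t) (A₁ t) ∧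
      ⇑w = profileAcc p f (direction p f a) (τ t) (A t) (A₁ t) (A₂ t) := by
    intro t
    by_cases ht : t ∈ J
    · have q₀ := contMDiff_mul_rpow f.contMDiff hφ p (h.mem t ht)
      have q₁ := contMDiff_mul_rpow hf₁ hφ (p - 1) (h.mem t ht)
      have q₂ := contMDiff_mul_rpow hf₂ hφ (p - 1 - 1) (h.mem t ht)
      exact ⟨⟨_, contMDiff_const.mul q₀⟩,
        ⟨_, (contMDiff_const.mul q₀).add (contMDiff_const.mul q₁)⟩,
        ⟨_, ((contMDiff_const.mul q₀).add (contMDiff_const.mul q₁)).add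
          (contMDiff_const.mul q₂)⟩, fun _ => ⟨rfl, rfl, rfl⟩⟩
    · exact ⟨0, 0, 0, fun h => absurd h ht⟩
  choose u v w huvw using hmem
  have hC := fun (k : ℝ) (hk : (n : ℝ) / 2 < k) => h.isC2Curve hk (toSobolev k f).2
    (toSobolev k a).2 hprob.1 (u := fun t => toSobolev k (u t)) (v := fun t => toSobolev k (v t))
    (w := fun t => toSobolev k (w t)) (fun t ht => (huvw t ht).1) (fun t ht => (huvw t ht).2.1)
    fun t ht => (huvw t ht).2.2
  refine ⟨u, h.isGeodesicSolution hp.ne' hα hfc hac hprob.1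
    (geodesicLifetime_pos hp hfc hac hprob.1) ⟨fun t ht => ?_, fun t ht => ?_, fun t ht => ?_⟩
    (fun t ht => (huvw t ht).1) (fun t ht => (huvw t ht).2.1) fun t ht => (huvw t ht).2.2⟩
  · refine smooth_tendsto_of_sobolev fun k hk => ?_
    simpa only [map_slope] using (hC k hk).velocity t ht
  · refine smooth_tendsto_of_sobolev fun k hk => ?_
    simpa only [map_slope] using (hC k hk).acceleration t ht
  · exact smooth_tendsto_of_sobolev fun k hk => (hC k hk).continuousOn t ht

end Existence

end FisherRao

end

noncomputable section

namespace FisherRao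

open scoped ENNReal NNReal

/-! ### The substitution G = (u/F)^(1/p) and the Wronskian. -/

section Calculus

theorem convex_timeInterval (T : EReal) : Convex ℝ (timeInterval T) := by
  refine OrdConnected.convex ⟨fun a ha b hb t ht => ⟨ha.1.trans ht.1, ?_⟩⟩
  exact lt_of_le_of_lt (by exact_mod_cast ht.2) hb.2

theorem eq_of_hasDerivWithinAt_zero {I : Set ℝ} (hI : Convex ℝ I) {g : ℝ → ℝ}
    (hg : ∀ t ∈ I, HasDerivWithinAt g 0 I t) {s t : ℝ} (hs : s ∈ I) (ht : t ∈ I) : g t = g s := by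
  have h := hI.norm_image_sub_le_of_norm_hasDerivWithin_le hg (C := 0) (by simp) hs ht
  rw [zero_mul] at h
  exact sub_eq_zero.1 (norm_le_zero_iff.1 h)

theorem hasDerivWithinAt_rpow_div {p F : ℝ} (hF : 0 < F) {I : Set ℝ} {u v : ℝ → ℝ} {t : ℝ}
    (hu : HasDerivWithinAt u (v t) I t) (hpos : 0 < u t) :
    HasDerivWithinAt (fun s => (u s / F) ^ (1 / p)) (1 / p * (v t / u t) * (u t / F) ^ (1 / p))
      I t := by
  have h := (hu.div_const F).rpow_const (p := 1 / p) (Or.inl (div_pos hpos hF).ne')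
  refine h.congr_deriv ?_
  rw [Real.rpow_sub_one (div_pos hpos hF).ne']
  have := hpos.ne'
  have := hF.ne'
  field_simp

/-- The exponent 1/p is the one for which the terms quadratic in the velocity combine to the left
side of the geodesic equation. On a solution the second derivative is therefore a multiple of the
function itself, with a factor independent of the point. -/
theorem hasDerivWithinAt_rpow_div_deriv {p F : ℝ} (hF : 0 < F) {I : Set ℝ} {u v : ℝ → ℝ} {w t : ℝ}
    (hu : HasDerivWithinAt u (v t) I t) (hv : HasDerivWithinAt v w I t) (hpos : 0 < u t) :
    HasDerivWithinAt (fun s => 1 / p * (v s / u s) * (u s / F) ^ (1 / p))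
      (1 / p * ((w - (p - 1) / p * (v t ^ 2 / u t)) / u t) * (u t / F) ^ (1 / p)) I t := by
  refine (((hv.div hu hpos.ne').const_mul (1 / p)).mul
    (hasDerivWithinAt_rpow_div hF hu hpos)).congr_deriv ?_
  have := hpos.ne'
  by_cases hp : p = 0
  · simp [hp]
  simp only [Pi.div_apply]
  field_simp
  ring

/-- Two solutions of the same linear equation of second order have constant Wronskian, so that their
quotients have the derivative one gets from an antiderivative of `1 / G²`. -/
theorem hasDerivWithinAt_div_of_wronskian {I : Set ℝ} (hI : Convex ℝ I) (h0 : (0 : ℝ) ∈ I)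
    {G G₁ H H₁ c : ℝ → ℝ} (hG : ∀ t ∈ I, HasDerivWithinAt G (G₁ t) I t)
    (hG₁ : ∀ t ∈ I, HasDerivWithinAt G₁ (c t * G t) I t)
    (hH : ∀ t ∈ I, HasDerivWithinAt H (H₁ t) I t)
    (hH₁ : ∀ t ∈ I, HasDerivWithinAt H₁ (c t * H t) I t) (hpos : ∀ t ∈ I, 0 < G t) {t : ℝ}
    (ht : t ∈ I) :
    HasDerivWithinAt (fun t => H t / G t) ((G 0 * H₁ 0 - H 0 * G₁ 0) * (1 / G t ^ 2)) I t := by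
  have hw : G t * H₁ t - H t * G₁ t = G 0 * H₁ 0 - H 0 * G₁ 0 :=
    eq_of_hasDerivWithinAt_zero hI (g := fun t => G t * H₁ t - H t * G₁ t) (fun s hs =>
      (((hG s hs).mul (hH₁ s hs)).sub ((hH s hs).mul (hG₁ s hs))).congr_deriv (by ring)) h0 ht
  refine ((hH t ht).div (hG t ht) (hpos t ht).ne').congr_deriv ?_
  rw [← hw]
  ring

end Calculus

/-! ### Every solution is given by the explicit formula. -/

section Uniqueness

variable {M : Type*} [MeasurableSpace M] [TopologicalSpace M] [CompactSpace M] [BorelSpace M]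
  {lam : Measure M} [IsProbabilityMeasure lam]

/-- A function with integral zero is not positive everywhere. Such a point serves as the reference
point in the uniqueness proof, where it keeps a denominator positive. -/
theorem exists_direction_nonpos {p : ℝ} (hp : 0 < p) {f a : M → ℝ} (ha : Continuous a)
    (hpos : ∀ x, 0 < f x) (htan : IsTangent lam a) : ∃ x, direction p f a x ≤ 0 := by
  by_contra! h
  have h1 : ∀ x, 0 < a x := fun x => by
    have := mul_pos (mul_pos hp (hpos x)) (h x)
    rw [mul_assoc, mul_direction hp.ne' hpos, mul_inv_cancel_left₀ hp.ne'] at this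
    exact this
  exact (integral_pos_of_continuous (lam := lam) ha h1).ne' htan

/-- Every solution of the geodesic equation, with derivatives taken pointwise on `M`, is given by the
explicit formula. -/
theorem isExplicitPosition_of_geodesicEquation {α p : ℝ} (hp : 0 < p)
    (hα : 1 / expPStar α = (p - 1) / p) {f a : M → ℝ} (hf : Continuous f) (ha : Continuous a)
    (hprob : IsProb lam f) (htan : IsTangent lam a) {I : Set ℝ} (hI : Convex ℝ I)
    (h0 : (0 : ℝ) ∈ I) (hnonneg : ∀ t ∈ I, 0 ≤ t) {u v w : ℝ → M → ℝ}
    (hu : ∀ x, ∀ t ∈ I, HasDerivWithinAt (fun s => u s x) (v t x) I t)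
    (hv : ∀ x, ∀ t ∈ I, HasDerivWithinAt (fun s => v s x) (w t x) I t)
    (hsol : ∀ t ∈ I, IsProb lam (u t) ∧ GeodesicEquation lam α (u t) (v t) (w t))
    (hu0 : u 0 = f) (hv0 : v 0 = a) {t : ℝ} (ht : t ∈ I) :
    IsExplicitPosition lam p f a t (u t) := by
  have hpos := hprob.1
  set φ := direction p f a with hφ
  set Z := geodesicMass lam p f a
  obtain ⟨y, hy⟩ := exists_direction_nonpos hp ha hpos htan
  rw [← hφ] at hy
  let G (x : M) (t : ℝ) : ℝ := (u t x / f x) ^ (1 / p)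
  let G₁ (x : M) (t : ℝ) : ℝ := 1 / p * (v t x / u t x) * (u t x / f x) ^ (1 / p)
  have hGpos : ∀ x, ∀ t ∈ I, 0 < G x t := fun x t ht =>
    Real.rpow_pos_of_pos (div_pos ((hsol t ht).1.1 x) (hpos x)) _
  have hGd : ∀ x, ∀ t ∈ I, HasDerivWithinAt (G x) (G₁ x t) I t := fun x t ht =>
    hasDerivWithinAt_rpow_div (v := fun t => v t x) (hpos x) (hu x t ht) ((hsol t ht).1.1 x)
  have hG₁d : ∀ x, ∀ t ∈ I, HasDerivWithinAt (G₁ x)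
      (1 / p * (-((p - 1) / p) * ∫ y, (v t y / u t y) ^ 2 * u t y ∂lam) * G x t) I t := by
    intro x t ht
    refine (hasDerivWithinAt_rpow_div_deriv (v := fun t => v t x) (hpos x) (hu x t ht)
      (hv x t ht) ((hsol t ht).1.1 x)).congr_deriv ?_
    have h := (hsol t ht).2 x
    rw [hα] at h
    rw [h, mul_div_cancel_right₀ _ ((hsol t ht).1.1 x).ne']
  have hG0 : ∀ x, G x 0 = 1 := fun x => by
    simp only [G, hu0, div_self (hpos x).ne', Real.one_rpow]
  have hG₁0 : ∀ x, G₁ x 0 = φ x := fun x => by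
    simp only [G₁, hu0, hv0, div_self (hpos x).ne', Real.one_rpow, hφ, direction]
    have := (hpos x).ne'
    field_simp
  have hpow : ∀ x, ∀ t ∈ I, u t x = f x * G x t ^ p := fun x t ht => by
    rw [← Real.rpow_mul (div_pos ((hsol t ht).1.1 x) (hpos x)).le, one_div_mul_cancel hp.ne',
      Real.rpow_one, mul_div_cancel₀ _ (hpos x).ne']
  -- All G x are compared with the solution at the reference point y, so no linear equation with the
  -- unknown coefficient has to be solved.
  have hquot : ∀ x, ∀ t ∈ I, HasDerivWithinAt (fun t => G x t / G y t)
      ((φ x - φ y) * (1 / G y t ^ 2)) I t := fun x t ht => by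
    refine (hasDerivWithinAt_div_of_wronskian hI h0 (hGd y) (hG₁d y) (hGd x) (hG₁d x)
      (hGpos y) ht).congr_deriv ?_
    rw [hG0, hG0, hG₁0, hG₁0]
    ring
  -- An antiderivative of 1/(G y)². If φ is not constant, a quotient of two of the G's provides it.
  -- If φ is constant, all the G's agree, unit mass forces G = 1, and σ(t) = t.
  obtain ⟨σ, hσ0, hσ⟩ : ∃ σ : ℝ → ℝ, σ 0 = 0 ∧
      ∀ t ∈ I, HasDerivWithinAt σ (1 / G y t ^ 2) I t := by
    by_cases hc : ∃ x, φ x ≠ φ y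
    · obtain ⟨x, hx⟩ := hc
      have hne := sub_ne_zero.2 hx
      refine ⟨fun t => (φ x - φ y)⁻¹ * (G x t / G y t - 1), by simp [hG0], fun t ht => ?_⟩
      refine (((hquot x t ht).sub_const 1).const_mul _).congr_deriv ?_
      rw [inv_mul_cancel_left₀ hne]
    · push Not at hc
      refine ⟨fun t => t, rfl, fun t ht => (hasDerivWithinAt_id t I).congr_deriv ?_⟩
      have h1 : ∀ x, G x t = G y t := fun x => by
        have h2 := eq_of_hasDerivWithinAt_zero hI (g := fun t => G x t / G y t)
          (fun t ht => (hquot x t ht).congr_deriv (by simp [hc x])) h0 ht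
        simp only [hG0, div_one] at h2
        exact (div_eq_one_iff_eq (hGpos y t ht).ne').1 h2
      have h3 : G y t ^ p = 1 := by
        have h4 := (hsol t ht).1.2
        simp only [fun x => hpow x t ht, h1] at h4
        rwa [integral_mul_const, hprob.2, one_mul] at h4
      have h5 : G y t = 1 := by
        rw [← Real.rpow_rpow_inv (hGpos y t ht).le hp.ne', h3, Real.one_rpow]
      simp [h5]
  have hσnonneg : ∀ t ∈ I, 0 ≤ σ t := fun t ht => by
    have hmono : MonotoneOn σ I := monotoneOn_of_hasDerivWithinAt_nonneg hI
      (fun s hs => (hσ s hs).continuousWithinAt)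
      (fun s hs => (hσ s (interior_subset hs)).mono interior_subset) fun s hs => by positivity
    have := hmono h0 ht (hnonneg t ht)
    rwa [hσ0] at this
  -- This is where the choice φ(y) ≤ 0 is used, together with σ ≥ 0.
  have hden : ∀ t ∈ I, 0 < 1 - φ y * σ t := fun t ht => by
    nlinarith [mul_nonneg (neg_nonneg.2 hy) (hσnonneg t ht)]
  have hGx : ∀ x, ∀ t ∈ I, G x t = G y t * (1 + (φ x - φ y) * σ t) := fun x t ht => by
    have h2 := eq_of_hasDerivWithinAt_zero hI (g := fun t => G x t / G y t - (φ x - φ y) * σ t)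
      (fun t ht => ((hquot x t ht).sub ((hσ t ht).const_mul _)).congr_deriv (sub_self _)) h0 ht
    simp only [hG0, hσ0] at h2
    have h3 : G x t / G y t = 1 + (φ x - φ y) * σ t := by linarith
    rw [← h3, mul_div_cancel₀ _ (hGpos y t ht).ne']
  -- Regrouping G y (1 + (φ x - φ y) σ) as A (1 + τ φ x): a Möbius change of parameter from the
  -- solution at y to the one with initial data 1 and 0.
  let A (t : ℝ) : ℝ := G y t * (1 - φ y * σ t)
  let τ (t : ℝ) : ℝ := σ t / (1 - φ y * σ t)
  have hA : ∀ t ∈ I, 0 < A t := fun t ht => mul_pos (hGpos y t ht) (hden t ht)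
  have hGA : ∀ x, ∀ t ∈ I, G x t = A t * (1 + τ t * φ x) := fun x t ht => by
    have := (hden t ht).ne'
    rw [hGx x t ht]
    simp only [A, τ]
    field_simp
    ring
  have hτ : ∀ t ∈ I, τ t ∈ positiveTimes φ := fun t ht x => by
    have := hGpos x t ht
    rw [hGA x t ht] at this
    exact pos_of_mul_pos_right this (hA t ht).le
  have hprofile : ∀ t ∈ I, u t = profile p f φ (τ t) (A t) := fun t ht => by
    funext x
    rw [hpow x t ht, hGA x t ht, Real.mul_rpow (hA t ht).le (hτ t ht x).le, profile]
    ring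
  have hmass : ∀ t ∈ I, A t ^ p * Z (τ t) = 1 := fun t ht => by
    have h1 := (hsol t ht).1.2
    rw [hprofile t ht] at h1
    simp only [profile] at h1
    rwa [integral_const_mul] at h1
  have hτd : ∀ t ∈ I, HasDerivWithinAt τ (Z (τ t) ^ (2 / p)) I t := fun t ht => by
    refine ((hσ t ht).div (((hσ t ht).const_mul (φ y)).const_sub 1) (hden t ht).ne').congr_deriv ?_
    have h1 : Z (τ t) = (A t ^ p)⁻¹ := eq_inv_of_mul_eq_one_right (hmass t ht)
    have h2 : Z (τ t) ^ (2 / p) = 1 / A t ^ 2 := by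
      rw [h1, ← Real.rpow_neg (hA t ht).le, ← Real.rpow_mul (hA t ht).le,
        show -p * (2 / p) = -2 by field_simp, Real.rpow_neg (hA t ht).le, one_div]
      norm_cast
    rw [h2]
    simp only [A]
    have := (hden t ht).ne'
    have := (hGpos y t ht).ne'
    field_simp
    ring
  have hcont := continuous_direction hp.ne' hf ha hpos
  have hclock : clock p Z (τ t) = t := by
    -- The clock has derivative Z^(-2/p) and τ has derivative Z(τ)^(2/p), so the clock along τ runs
    -- at unit speed.
    have h1 := eq_of_hasDerivWithinAt_zero hI (g := fun t => clock p Z (τ t) - t) (fun t ht => by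
      have hZpos := geodesicMass_pos (lam := lam) hp.ne' hf ha hpos (hτ t ht)
      have h2 := (hasDerivAt_clock (p := p) (Z := Z) (isOpen_positiveTimes hcont)
        (ordConnected_positiveTimes _) (zero_mem_positiveTimes _)
        (fun τ hτ =>
          (hasDerivAt_geodesicMass hp.ne' hf ha hpos hτ).continuousAt.continuousWithinAt)
        (fun τ hτ => geodesicMass_pos hp.ne' hf ha hpos hτ) (hτ t ht)).hasDerivAt
      refine ((h2.comp_hasDerivWithinAt t (hτd t ht)).sub (hasDerivWithinAt_id t I)).congr_deriv ?_
      rw [← Real.rpow_add hZpos, neg_add_cancel, Real.rpow_zero, sub_self]) h0 ht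
    have h3 : τ 0 = 0 := by simp [τ, hσ0]
    simp only [h3, clock_zero, sub_zero] at h1
    linarith
  exact ⟨τ t, hτ t ht, A t, hclock, hmass t ht, hprofile t ht⟩

theorem IsExplicitPosition.lt_geodesicLifetime {p : ℝ} (hp : p ≠ 0) {f a : M → ℝ}
    (hf : Continuous f) (ha : Continuous a) (hpos : ∀ x, 0 < f x) {t : ℝ} {F : M → ℝ}
    (h : IsExplicitPosition lam p f a t F) : (t : EReal) < geodesicLifetime lam p f a := by
  obtain ⟨τ, hτ, -, rfl, -⟩ := h
  exact clock_lt_lifetime (isOpen_positiveTimes (continuous_direction hp hf ha hpos))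
    (ordConnected_positiveTimes _) (zero_mem_positiveTimes _)
    (fun τ hτ => (hasDerivAt_geodesicMass hp hf ha hpos hτ).continuousAt.continuousWithinAt)
    (fun τ hτ => geodesicMass_pos hp hf ha hpos hτ) hτ

/-- In a space of functions in which convergence implies pointwise convergence, the explicit solution
is the maximal one. -/
theorem isMaximalGeodesicSolution {X : Type*} [AddCommGroup X] [Module ℝ X]
    [TopologicalSpace X] [FunLike X M ℝ] (ev : M → X →ₗ[ℝ] ℝ) (hev : ∀ x F, ev x F = F x)
    (htendsto : ∀ (l : Filter ℝ) (F : ℝ → X) (G : X), Tendsto F l (𝓝 G) →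
      ∀ x, Tendsto (fun t => ev x (F t)) l (𝓝 (ev x G)))
    {α p : ℝ} (hp : 0 < p) (hα : 1 / expPStar α = (p - 1) / p) {f a : X} (hf : Continuous f)
    (ha : Continuous a) (hprob : IsProb lam f) (htan : IsTangent lam a) {u : ℝ → X}
    (hu : IsGeodesicSolution lam α f a (geodesicLifetime lam p f a) u)
    (hexp : ∀ t ∈ timeInterval (geodesicLifetime lam p f a),
      IsExplicitPosition lam p f a t (u t)) :
    IsMaximalGeodesicSolution lam α f a (geodesicLifetime lam p f a) u := by
  refine ⟨hu, fun S u' ⟨hS, v', w', hC, hu0, hv0, hsol⟩ => ?_⟩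
  have hder : ∀ {F : ℝ → X} {G : X} {t : ℝ}, Tendsto (slope F t) (𝓝[timeInterval S \ {t}] t) (𝓝 G) →
      ∀ x, HasDerivWithinAt (fun s => F s x) (G x) (timeInterval S) t := by
    intro F G t h x
    rw [hasDerivWithinAt_iff_tendsto_slope]
    have h1 := htendsto _ _ _ h x
    simp only [map_slope] at h1
    simpa only [hev] using h1
  have hexp' : ∀ t ∈ timeInterval S, IsExplicitPosition lam p f a t (u' t) := fun t ht =>
    isExplicitPosition_of_geodesicEquation hp hα hf ha hprob htan (convex_timeInterval S)
      (zero_mem_timeInterval hS) (fun t ht => ht.1) (u := fun t => u' t) (v := fun t => v' t)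
      (w := fun t => w' t) (fun x t ht => hder (hC.velocity t ht) x)
      (fun x t ht => hder (hC.acceleration t ht) x) hsol (by rw [hu0]) (by rw [hv0]) ht
  -- Otherwise the lifetime would be a real time reached by the solution, where the explicit formula
  -- puts the time strictly below the lifetime.
  have hle : S ≤ geodesicLifetime lam p f a := by
    by_contra! hlt
    have hT := geodesicLifetime_pos (lam := lam) hp hf ha hprob.1
    generalize hTe : geodesicLifetime lam p f a = T at *
    induction T with
    | bot => simp at hT
    | top => simp at hlt
    | coe r =>
      have hr : r ∈ timeInterval S := ⟨by exact_mod_cast hT.le, hlt⟩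
      have := (hexp' r hr).lt_geodesicLifetime hp.ne' hf ha hprob.1
      rw [hTe] at this
      exact lt_irrefl _ this
  refine ⟨hle, fun t ht => DFunLike.coe_injective ?_⟩
  exact (hexp' t ht).eq hp.ne' hf ha hprob.1 (hexp t ⟨ht.1, ht.2.trans_le hle⟩)

end Uniqueness

end FisherRao

end

noncomputable section

namespace FisherRao

open scoped ENNReal NNReal

section Exponents

theorem expP_pos {α : ℝ} (hα : α ∈ Ioo (-1 : ℝ) 1) : 0 < expP α :=
  div_pos two_pos (by linarith [hα.2])

theorem one_div_expPStar {α : ℝ} (hα : α ∈ Ioo (-1 : ℝ) 1) :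
    1 / expPStar α = (expP α - 1) / expP α := by
  have h1 : (1 - α) ≠ 0 := by linarith [hα.2]
  have h2 : (1 + α) ≠ 0 := by linarith [hα.1]
  simp only [expP, expPStar]
  field_simp
  ring

theorem expPStar_pos {α : ℝ} (hα : α ∈ Ioo (-1 : ℝ) 1) : 0 < expPStar α :=
  div_pos two_pos (by linarith [hα.1])

end Exponents

/-! ### Maximal solutions and independence of the Sobolev order. -/

section MaximalSolutions

theorem IsMaximalGeodesicSolution.unique {M : Type*} [MeasurableSpace M] {lam : Measure M} {X : Type*} [AddCommGroup X] [Module ℝ X]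
    [TopologicalSpace X] [FunLike X M ℝ] {α : ℝ} {f a : X} {T T' : EReal} {u u' : ℝ → X}
    (h : IsMaximalGeodesicSolution lam α f a T u)
    (h' : IsMaximalGeodesicSolution lam α f a T' u') :
    T = T' ∧ ∀ t ∈ timeInterval T, u t = u' t :=
  ⟨((h'.2 T u h.1).1).antisymm (h.2 T' u' h'.1).1, (h'.2 T u h.1).2⟩

variable {n : ℕ} {M : Type*} [TopologicalSpace M] [CompactSpace M]
  [ChartedSpace (EuclideanSpace ℝ (Fin n)) M] [IsManifold (𝓡 n) ∞ M] [MeasurableSpace M]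
  [BorelSpace M] {lam : Measure M} [IsProbabilityMeasure lam]

theorem SobolevSpace.isMaximalGeodesicSolution {k : ℝ} (hk : (n : ℝ) / 2 < k) {α p : ℝ} (hp : 0 < p)
    (hα : 1 / expPStar α = (p - 1) / p) {f a : SobolevSpace n M k} (hprob : IsProb lam f)
    (htan : IsTangent lam a) {u : ℝ → SobolevSpace n M k}
    (hu : IsGeodesicSolution lam α f a (geodesicLifetime lam p f a) u)
    (hexp : ∀ t ∈ timeInterval (geodesicLifetime lam p f a),
      IsExplicitPosition lam p f a t (u t)) :
    IsMaximalGeodesicSolution lam α f a (geodesicLifetime lam p f a) u :=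
  FisherRao.isMaximalGeodesicSolution
    (fun x => { toFun := fun F => F x, map_add' := fun _ _ => rfl, map_smul' := fun _ _ => rfl })
    (fun _ _ => rfl) (fun _ _ _ h x => SobolevSpace.tendsto_apply hk h x) hp hα f.continuous
    a.continuous hprob htan hu hexp

theorem smooth_isMaximalGeodesicSolution {α p : ℝ} (hp : 0 < p)
    (hα : 1 / expPStar α = (p - 1) / p) {f a : C^∞⟮𝓡 n, M; 𝓘(ℝ, ℝ), ℝ⟯} (hprob : IsProb lam f)
    (htan : IsTangent lam a) {u : ℝ → C^∞⟮𝓡 n, M; 𝓘(ℝ, ℝ), ℝ⟯}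
    (hu : IsGeodesicSolution lam α f a (geodesicLifetime lam p f a) u)
    (hexp : ∀ t ∈ timeInterval (geodesicLifetime lam p f a),
      IsExplicitPosition lam p f a t (u t)) :
    IsMaximalGeodesicSolution lam α f a (geodesicLifetime lam p f a) u :=
  FisherRao.isMaximalGeodesicSolution
    (fun x => { toFun := fun F => F x, map_add' := fun _ _ => rfl, map_smul' := fun _ _ => rfl })
    (fun _ _ => rfl) (fun _ _ _ h x => ((continuous_eval_const x).tendsto _).comp
      (tendsto_toContinuous h)) hp hα f.contMDiff.continuous
    a.contMDiff.continuous hprob htan hu hexp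

theorem isExplicitPosition_of_isMaximalGeodesicSolution {k : ℝ} (hk : (n : ℝ) / 2 < k) {α p : ℝ}
    (hp : 0 < p) (hα : 1 / expPStar α = (p - 1) / p) {f a : SobolevSpace n M k}
    (hprob : IsProb lam f) (htan : IsTangent lam a) {T : EReal} {u : ℝ → SobolevSpace n M k}
    (h : IsMaximalGeodesicSolution lam α f a T u) :
    T = geodesicLifetime lam p f a ∧
      ∀ t ∈ timeInterval T, IsExplicitPosition lam p f a t (u t) := by
  obtain ⟨u', hu', hexp⟩ := exists_sobolev_solution hk hp hα hprob htan
  obtain ⟨rfl, h2⟩ := h.unique (SobolevSpace.isMaximalGeodesicSolution hk hp hα hprob htan hu' hexp)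
  exact ⟨rfl, fun t ht => by rw [h2 t ht]; exact hexp t ht⟩

/-- The maximal solutions in all Sobolev spaces and in the smooth functions are given by the same
formula. -/
theorem exists_maximal_smooth_solution {α p : ℝ} (hp : 0 < p)
    (hα : 1 / expPStar α = (p - 1) / p) {f a : C^∞⟮𝓡 n, M; 𝓘(ℝ, ℝ), ℝ⟯} (hprob : IsProb lam f)
    (htan : IsTangent lam a) :
    ∃ (T : EReal) (u : ℝ → C^∞⟮𝓡 n, M; 𝓘(ℝ, ℝ), ℝ⟯), IsMaximalGeodesicSolution lam α f a T u ∧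
      ∀ k : ℝ, (n : ℝ) / 2 < k → ∃ u' : ℝ → SobolevSpace n M k,
        (∀ t ∈ timeInterval T, ∀ x, u' t x = u t x) ∧
        IsMaximalGeodesicSolution lam α (toSobolev k f) (toSobolev k a) T u' := by
  obtain ⟨u, hu, hexp⟩ := exists_smooth_solution hp hα hprob htan
  refine ⟨_, u, smooth_isMaximalGeodesicSolution hp hα hprob htan hu hexp, fun k hk => ?_⟩
  obtain ⟨u', hu', hexp'⟩ := exists_sobolev_solution hk hp hα (f := toSobolev k f)
    (a := toSobolev k a) hprob htan
  refine ⟨u', fun t ht x => ?_, SobolevSpace.isMaximalGeodesicSolution hk hp hα hprob htan hu' hexp'⟩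
  exact congrFun ((hexp' t ht).eq hp.ne' f.contMDiff.continuous a.contMDiff.continuous hprob.1
    (hexp t ht)) x

/-- Neither `geodesicLifetime` nor `IsExplicitPosition` involves the order: both depend on the
underlying functions only. -/
theorem IsMaximalGeodesicSolution.sobolev_order {k l : ℝ} (hk : (n : ℝ) / 2 < k)
    (hl : (n : ℝ) / 2 < l) {α p : ℝ} (hp : 0 < p) (hα : 1 / expPStar α = (p - 1) / p)
    {f a : SobolevSpace n M k} {f' a' : SobolevSpace n M l} (hf : ⇑f = f') (ha : ⇑a = a')
    (hprob : IsProb lam f) (htan : IsTangent lam a) {T T' : EReal}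
    {u : ℝ → SobolevSpace n M k} {u' : ℝ → SobolevSpace n M l}
    (h : IsMaximalGeodesicSolution lam α f a T u)
    (h' : IsMaximalGeodesicSolution lam α f' a' T' u') :
    T = T' ∧ ∀ t ∈ timeInterval T, ∀ x, u t x = u' t x := by
  obtain ⟨hT, hexp⟩ := isExplicitPosition_of_isMaximalGeodesicSolution hk hp hα hprob htan h
  obtain ⟨hT', hexp'⟩ := isExplicitPosition_of_isMaximalGeodesicSolution hl hp hα (hf ▸ hprob)
    (ha ▸ htan) h'
  rw [← hf, ← ha] at hT' hexp'
  obtain rfl := hT.trans hT'.symm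
  exact ⟨rfl, fun t ht x => congrFun ((hexp t ht).eq hp.ne' f.continuous a.continuous hprob.1
    (hexp' t ht)) x⟩

end MaximalSolutions

end FisherRao

end

noncomputable section

namespace FisherRao

open scoped ENNReal NNReal

/-! ### The mixed second derivative of the α-divergence. -/

section MixedDerivative

variable {M : Type*} [TopologicalSpace M] [CompactSpace M]

theorem eventually_add_mul_pos {f b : M → ℝ} (hf : Continuous f) (hb : Continuous b)
    (hpos : ∀ x, 0 < f x) : ∀ᶠ r in 𝓝 (0 : ℝ), ∀ x, 0 < f x + r * b x := by
  filter_upwards [(isOpen_positiveTimes (hb.div hf fun x => (hpos x).ne')).mem_nhds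
    (zero_mem_positiveTimes _)] with r hr x
  have h := mul_pos (hpos x) (hr x)
  have := (hpos x).ne'
  simp only [Pi.div_apply] at h
  field_simp at h
  exact h

variable [MeasurableSpace M] [BorelSpace M] (lam : Measure M) [IsFiniteMeasure lam]

/-- Factor (f + r b)^q = f^q (1 + r b/f)^q and use the curve of powers in C(M). -/
theorem hasDerivAt_integral_mul_rpow {h f b : M → ℝ} (hh : Continuous h) (hf : Continuous f)
    (hb : Continuous b) (hpos : ∀ x, 0 < f x) (q : ℝ) :
    HasDerivAt (fun r => ∫ x, h x * (f x + r * b x) ^ q ∂lam)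
      (q * ∫ x, h x * b x * f x ^ (q - 1) ∂lam) 0 := by
  have hdiv : Continuous fun x => b x / f x := hb.div hf fun x => (hpos x).ne'
  have hcont : Continuous fun x => h x * f x ^ q :=
    hh.mul (hf.rpow_const fun x => Or.inl (hpos x).ne')
  refine ((hasDerivAt_integral_rpow lam hcont hdiv q
    (zero_mem_positiveTimes _)).congr_of_eventuallyEq ?_).congr_deriv ?_
  · filter_upwards [(isOpen_positiveTimes hdiv).mem_nhds (zero_mem_positiveTimes _)] with r hr
    congr 1
    funext x
    rw [mul_assoc, ← Real.mul_rpow (hpos x).le (hr x).le]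
    have := (hpos x).ne'
    congr 2
    field_simp
  · congr 2
    funext x
    rw [zero_mul, add_zero, Real.one_rpow, mul_one, Real.rpow_sub_one (hpos x).ne']
    ring

/-- The mass terms disappear from the mixed derivative, and the prefactor p* p cancels against the
exponents 1/p* and 1/p brought down by the two derivatives. -/
theorem alphaDivergenceMixed_eq {α : ℝ} (hα : α ∈ Ioo (-1 : ℝ) 1) {f g b c : M → ℝ}
    (hf : Continuous f) (hg : Continuous g) (hb : Continuous b) (hc : Continuous c)
    (hfpos : ∀ x, 0 < f x) (hgpos : ∀ x, 0 < g x) :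
    alphaDivergenceMixed lam α f g b c =
      -∫ x, c x * g x ^ (1 / expPStar α - 1) * (b x * f x ^ (1 / expP α - 1)) ∂lam := by
  have hp := (expP_pos hα).ne'
  have hp' := (expPStar_pos hα).ne'
  have hpow : ∀ {F : M → ℝ}, Continuous F → (∀ x, 0 < F x) → ∀ q : ℝ,
      Continuous fun x => F x ^ q := fun hF h q => hF.rpow_const fun x => Or.inl (h x).ne'
  have hinner : ∀ F : M → ℝ, Continuous F → (∀ x, 0 < F x) →
      deriv (fun r : ℝ => alphaDivergence lam α F (g + r • c)) 0 = expP α * ∫ x, c x ∂lam -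
        expP α * ∫ x, c x * g x ^ (1 / expPStar α - 1) * F x ^ (1 / expP α) ∂lam := by
    intro F hF hFpos
    have h1 : HasDerivAt (fun r : ℝ => ∫ x, (g + r • c) x ∂lam) (∫ x, c x ∂lam) 0 := by
      have h2 : (fun r : ℝ => ∫ x, (g + r • c) x ∂lam) =
          fun r => ∫ x, g x ∂lam + r * ∫ x, c x ∂lam := by
        funext r
        rw [← integral_const_mul]
        exact integral_add (integrable_of_continuous lam hg)
          ((integrable_of_continuous lam hc).const_mul r)
      rw [h2]
      simpa using ((hasDerivAt_id (0 : ℝ)).mul_const (∫ x, c x ∂lam)).const_add (∫ x, g x ∂lam)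
    have h3 := hasDerivAt_integral_mul_rpow lam (hpow hF hFpos (1 / expP α)) hg hc hgpos
      (1 / expPStar α)
    have h4 := ((h1.const_mul (expP α)).add_const (expPStar α * ∫ x, F x ∂lam)).sub
      (h3.const_mul (expPStar α * expP α))
    refine h4.deriv.trans ?_
    congr 1
    rw [← mul_assoc, show expPStar α * expP α * (1 / expPStar α) = expP α by field_simp]
    congr 2
    funext x
    ring
  have hcg : Continuous fun x => c x * g x ^ (1 / expPStar α - 1) := hc.mul (hpow hg hgpos _)
  have h5 := ((hasDerivAt_integral_mul_rpow lam hcg hf hb hfpos (1 / expP α)).const_mul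
    (expP α)).const_sub (expP α * ∫ x, c x ∂lam)
  rw [alphaDivergenceMixed]
  refine (Filter.EventuallyEq.deriv_eq ?_).trans (h5.deriv.trans ?_)
  -- The formula for the inner derivative needs positivity of f + s b, available only for s near 0;
  -- the outer derivative needs no more.
  · filter_upwards [eventually_add_mul_pos hf hb hfpos] with s hs
    exact hinner (f + s • b) (hf.add (hb.const_smul s)) hs
  · rw [← mul_assoc, mul_one_div_cancel hp, one_mul]
    congr 2
    funext x
    ring

end MixedDerivative

/-! ### Geodesics of the α-connection and the equation (*). -/

section GeodesicsOfTheConnection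

variable {n : ℕ} {M : Type*} [TopologicalSpace M] [CompactSpace M]
  [ChartedSpace (EuclideanSpace ℝ (Fin n)) M] [IsManifold (𝓡 n) ∞ M]

theorem hasDerivWithinAt_toContinuous {u : ℝ → C^∞⟮𝓡 n, M; 𝓘(ℝ, ℝ), ℝ⟯}
    {v : C^∞⟮𝓡 n, M; 𝓘(ℝ, ℝ), ℝ⟯} {J : Set ℝ} {t : ℝ}
    (h : Tendsto (slope u t) (𝓝[J \ {t}] t) (𝓝 v)) :
    HasDerivWithinAt (fun s => toContinuous (u s)) (toContinuous v) J t := by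
  rw [hasDerivWithinAt_iff_tendsto_slope]
  have h1 := tendsto_toContinuous h
  simpa only [map_slope] using h1

theorem hasDerivWithinAt_apply {u : ℝ → C^∞⟮𝓡 n, M; 𝓘(ℝ, ℝ), ℝ⟯}
    {v : C^∞⟮𝓡 n, M; 𝓘(ℝ, ℝ), ℝ⟯} {J : Set ℝ} {t : ℝ}
    (h : Tendsto (slope u t) (𝓝[J \ {t}] t) (𝓝 v)) (x : M) :
    HasDerivWithinAt (fun s => u s x) (v x) J t :=
  (ContinuousMap.evalCLM ℝ x : C(M, ℝ) →L[ℝ] ℝ).hasFDerivAt.comp_hasDerivWithinAt t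
    (hasDerivWithinAt_toContinuous h)

theorem continuousOn_uncurry {u : ℝ → C^∞⟮𝓡 n, M; 𝓘(ℝ, ℝ), ℝ⟯} {J : Set ℝ}
    (h : ContinuousOn (fun t => toContinuous (u t)) J) :
    ContinuousOn (fun q : ℝ × M => u q.1 q.2) (J ×ˢ univ) := by
  have h1 : ContinuousOn (fun q : ℝ × M => (toContinuous (u q.1), q.2)) (J ×ˢ univ) :=
    (h.comp continuousOn_fst fun q hq => hq.1).prodMk continuousOn_snd
  exact (continuous_eval (F := C(M, ℝ))).comp_continuousOn h1

variable [MeasurableSpace M] [BorelSpace M] {lam : Measure M} [IsProbabilityMeasure lam]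

theorem hasDerivWithinAt_integral {u : ℝ → C^∞⟮𝓡 n, M; 𝓘(ℝ, ℝ), ℝ⟯}
    {v : C^∞⟮𝓡 n, M; 𝓘(ℝ, ℝ), ℝ⟯} {J : Set ℝ} {t : ℝ}
    (h : Tendsto (slope u t) (𝓝[J \ {t}] t) (𝓝 v)) :
    HasDerivWithinAt (fun s => ∫ x, u s x ∂lam) (∫ x, v x ∂lam) J t :=
  (integralCLM lam).hasFDerivAt.comp_hasDerivWithinAt t (hasDerivWithinAt_toContinuous h)

/-- The time derivative that defines the covariant derivative of the velocity. -/
theorem hasDerivWithinAt_alphaDivergenceMixed {α : ℝ} (hα : α ∈ Ioo (-1 : ℝ) 1)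
    {u v w : ℝ → C^∞⟮𝓡 n, M; 𝓘(ℝ, ℝ), ℝ⟯} {J : Set ℝ} (hJ : Convex ℝ J) (hJc : IsCompact J)
    (h : IsC2Curve J u v w) (hpos : ∀ t ∈ J, ∀ x, 0 < u t x) {t : ℝ} (ht : t ∈ J)
    (c : C^∞⟮𝓡 n, M; 𝓘(ℝ, ℝ), ℝ⟯) :
    HasDerivWithinAt (fun s => alphaDivergenceMixed lam α (u s) (u t) (v s) c)
      (-∫ x, (w t x - 1 / expPStar α * (v t x ^ 2 / u t x)) / u t x * c x ∂lam) J t := by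
  have hcont : ∀ F : C^∞⟮𝓡 n, M; 𝓘(ℝ, ℝ), ℝ⟯, Continuous F := fun F => F.contMDiff.continuous
  have hrel : 1 / expP α - 1 = -(1 / expPStar α) := by
    rw [one_div_expPStar hα]
    have := (expP_pos hα).ne'
    field_simp
    ring
  set κ := 1 / expPStar α
  have hu : ContinuousOn (fun q : ℝ × M => u q.1 q.2) (J ×ˢ univ) :=
    continuousOn_uncurry fun s hs => (hasDerivWithinAt_toContinuous (h.velocity s hs)).continuousWithinAt
  have hv : ContinuousOn (fun q : ℝ × M => v q.1 q.2) (J ×ˢ univ) :=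
    continuousOn_uncurry fun s hs =>
      (hasDerivWithinAt_toContinuous (h.acceleration s hs)).continuousWithinAt
  have hw : ContinuousOn (fun q : ℝ × M => w q.1 q.2) (J ×ˢ univ) :=
    continuousOn_uncurry fun s hs => tendsto_toContinuous (h.continuousOn s hs)
  -- Collects the factors frozen at time t. The time derivative falls on v u^(-κ), because 1/p - 1 =
  -- -1/p*.
  let H (x : M) : ℝ := c x * u t x ^ (κ - 1)
  have hH : Continuous H := (hcont c).mul
    ((hcont (u t)).rpow_const fun x => Or.inl (hpos t ht x).ne')
  let F (s : ℝ) (x : M) : ℝ := H x * (v s x * u s x ^ (-κ))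
  let F' (s : ℝ) (x : M) : ℝ :=
    H x * (w s x * u s x ^ (-κ) + v s x * (v s x * -κ * u s x ^ (-κ - 1)))
  have hpow : ∀ q : ℝ, ContinuousOn (fun r : ℝ × M => u r.1 r.2 ^ q) (J ×ˢ univ) := fun q =>
    hu.rpow_const fun r hr => Or.inl (hpos r.1 hr.1 r.2).ne'
  have hF'c : ContinuousOn (fun q : ℝ × M => F' q.1 q.2) (J ×ˢ univ) :=
    (hH.comp continuous_snd).continuousOn.mul ((hw.mul (hpow _)).add
      (hv.mul ((hv.mul continuousOn_const).mul (hpow _))))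
  -- Joint continuity on the compact set J × M supplies the bound for differentiating under the
  -- integral.
  obtain ⟨C, hC⟩ := (hJc.prod isCompact_univ).exists_bound_of_continuousOn hF'c
  have hd := hasDerivWithinAt_integral_of_bounded lam hJ (F := F) (F' := F') (fun s hs =>
      hH.mul ((hcont (v s)).mul ((hcont (u s)).rpow_const fun x => Or.inl (hpos s hs x).ne')))
    (fun x s hs => ((hasDerivWithinAt_apply (h.acceleration s hs) x).mul
      ((hasDerivWithinAt_apply (h.velocity s hs) x).rpow_const
        (Or.inl (hpos s hs x).ne'))).const_mul (H x))
    (fun s hs x => hC (s, x) ⟨hs, mem_univ x⟩) ht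
  have heq : ∀ s ∈ J, alphaDivergenceMixed lam α (u s) (u t) (v s) c = -∫ x, F s x ∂lam :=
    fun s hs => by
      rw [alphaDivergenceMixed_eq lam hα (hcont _) (hcont _) (hcont _) (hcont _) (hpos s hs)
        (hpos t ht), hrel]
  refine (hd.neg.congr heq (heq t ht)).congr_deriv ?_
  congr 2
  funext x
  have hux := hpos t ht x
  simp only [F', H]
  rw [Real.rpow_sub_one hux.ne', Real.rpow_sub_one hux.ne', Real.rpow_neg hux.le]
  have := hux.ne'
  have := (Real.rpow_pos_of_pos hux κ).ne'
  field_simp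
  ring

/-- Test with c = q - ∫ q, which is tangent: the integral of (q - ∫ q)² vanishes. Continuity and
positivity of the measure on open sets make the conclusion pointwise. -/
theorem eq_integral_of_forall_isTangent [lam.IsOpenPosMeasure] {q : C^∞⟮𝓡 n, M; 𝓘(ℝ, ℝ), ℝ⟯}
    (h : ∀ c : C^∞⟮𝓡 n, M; 𝓘(ℝ, ℝ), ℝ⟯, IsTangent lam c → ∫ x, q x * c x ∂lam = 0) (x : M) :
    q x = ∫ y, q y ∂lam := by
  set m := ∫ y, q y ∂lam
  have hq : Continuous q := q.contMDiff.continuous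
  have hint := integrable_of_continuous lam hq
  let c : C^∞⟮𝓡 n, M; 𝓘(ℝ, ℝ), ℝ⟯ := ⟨fun x => q x - m, q.contMDiff.sub contMDiff_const⟩
  have hc : ∫ x, c x ∂lam = 0 := by
    have : ∫ x, c x ∂lam = ∫ x, q x ∂lam - ∫ _, m ∂lam := integral_sub hint (integrable_const m)
    rw [this, integral_const, probReal_univ, one_smul, sub_self]
  have hsq : ∫ x, (q x - m) ^ 2 ∂lam = 0 := by
    have h1 : ∀ x, (q x - m) ^ 2 = q x * c x - m * c x := fun x => by
      change _ = q x * (q x - m) - m * (q x - m)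
      ring
    simp only [h1]
    have hcc : Continuous c := c.contMDiff.continuous
    have h2 : Integrable (fun x => q x * c x) lam := integrable_of_continuous lam (hq.mul hcc)
    rw [integral_sub h2 ((integrable_of_continuous lam hcc).const_mul m), h c hc,
      integral_const_mul, hc, mul_zero, sub_zero]
  have hcont : Continuous fun x => (q x - m) ^ 2 := (hq.sub continuous_const).pow 2
  rw [integral_eq_zero_iff_of_nonneg (fun x => sq_nonneg _)
    (integrable_of_continuous lam hcont)] at hsq
  have h2 := congrFun ((hcont.ae_eq_iff_eq lam continuous_const).1 hsq) x
  exact sub_eq_zero.1 (pow_eq_zero_iff two_ne_zero |>.1 h2)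

/-- With q = (w - (1/p*) v²/u)/u, the curve is a geodesic if and only if ∫ q c = 0 for all tangent
c, that is, if and only if q is constant in space. Conservation of mass gives ∫ w = 0, which
identifies the constant with the multiplier on the right side of (*). -/
theorem isAlphaGeodesic_iff [lam.IsOpenPosMeasure] {α : ℝ} (hα : α ∈ Ioo (-1 : ℝ) 1)
    {u v w : ℝ → C^∞⟮𝓡 n, M; 𝓘(ℝ, ℝ), ℝ⟯} (h : IsC2Curve (Icc 0 1) u v w)
    (hprob : ∀ t ∈ Icc (0 : ℝ) 1, IsProb lam (u t)) :
    IsAlphaGeodesic lam α (Icc 0 1) u v ↔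
      ∀ t ∈ Icc (0 : ℝ) 1, GeodesicEquation lam α (u t) (v t) (w t) := by
  have huniq := uniqueDiffOn_Icc (zero_lt_one (α := ℝ))
  have hvint : ∀ t ∈ Icc (0 : ℝ) 1, ∫ x, v t x ∂lam = 0 := fun t ht =>
    (huniq t ht).eq_deriv _ (hasDerivWithinAt_integral (h.velocity t ht))
      ((hasDerivWithinAt_const t _ (1 : ℝ)).congr (fun s hs => (hprob s hs).2) (hprob t ht).2)
  have hwint : ∀ t ∈ Icc (0 : ℝ) 1, ∫ x, w t x ∂lam = 0 := fun t ht =>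
    (huniq t ht).eq_deriv _ (hasDerivWithinAt_integral (h.acceleration t ht))
      ((hasDerivWithinAt_const t _ (0 : ℝ)).congr (fun s hs => hvint s hs) (hvint t ht))
  refine forall₂_congr fun t ht => ?_
  have hpos := (hprob t ht).1
  have hcont : ∀ F : C^∞⟮𝓡 n, M; 𝓘(ℝ, ℝ), ℝ⟯, Continuous F := fun F => F.contMDiff.continuous
  set κ := 1 / expPStar α with hκ
  let q : C^∞⟮𝓡 n, M; 𝓘(ℝ, ℝ), ℝ⟯ :=
    ⟨fun x => (w t x - κ * (v t x ^ 2 / u t x)) / u t x, fun x => by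
      have h1 : ContDiffAt ℝ ∞ (fun y : ℝ × ℝ × ℝ => (y.1 - κ * (y.2.1 ^ 2 / y.2.2)) / y.2.2)
          (w t x, v t x, u t x) :=
        ContDiffAt.div (contDiffAt_fst.sub (contDiffAt_const.mul
          (ContDiffAt.div (by fun_prop) (by fun_prop) (hpos x).ne'))) (by fun_prop) (hpos x).ne'
      exact h1.contMDiffAt.comp x (((w t).contMDiff x).prodMk_space
        (((v t).contMDiff x).prodMk_space ((u t).contMDiff x)))⟩
  have hqu : ∀ x, w t x - κ * (v t x ^ 2 / u t x) = q x * u t x := fun x =>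
    (div_mul_cancel₀ _ (hpos x).ne').symm
  have hE : ∀ y, (v t y / u t y) ^ 2 * u t y = v t y ^ 2 / u t y := fun y => by
    have := (hpos y).ne'
    field_simp
  have hzero : ∀ c : C^∞⟮𝓡 n, M; 𝓘(ℝ, ℝ), ℝ⟯,
      -fisherRao lam (u t) (0 : C^∞⟮𝓡 n, M; 𝓘(ℝ, ℝ), ℝ⟯) c = 0 := fun c => by
    have h0 : ∀ x, (0 : C^∞⟮𝓡 n, M; 𝓘(ℝ, ℝ), ℝ⟯) x = 0 := fun _ => rfl
    simp [fisherRao, h0]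
  have hder := hasDerivWithinAt_alphaDivergenceMixed (lam := lam) hα (convex_Icc (0 : ℝ) 1)
    isCompact_Icc h (fun t ht => (hprob t ht).1) ht
  have htangent : IsTangent lam (0 : C^∞⟮𝓡 n, M; 𝓘(ℝ, ℝ), ℝ⟯) := integral_zero M ℝ
  constructor
  · rintro ⟨-, hg⟩ x
    have hq := eq_integral_of_forall_isTangent (q := q) (lam := lam) fun c hc => by
      have h1 := (huniq t ht).eq_deriv _ (hder c) (hg c hc)
      rw [hzero] at h1
      exact neg_eq_zero.1 h1
    -- Integrate q u over M: q is constant, u has mass one, and the acceleration has integral zero.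
    have hm : ∫ x, q x ∂lam = -κ * ∫ y, v t y ^ 2 / u t y ∂lam := by
      have h2 : ∫ x, (w t x - κ * (v t x ^ 2 / u t x)) ∂lam = ∫ x, q x ∂lam := by
        simp only [hqu]
        rw [integral_congr_ae (Eventually.of_forall fun x => congrArg (· * u t x) (hq x)),
          integral_const_mul, (hprob t ht).2, mul_one]
      have h3 : Integrable (fun x => v t x ^ 2 / u t x) lam := integrable_of_continuous lam
        (((hcont (v t)).pow 2).div (hcont (u t)) fun x => (hpos x).ne')
      rw [← h2, integral_sub (integrable_of_continuous lam (hcont _)) (h3.const_mul κ),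
        hwint t ht, integral_const_mul]
      ring
    simp only [hE]
    rw [← hκ, hqu, hq, hm]
  · intro hg
    refine ⟨htangent, fun c hc => (hder c).congr_deriv ?_⟩
    rw [hzero, neg_eq_zero]
    have h1 : ∀ x, (w t x - κ * (v t x ^ 2 / u t x)) / u t x =
        -κ * ∫ y, (v t y / u t y) ^ 2 * u t y ∂lam := fun x => by
      rw [hg x, mul_div_cancel_right₀ _ (hpos x).ne']
    simp only [← hκ, h1]
    rw [integral_const_mul, hc, mul_zero]

end GeodesicsOfTheConnection

end FisherRao

end

theorem theorem4p2 {n : ℕ} {M : Type*} [TopologicalSpace M] [T2Space M] [CompactSpace M]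
    [ChartedSpace (EuclideanSpace ℝ (Fin n)) M] [IsManifold (𝓡 n) ∞ M]
    [MeasurableSpace M] [BorelSpace M]
    (lam : Measure M) [IsProbabilityMeasure lam] (hlam : FisherRao.IsSmoothVolume n lam)
    (α : ℝ) (hα : α ∈ Ioo (-1 : ℝ) 1) :
    -- the geodesics of the connection are the solutions of the equation
    (∀ u v w : ℝ → C^∞⟮𝓡 n, M; 𝓘(ℝ, ℝ), ℝ⟯, FisherRao.IsC2Curve (Icc 0 1) u v w →
      (∀ t ∈ Icc (0 : ℝ) 1, FisherRao.IsProb lam (u t)) →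
      (FisherRao.IsAlphaGeodesic lam α (Icc 0 1) u v ↔
        ∀ t ∈ Icc (0 : ℝ) 1, FisherRao.GeodesicEquation lam α (u t) (v t) (w t))) ∧
    -- unique maximal solutions in the Sobolev probability densities
    (∀ k : ℝ, (n : ℝ) / 2 < k → ∀ f a : FisherRao.SobolevSpace n M k,
      FisherRao.IsProb lam f → FisherRao.IsTangent lam a →
      ∃ (T : EReal) (u : ℝ → FisherRao.SobolevSpace n M k),
        FisherRao.IsMaximalGeodesicSolution lam α f a T u) ∧
    -- the maximal interval does not depend on the Sobolev order
    (∀ k l : ℝ, (n : ℝ) / 2 < k → (n : ℝ) / 2 < l →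
      ∀ (f a : FisherRao.SobolevSpace n M k) (f' a' : FisherRao.SobolevSpace n M l),
      (∀ x, f x = f' x) → (∀ x, a x = a' x) →
      FisherRao.IsProb lam f → FisherRao.IsTangent lam a →
      ∀ (T T' : EReal) (u : ℝ → FisherRao.SobolevSpace n M k)
        (u' : ℝ → FisherRao.SobolevSpace n M l),
      FisherRao.IsMaximalGeodesicSolution lam α f a T u →
      FisherRao.IsMaximalGeodesicSolution lam α f' a' T' u' →
      T = T' ∧ ∀ t ∈ FisherRao.timeInterval T, ∀ x, u t x = u' t x) ∧
    -- unique maximal solutions in the smooth probability densities, on the same interval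
    (∀ f a : C^∞⟮𝓡 n, M; 𝓘(ℝ, ℝ), ℝ⟯, FisherRao.IsProb lam f → FisherRao.IsTangent lam a →
      ∃ (T : EReal) (u : ℝ → C^∞⟮𝓡 n, M; 𝓘(ℝ, ℝ), ℝ⟯),
        FisherRao.IsMaximalGeodesicSolution lam α f a T u ∧
        ∀ k : ℝ, (n : ℝ) / 2 < k →
          ∃ (f' a' : FisherRao.SobolevSpace n M k) (u' : ℝ → FisherRao.SobolevSpace n M k),
          (∀ x, f' x = f x) ∧ (∀ x, a' x = a x) ∧
          (∀ t ∈ FisherRao.timeInterval T, ∀ x, u' t x = u t x) ∧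
          FisherRao.IsMaximalGeodesicSolution lam α f' a' T u') := by
  have := hlam.isOpenPosMeasure
  have hp := FisherRao.expP_pos hα
  have hp' := FisherRao.one_div_expPStar hα
  refine ⟨fun u v w h hprob => FisherRao.isAlphaGeodesic_iff hα h hprob,
    fun k hk f a hprob htan => ?_, fun k l hk hl f a f' a' hf ha hprob htan T T' u u' h h' =>
      h.sobolev_order hk hl hp hp' (funext hf) (funext ha) hprob htan h',
    fun f a hprob htan => ?_⟩
  · obtain ⟨u, hu, hexp⟩ := FisherRao.exists_sobolev_solution hk hp hp' hprob htan
    exact ⟨_, u, FisherRao.SobolevSpace.isMaximalGeodesicSolution hk hp hp' hprob htan hu hexp⟩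
  · obtain ⟨T, u, hu, h⟩ := FisherRao.exists_maximal_smooth_solution hp hp' hprob htan
    refine ⟨T, u, hu, fun k hk => ?_⟩
    obtain ⟨u', huu', hu'⟩ := h k hk
    exact ⟨FisherRao.toSobolev k f, FisherRao.toSobolev k a, u', fun _ => rfl, fun _ => rfl, huu',
      hu'⟩
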